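/- Let $k$ be a field, $n\ge 0$, $S=k[x_1,\dots,x_n]$, and let $I=I_{P_n}=(x_1x_2,\,x_2x_3,\,\dots,\,x_{n-1}x_n)\subset S$ be the edge ideal of the path $P_n$ with $n$ vertices. For $d\ge 1$ let $\operatorname{Newt}(I^d)\subset\mathbb R^n$ be the convex hull of the exponent vectors of the minimal monomial generators of $I^d$, and consider, for $1\le i\le n$ and integers $j\ge 0$, the hyperplanes $$H_{i,j}=\{y_i=j\},\qquad H'_{i,j}=\Big\{\sum_{t=0}^{\lfloor (i-1)/2\rfloor}y_{i-2t}=j\Big\},\qquad \overline H_{i,j}=\Big\{\sum_{t=0}^{\lfloor (i-1)/3\rfloor}y_{i-3t}=j\Big\}.$$ Let $Y^d_n$ be the polyhedral subdivision of $\operatorname{Newt}(I^d)$ by all $H_{i,j}$, let $Z^d_n$ be its subdivision by all $H_{i,j}$ and $H'_{i,j}$, and $\overline{Z^d_n}$ its subdivision by all $H_{i,j}$, $H'_{i,j}$ and $\overline H_{i,j}$. Label a vertex $v$ by $x^{\lceil v\rceil}$ (coordinatewise rounding up; this is $x^v$ if $v\in\mathbb N^n$), a cell $C$ by the least common multiple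 $x^{a_C}$ of the labels of its vertices, and the empty face by $1$; orient the cells arbitrarily. The cellular complex $\mathcal F_X$ of such a labelled complex $X$ has in degree $p\geq 0$ the free $S$-module on the faces of dimension $p-1$ (the empty face has dimension $-1$), with differential $\partial(F)=\sum_{G}\operatorname{sign}(G,F)\,x^{a_F-a_G}\,G$, the sum over the faces $G$ of $F$ of codimension one. Let $X_1,X_2,\dots$ be one of the three sequences $(Y^d_n)_{d\ge1}$, $(Z^d_n)_{d\ge1}$, $(\overline{Z^d_n})_{d\ge1}$. Then the following hold. 1. The vertices of $Y^d_n$ and of $Z^d_n$ are exactly the exponent vectors of the minimal monomial generators of $I^d$. 2. Every $X_d$ is finite and supports a cellular resolution of $S/I^d$: the complex $\mathcal F_{X_d}$ is exact in all positive degrees, and its homology in degree $0$ is $S/I^d$. Call a chain map $f:\mathcal F_{X_d}\to\mathcal F_{X_{d+1}}$ a *multiplication by the monomial $x^m$* if $f_0$ is multiplication by $x^m$; if $f$ is multigraded, that is, for all faces $C,D$ the coefficient of $D$ in $f(C)$ is $0$ or $x^{a_D}$ divides $x^{m}x^{a_C}$ and the coefficient is a scalar multiple of $x^{m+a_C-a_D}$;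 and if $f(C)=\pm(C+m)$ for every nonempty cell $C$ of $X_d$ whose translate $C+m$ is a cell of $X_{d+1}$. A *multiplication family* is a category whose objects are $\mathcal F_{X_1},\mathcal F_{X_2},\dots$ and whose morphisms are chain maps, such that $\operatorname{Hom}(\mathcal F_{X_d},\mathcal F_{X_{d+1}})$ consists of exactly one multiplication by $g$ for each minimal monomial generator $g$ of $I$, and such that every morphism is an identity or a composition of morphisms between consecutive objects. 3. A multiplication family exists. 4. Every multiplication family has finitely generated syzygies: for every $p\ge 0$ the functor $\sigma_p$ to the category of $S$-modules, which sends $\mathcal F_{X_d}$ to its $p$-th syzygy module $\operatorname{im}\big(\partial:(\mathcal F_{X_d})_{p+1}\to(\mathcal F_{X_d})_p\big)$ and a morphism to its restriction, is a finitely generated representation; that is, there are finitely many elements of the modules $\sigma_p(\mathcal F_{X_d})$ such that the only subfunctor of $\sigma_p$ that contains all of them is $\sigma_p$ itself. -/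

import Mathlib

open CategoryTheory

noncomputable section

namespace PathPowers

/-! ### Monomial ideals, edge ideals, Newton polytopes -/

/-- The exponent vectors of the minimal monomial generators of a (monomial) ideal. -/
def minGens {K : Type*} [Field K] {n : ℕ} (J : Ideal (MvPolynomial (Fin n) K)) :
    Set (Fin n →₀ ℕ) :=
  {a | Minimal (fun b => MvPolynomial.monomial b (1 : K) ∈ J) a}

/-- The edge ideal of a graph on `n` vertices. -/
def edgeIdeal (K : Type*) [Field K] {n : ℕ} (G : SimpleGraph (Fin n)) :
    Ideal (MvPolynomial (Fin n) K) :=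
  Ideal.span {f | ∃ i j, G.Adj i j ∧ f = MvPolynomial.X i * MvPolynomial.X j}

/-- The edge ideal of the path on `n` vertices. -/
abbrev pathIdeal (K : Type*) [Field K] (n : ℕ) : Ideal (MvPolynomial (Fin n) K) :=
  edgeIdeal K (SimpleGraph.pathGraph n)

/-- The point of `ℝⁿ` with the given exponents as coordinates. -/
def toPoint {n : ℕ} (a : Fin n →₀ ℕ) : Fin n → ℝ := fun i => (a i : ℝ)

/-- The Newton polytope: the convex hull of the exponent vectors of the generators. -/
def newtonPolytope {K : Type*} [Field K] {n : ℕ} (J : Ideal (MvPolynomial (Fin n) K)) :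
    Set (Fin n → ℝ) :=
  convexHull ℝ (toPoint '' minGens J)

/-! ### Subdivisions of polytopes by hyperplanes -/

/-- A pair `(ℓ, j)` stands for the hyperplane `ℓ y = j`. -/
abbrev HyperplaneData (n : ℕ) : Type := ((Fin n → ℝ) →ₗ[ℝ] ℝ) × ℝ

/-- The part of `P` on prescribed closed sides of the hyperplanes
(the upper side for those in `U`, the lower side for the others). -/
def region {n : ℕ} (P : Set (Fin n → ℝ)) (H U : Set (HyperplaneData n)) : Set (Fin n → ℝ) :=
  {y ∈ P | ∀ h ∈ H, (h ∈ U → h.2 ≤ h.1 y) ∧ (h ∉ U → h.1 y ≤ h.2)}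

/-- The cells of the subdivision of the polytope `P` by the hyperplanes in `H`:
all nonempty faces of the closed regions into which the hyperplanes cut `P`. -/
def subdivisionCells {n : ℕ} (P : Set (Fin n → ℝ)) (H : Set (HyperplaneData n)) :
    Set (Set (Fin n → ℝ)) :=
  {C | C.Nonempty ∧ ∃ U, IsExposed ℝ (region P H U) C}

/-- The linear form `y_i + y_{i-s} + y_{i-2s} + ⋯` (all terms with positive index, where the
coordinates are numbered from `1`; the element `i : Fin n` stands for the index `i + 1`). -/
def stepForm {n : ℕ} (s : ℕ) (i : Fin n) : (Fin n → ℝ) →ₗ[ℝ] ℝ :=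
  ∑ t ∈ Finset.range (i.val / s + 1),
    LinearMap.proj (⟨i.val - s * t, lt_of_le_of_lt (Nat.sub_le _ _) i.isLt⟩ : Fin n)

/-- The hyperplanes `y_i = j`. -/
def coordHyperplanes (n : ℕ) : Set (HyperplaneData n) :=
  {h | ∃ (i : Fin n) (j : ℕ), h = (LinearMap.proj i, (j : ℝ))}

/-- The hyperplanes `y_i + y_{i-s} + y_{i-2s} + ⋯ = j`. -/
def stepHyperplanes (n s : ℕ) : Set (HyperplaneData n) :=
  {h | ∃ (i : Fin n) (j : ℕ), h = (stepForm s i, (j : ℝ))}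

/-- The hyperplanes that cut out `Y_n^d`. -/
def hyperplanesY (n : ℕ) : Set (HyperplaneData n) := coordHyperplanes n

/-- The hyperplanes that cut out `Z_n^d`. -/
def hyperplanesZ (n : ℕ) : Set (HyperplaneData n) := hyperplanesY n ∪ stepHyperplanes n 2

/-- The hyperplanes that cut out the refinement of `Z_n^d`. -/
def hyperplanesZbar (n : ℕ) : Set (HyperplaneData n) := hyperplanesZ n ∪ stepHyperplanes n 3

/-! ### Oriented labelled cell complexes and their cellular complexes -/

/-- The linear hull of the cone `{1} × C` over `C`. -/
def coneSpan {n : ℕ} (C : Set (Fin n → ℝ)) : Submodule ℝ (ℝ × (Fin n → ℝ)) :=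
  Submodule.span ℝ ((fun y => ((1 : ℝ), y)) '' C)

/-- The rank of a convex set: its dimension plus one (so `0` for the empty set). -/
def rank {n : ℕ} (C : Set (Fin n → ℝ)) : ℕ := Module.finrank ℝ (coneSpan C)

theorem coneSpan_mono {n : ℕ} {C D : Set (Fin n → ℝ)} (h : C ⊆ D) : coneSpan C ≤ coneSpan D :=
  Submodule.span_mono (Set.image_mono h)

theorem mem_coneSpan {n : ℕ} {C : Set (Fin n → ℝ)} {y : Fin n → ℝ} (h : y ∈ C) :
    ((1 : ℝ), y) ∈ coneSpan C :=
  Submodule.subset_span ⟨y, h, rfl⟩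

/-- A choice of an orientation for every possible cell, given by an ordered basis. -/
abbrev CellOrientation (n : ℕ) : Type :=
  ∀ C : Set (Fin n → ℝ), Module.Basis (Fin (rank C)) ℝ (coneSpan C)

/-- A polyhedral cell complex in `ℝⁿ`, given by its nonempty closed cells, together with
orientations of the cells. -/
structure CellComplex (n : ℕ) where
  cells : Set (Set (Fin n → ℝ))
  orient : CellOrientation n

/-- The subdivision of the Newton polytope of `J` by the hyperplanes in `H`. -/
def newtonComplex {K : Type*} [Field K] {n : ℕ} (J : Ideal (MvPolynomial (Fin n) K))
    (H : Set (HyperplaneData n)) (o : CellOrientation n) : CellComplex n where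
  cells := subdivisionCells (newtonPolytope J) H
  orient := o

namespace CellComplex

variable {n : ℕ}

/-- The faces of rank `p`, that is, of dimension `p - 1`; the only face of rank `0` is the
empty face. -/
def Face (X : CellComplex n) (p : ℕ) : Type :=
  {C : Set (Fin n → ℝ) // (C = ∅ ∨ C ∈ X.cells) ∧ rank C = p}

/-- The exponent vector of the label of a face. A vertex `v` is labelled by the least monomial
whose exponent vector is `≥ v` (this is `x ^ v` if `v` is a lattice point of the orthant), and a
face by the least common multiple of the labels of its vertices. -/
def label (X : CellComplex n) (C : Set (Fin n → ℝ)) : Fin n →₀ ℕ :=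
  Finsupp.equivFunOnFinite.symm
    (fun i => sSup {a : ℕ | ∃ v ∈ C, {v} ∈ X.cells ∧ a = ⌈v i⌉₊})

open Classical in
/-- The incidence number of `G` in `F`: it is `0` unless `G` is a face of `F` of codimension one,
and then it is the sign with which the chosen orientation of `G`, preceded by a vector that
points from `G` into `F`, is positively or negatively oriented in `F`. -/
def sign (X : CellComplex n) (G F : Set (Fin n → ℝ)) : ℤ :=
  if h : G ⊆ F ∧ rank F = rank G + 1 ∧ (F \ G).Nonempty then
    ((SignType.sign ((X.orient F).det (fun i : Fin (rank F) =>
      (Fin.cons ⟨(1, h.2.2.some), mem_coneSpan h.2.2.some_mem.1⟩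
        (fun j => Submodule.inclusion (coneSpan_mono h.1) (X.orient G j)) :
          Fin (rank G + 1) → coneSpan F) (Fin.cast h.2.1 i))) : SignType) : ℤ)
  else 0

/-- The free module of the cellular complex in homological degree `p`. -/
abbrev Chain (K : Type*) [Field K] (X : CellComplex n) (p : ℕ) : Type _ :=
  X.Face p →₀ MvPolynomial (Fin n) K

/-- The differential `∂ F = ∑_G sign(G, F) x^(a_F - a_G) G` of the cellular complex. -/
def bdry (K : Type*) [Field K] (X : CellComplex n) (p : ℕ) :
    X.Chain K (p + 1) →ₗ[MvPolynomial (Fin n) K] X.Chain K p :=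
  Finsupp.linearCombination (MvPolynomial (Fin n) K) (fun F : X.Face (p + 1) =>
    ∑ᶠ G : X.Face p, Finsupp.single G
      (MvPolynomial.monomial (X.label F.1 - X.label G.1) ((X.sign G.1 F.1 : ℤ) : K)))

/-- `X` is a finite complex that supports a cellular resolution of `S / J`: the cellular complex
is exact in all positive degrees, and its homology in degree `0` is `S / J`. -/
def SupportsResolution (K : Type*) [Field K] (X : CellComplex n)
    (J : Ideal (MvPolynomial (Fin n) K)) : Prop :=
  X.cells.Finite ∧
  LinearMap.range (X.bdry K 0) = J • (⊤ : Submodule (MvPolynomial (Fin n) K) (X.Chain K 0)) ∧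
  ∀ p, LinearMap.range (X.bdry K (p + 1)) = LinearMap.ker (X.bdry K p)

/-- The `p`-th syzygy module, as a submodule of the `p`-th free module. -/
def syz (K : Type*) [Field K] (X : CellComplex n) (p : ℕ) :
    Submodule (MvPolynomial (Fin n) K) (X.Chain K p) :=
  LinearMap.range (X.bdry K p)

end CellComplex

/-! ### Morphisms -/

/-- Chain maps between cellular complexes. -/
@[ext]
structure ChainMap (K : Type*) [Field K] {n : ℕ} (X Y : CellComplex n) where
  app : ∀ p, X.Chain K p →ₗ[MvPolynomial (Fin n) K] Y.Chain K p
  comm : ∀ p, (app p).comp (X.bdry K p) = (Y.bdry K p).comp (app (p + 1))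

namespace ChainMap

variable {K : Type*} [Field K] {n : ℕ} {X Y Z : CellComplex n}

/-- The identity chain map. -/
def id (K : Type*) [Field K] {n : ℕ} (X : CellComplex n) : ChainMap K X X where
  app _ := LinearMap.id
  comm _ := rfl

/-- The composition `g ∘ f`. -/
def comp (g : ChainMap K Y Z) (f : ChainMap K X Y) : ChainMap K X Z where
  app p := (g.app p).comp (f.app p)
  comm p := by
    rw [LinearMap.comp_assoc, f.comm, ← LinearMap.comp_assoc, g.comm, LinearMap.comp_assoc]

/-- The chain map `f` is a multiplication by the monomial `x ^ m`: it is multiplication by `x ^ m`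
in degree `0`; it is multigraded, that is, its matrix entries are scalar multiples of the monomials
`x ^ m x ^ (a_C) / x ^ (a_D)`; and every cell that the translation by `m` (which multiplies the
labels by `x ^ m`) carries to a cell of `Y` is sent to that cell, up to orientation. -/
structure IsMultiplication (f : ChainMap K X Y) (m : Fin n →₀ ℕ) : Prop where
  zero : ∀ (C : X.Face 0) (D : Y.Face 0),
    f.app 0 (Finsupp.single C 1) = Finsupp.single D (MvPolynomial.monomial m 1)
  multigraded : ∀ (p : ℕ) (C : X.Face p) (D : Y.Face p),
    f.app p (Finsupp.single C 1) D = 0 ∨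
      (Y.label D.1 ≤ m + X.label C.1 ∧
        ∃ c : K, f.app p (Finsupp.single C 1) D =
          MvPolynomial.monomial (m + X.label C.1 - Y.label D.1) c)
  translate : ∀ (p : ℕ) (C : X.Face (p + 1)) (D : Y.Face (p + 1)),
    D.1 = (fun y => y + toPoint m) '' C.1 →
      f.app (p + 1) (Finsupp.single C 1) = Finsupp.single D 1 ∨
      f.app (p + 1) (Finsupp.single C 1) = -Finsupp.single D 1

/-- A chain map restricts to the syzygy modules. -/
theorem mapsTo_syz (f : ChainMap K X Y) (p : ℕ) :
    ∀ z ∈ X.syz K p, f.app p z ∈ Y.syz K p := by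
  rintro _ ⟨w, rfl⟩
  exact ⟨f.app (p + 1) w, (LinearMap.congr_fun (f.comm p) w).symm⟩

end ChainMap

/-! ### Families of cellular resolutions -/

/-- A category with the cellular complexes of `X 0, X 1, …` as objects and with sets of chain maps,
closed under composition, as morphisms. -/
structure Family (K : Type*) [Field K] {n : ℕ} (X : ℕ → CellComplex n) where
  homs : ∀ a b, Set (ChainMap K (X a) (X b))
  id_mem : ∀ a, ChainMap.id K (X a) ∈ homs a a
  comp_mem : ∀ {a b c} {g : ChainMap K (X b) (X c)} {f : ChainMap K (X a) (X b)},
    g ∈ homs b c → f ∈ homs a b → g.comp f ∈ homs a c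

namespace Family

variable {K : Type*} [Field K] {n : ℕ} {X : ℕ → CellComplex n}

/-- The chain maps that are compositions of morphisms of the family between consecutive objects. -/
inductive Composite (F : Family K X) : ∀ {a b : ℕ}, ChainMap K (X a) (X b) → Prop
  | id (a : ℕ) : Composite F (ChainMap.id K (X a))
  | step {a b : ℕ} (f : ChainMap K (X a) (X b)) (g : ChainMap K (X b) (X (b + 1))) :
      Composite F f → g ∈ F.homs b (b + 1) → Composite F (g.comp f)

/-- The morphisms are monomial multiplications: there is one morphism between consecutive objects
for each minimal generator of `I`, multiplication by that generator, and all other morphisms are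
compositions of these (so the family is linear, without self-maps other than identities). -/
structure IsMultiplicationFamily (F : Family K X) (I : Ideal (MvPolynomial (Fin n) K)) :
    Prop where
  linear : ∀ a b, ∀ f ∈ F.homs a b, F.Composite f
  exists_unique : ∀ a, ∀ m ∈ minGens I, ∃! f, f ∈ F.homs a (a + 1) ∧ f.IsMultiplication m
  only : ∀ a, ∀ f ∈ F.homs a (a + 1), ∃ m ∈ minGens I, f.IsMultiplication m

/-- The objects of a family. -/
structure Obj (F : Family K X) : Type where
  idx : ℕ

instance (F : Family K X) : Category (Obj F) where
  Hom A B := {f : ChainMap K (X A.idx) (X B.idx) // f ∈ F.homs A.idx B.idx}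
  id A := ⟨ChainMap.id K (X A.idx), F.id_mem _⟩
  comp f g := ⟨g.1.comp f.1, F.comp_mem g.2 f.2⟩

/-- The `p`-th syzygy representation of a family. -/
def syzygyFunctor (F : Family K X) (p : ℕ) : Obj F ⥤ ModuleCat (MvPolynomial (Fin n) K) where
  obj A := ModuleCat.of _ ((X A.idx).syz K p)
  map f := ModuleCat.ofHom ((f.1.app p).restrict (f.1.mapsTo_syz p))

end Family

/-- A representation is finitely generated: there is a finite set of elements such that the only
subrepresentation that contains them is the whole representation. -/
def FinitelyGeneratedRep {C : Type*} [Category C] {R : Type*} [Ring R] (M : C ⥤ ModuleCat R) :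
    Prop :=
  ∃ T : Set (Σ c : C, M.obj c), T.Finite ∧
    ∀ N : ∀ c : C, Submodule R (M.obj c),
      (∀ (c c' : C) (f : c ⟶ c'), ∀ z ∈ N c, (M.map f).hom z ∈ N c') →
      (∀ t ∈ T, t.2 ∈ N t.1) → ∀ c, N c = ⊤

end PathPowers

end

open CategoryTheory

noncomputable section

namespace PathPowers

set_option linter.unusedSectionVars false
/-! ### A perturbation lemma -/

/-! The proof starts from a change of coordinates. Put S_k = y_k + y_{k-2} + ⋯ (`altSum`), so that
y_k = S_k - S_{k-2}. In these terms Newt(I^d) is given by 0 = S_0 ≤ S_1 ≤ ⋯ ≤ S_{n-1} = S_n = d.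
This is a dilated simplex in which S_{k+1} - S_k is the weight of the k-th edge, and its lattice
points are exactly the exponents of the minimal generators of I^d (`mem_minGens_iff`). Rounding all
S_k down preserves these relations and every bound y_i ≤ b_i with b_i integral. So whenever some
point of the polytope is ≤ b, some generator is ≤ b (`exists_lattice_le`), which identifies the
homology in degree 0. At a vertex of Y or Z all S_k are integral: otherwise the S_k in one nonzero
class modulo 1 could be shifted together without leaving any active hyperplane (`vertex_iff`).

For exactness it is enough that, in each multidegree b, the cells with label ≤ b together with the
empty face form an acyclic complex over the field whenever there is such a cell. The hyperplanes y_i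
= b_i are among the cutting ones, so these are the cells inside the convex set P ∩ {y ≤ b}
(`label_le_iff`). Topology is avoided by passing to the cone over P in ℝ × ℝⁿ: cells become sign
vectors of a finite central arrangement, faces become the relation `Conf`, and the empty face
becomes the apex. Acyclicity (`exactOn_cellsIn`) is an induction on the number of hyperplanes. An
unconstrained hyperplane is deleted by cancelling pairs of cells (`exactOn_deletion`, by the
algebraic Morse reduction `exact_of_perturbation`), a hyperplane with sign 0 is restricted to
(`exactOn_contraction`), and a half space follows from these two by a Mayer–Vietoris argument
(`exactOn_halfspace`). The reduction does not preserve incidence numbers ±1, so `IsCellDiff` only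
records which incidence numbers are nonzero. That the actual differential squares to zero follows
from `diamond` and from the sign of a swap of two vectors in a determinant.

Multiplications come from the comparison theorem for chain maps into an acyclic target. The values
on cells whose translate is a cell are prescribed as ± that translate; this is consistent because
the faces of such cells are of the same kind and translation respects orientations up to sign
(`exists_matrix`). Compositions of chosen multiplications form a family.

Finite generation is geometric. If d is large, some edge weight is large at a chosen point of a cell
of X_{d+1}; cells have bounded width, so this weight is at least 1 on the whole cell, and
subtracting that edge gives a cell of X_d (`exists_translate_eq`). From some d on, every basis cell
is therefore ± the image of an earlier one under a multiplication. All this needs only that the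
hyperplanes are the nonnegative integral levels of step forms and include the coordinate ones, so
the three sequences are treated together. -/

theorem exact_of_perturbation {K X Y : Type*} [Field K] [AddCommGroup X] [Module K X]
    [AddCommGroup Y] [Module K Y] (D S : X →ₗ[K] X) (I : Y →ₗ[K] X) (P : X →ₗ[K] Y)
    (hDD : ∀ x, D (D x) = 0) (hSS : ∀ x, S (S x) = 0) (hSDS : ∀ x, S (D (S x)) = S x)
    (hPS : ∀ x, P (S x) = 0) (hSI : ∀ y, S (I y) = 0) (hPI : ∀ y, P (I y) = y)
    (hker : ∀ v, P v = 0 → S v = 0 → S (D v) = 0 → v = 0) :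
    (∀ y, P (D (I (P (D (I y) - D (S (D (I y)))))) -
      D (S (D (I (P (D (I y) - D (S (D (I y)))))))))  = 0) ∧
    ∀ (A : Submodule K X) (A' : Submodule K Y), (∀ x ∈ A, D x ∈ A) → (∀ x ∈ A, S x ∈ A) →
      (∀ x ∈ A, P x ∈ A') → (∀ y ∈ A', I y ∈ A) →
      (∀ z ∈ A', P (D (I z) - D (S (D (I z)))) = 0 →
        ∃ y ∈ A', P (D (I y) - D (S (D (I y)))) = z) →
      ∀ z ∈ A, D z = 0 → ∃ y ∈ A, D y = z := by
  -- The reduced complex sits in X as the common kernel of S and SD; there a vector is determined by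
  -- P, by `hker` applied to the difference of the two sides. The lift of y is I y - S D I y.
  have key : ∀ u, S u = 0 → S (D u) = 0 → I (P u) - S (D (I (P u))) = u := by
    intro u h1 h2
    have := hker (u - (I (P u) - S (D (I (P u))))) (by simp [hPS, hPI])
      (by simp [hSI, hSS, h1]) (by simp [h2, hSDS])
    exact (sub_eq_zero.1 this).symm
  refine ⟨fun y => ?_, fun A A' hD hS hP hI hex z hz hz0 => ?_⟩
  · set u := D (I y) - D (S (D (I y))) with hu
    have h1 : S u = 0 := by simp [hu, hSDS]
    have h2 : D u = 0 := by simp [hu, hDD]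
    have h3 := key u h1 (by simp [h2])
    have h4 : D (I (P u)) - D (S (D (I (P u)))) = D u := by rw [← map_sub, h3]
    rw [h4, h2, map_zero]
  -- The cycle z is homologous to z - D S z, which lies in the common kernel; it is bounded in the
  -- reduced complex and the bounding chain is lifted. Every operation used preserves A.
  · have hPi : P (z - D (S z)) ∈ A' := hP _ (A.sub_mem hz (hD _ (hS _ hz)))
    have h1 : S (z - D (S z)) = 0 := by simp [hSDS]
    have h2 : D (z - D (S z)) = 0 := by simp [hDD, hz0]
    have h3 := key _ h1 (by simp [h2])
    have h4 : D (I (P (z - D (S z)))) - D (S (D (I (P (z - D (S z)))))) = 0 := by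
      rw [← map_sub, h3, h2]
    obtain ⟨y, hy, hyz⟩ := hex _ hPi (by rw [h4, map_zero])
    have h5 : D (I y) - D (S (D (I y))) = z - D (S z) := by
      rw [← h3, ← hyz]
      refine (key _ ?_ ?_).symm
      · simp [hSDS]
      · simp [hDD]
    refine ⟨I y - S (D (I y)) + S z, A.add_mem (A.sub_mem (hI _ hy) (hS _ (hD _ (hI _ hy))))
      (hS _ hz), ?_⟩
    rw [map_add, map_sub, h5]; abel

/-! ### Sign vectors of arrangements -/

section Arrangement

variable {V : Type*} [AddCommGroup V] [Module ℝ V] {ι : Type*} [DecidableEq ι]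

/-- The signs of the functionals `a e`, `e ∈ E`, at a point. -/
def signVec (a : ι → V →ₗ[ℝ] ℝ) (E : Finset ι) (y : V) : ι → SignType :=
  fun e => if e ∈ E then SignType.sign (a e y) else 0

/-- The sign vectors of the points of `W`. -/
def Cov (a : ι → V →ₗ[ℝ] ℝ) (E : Finset ι) (W : Submodule ℝ V) : Type _ :=
  {X : ι → SignType // ∃ y ∈ W, signVec a E y = X}

/-- `G` is a face of `F`. -/
def Conf (G F : ι → SignType) : Prop := ∀ e, G e = 0 ∨ G e = F e

/-- The linear hull of the cell with a given sign vector. -/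
def flat (a : ι → V →ₗ[ℝ] ℝ) (E : Finset ι) (W : Submodule ℝ V) (X : ι → SignType) :
    Submodule ℝ V :=
  W ⊓ ⨅ e ∈ {e | e ∈ E ∧ X e = 0}, LinearMap.ker (a e)

variable {a : ι → V →ₗ[ℝ] ℝ} {E : Finset ι} {W : Submodule ℝ V}

theorem mem_flat {X : ι → SignType} {v : V} :
    v ∈ flat a E W X ↔ v ∈ W ∧ ∀ e ∈ E, X e = 0 → a e v = 0 := by
  simp [flat, Submodule.mem_iInf]

theorem signVec_of_mem {e : ι} (he : e ∈ E) (y : V) :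
    signVec a E y e = SignType.sign (a e y) := if_pos he

theorem signVec_of_notMem {e : ι} (he : e ∉ E) (y : V) : signVec a E y e = 0 := if_neg he

theorem Conf.trans {F G H : ι → SignType} (h : Conf F G) (h' : Conf G H) : Conf F H := by
  intro e
  rcases h e with h1 | h1
  · exact Or.inl h1
  · rcases h' e with h2 | h2
    · exact Or.inl (h1.trans h2)
    · exact Or.inr (h1.trans h2)

theorem Conf.refl (F : ι → SignType) : Conf F F := fun _ => Or.inr rfl

theorem Conf.antisymm {F G : ι → SignType} (h : Conf F G) (h' : Conf G F) : F = G := by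
  funext e
  rcases h e with h1 | h1
  · rcases h' e with h2 | h2
    · rw [h1, h2]
    · exact h2.symm
  · exact h1

theorem Conf.flat_le {F G : ι → SignType} (h : Conf G F) : flat a E W G ≤ flat a E W F := by
  intro v hv
  rw [mem_flat] at hv ⊢
  refine ⟨hv.1, fun e he hF => hv.2 e he ?_⟩
  rcases h e with h1 | h1
  · exact h1
  · exact h1.trans hF

theorem mem_flat_signVec {y : V} (hy : y ∈ W) : y ∈ flat a E W (signVec a E y) := by
  rw [mem_flat]
  refine ⟨hy, fun e he h => ?_⟩
  rwa [signVec_of_mem he, sign_eq_zero_iff] at h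

theorem eventually_sign (f : V →ₗ[ℝ] ℝ) (g h : V) :
    ∀ᶠ ε : ℝ in nhdsWithin 0 (Set.Ioi 0), SignType.sign (f (g + ε • h)) =
      if f g = 0 then SignType.sign (f h) else SignType.sign (f g) := by
  have hpos : ∀ᶠ ε : ℝ in nhdsWithin 0 (Set.Ioi 0), 0 < ε := self_mem_nhdsWithin
  have hlim : Filter.Tendsto (fun ε : ℝ => f (g + ε • h)) (nhdsWithin 0 (Set.Ioi 0))
      (nhds (f g)) := by
    have : Continuous fun ε : ℝ => f g + ε * f h := by fun_prop
    have h2 := (this.tendsto 0).mono_left (nhdsWithin_le_nhds (s := Set.Ioi 0))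
    simpa using h2
  rcases lt_trichotomy (f g) 0 with h0 | h0 | h0
  · filter_upwards [hlim.eventually_lt_const h0] with ε hε
    rw [if_neg h0.ne, sign_neg h0, sign_neg hε]
  · filter_upwards [hpos] with ε hε
    simp [h0, sign_mul, sign_pos hε]
  · filter_upwards [hlim.eventually_const_lt h0] with ε hε
    rw [if_neg h0.ne', sign_pos h0, sign_pos hε]

/-- This is the composition of covectors: a small step from g in the direction h keeps the nonzero
signs of g and replaces its zeros by the signs of h. One ε serves all of the finite set E. -/
theorem exists_signVec_add (a : ι → V →ₗ[ℝ] ℝ) (E : Finset ι) (g h : V) :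
    ∃ ε : ℝ, 0 < ε ∧ ∀ e ∈ E, SignType.sign (a e (g + ε • h)) =
      if a e g = 0 then SignType.sign (a e h) else SignType.sign (a e g) := by
  have h1 : ∀ᶠ ε : ℝ in nhdsWithin 0 (Set.Ioi 0), ∀ e ∈ E, SignType.sign (a e (g + ε • h)) =
      if a e g = 0 then SignType.sign (a e h) else SignType.sign (a e g) :=
    (Finset.eventually_all E).2 fun e _ => eventually_sign (a e) g h
  have hpos : ∀ᶠ ε : ℝ in nhdsWithin 0 (Set.Ioi 0), 0 < ε := self_mem_nhdsWithin
  obtain ⟨ε, h2, h3⟩ := (h1.and hpos).exists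
  exact ⟨ε, h3, h2⟩

/-- The rank of a cell. -/
def rk (a : ι → V →ₗ[ℝ] ℝ) (E : Finset ι) (W : Submodule ℝ V) (X : ι → SignType) : ℕ :=
  Module.finrank ℝ (flat a E W X)

variable [FiniteDimensional ℝ V]

/-- A point of F lies in its own flat, hence in that of G, so F vanishes wherever G does. -/
theorem Conf.eq_of_flat_le {F G : Cov a E W} (h : Conf G.1 F.1)
    (hle : flat a E W F.1 ≤ flat a E W G.1) : G = F := by
  obtain ⟨F, y, hy, rfl⟩ := F
  obtain ⟨G, z, hz, rfl⟩ := G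
  refine Subtype.ext (h.antisymm fun e => ?_)
  by_cases he : e ∈ E
  · rcases h e with h1 | h1
    · have h2 := (mem_flat.1 (hle (mem_flat_signVec hy))).2 e he h1
      left
      show signVec a E y e = 0
      rw [signVec_of_mem he, h2, sign_zero]
    · exact Or.inr h1.symm
  · exact Or.inl (signVec_of_notMem he y)

theorem Conf.eq_of_rk {F G : Cov a E W} (h : Conf G.1 F.1)
    (hle : rk a E W F.1 ≤ rk a E W G.1) : G = F :=
  h.eq_of_flat_le (Submodule.eq_of_le_of_finrank_le h.flat_le hle).ge

theorem Conf.rk_lt {F G : Cov a E W} (h : Conf G.1 F.1) (hne : G ≠ F) :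
    rk a E W G.1 < rk a E W F.1 := by
  by_contra hlt
  exact hne (h.eq_of_rk (not_lt.1 hlt))

variable [Fintype ι]

instance : Finite (Cov a E W) := Subtype.finite

instance : Fintype (Cov a E W) := Fintype.ofFinite _

instance : DecidableEq (Cov a E W) := Classical.decEq _

/-- `D` is the differential of a complex on the cells of an arrangement in which exactly the
incidence numbers of cells with their facets are nonzero. -/
structure IsCellDiff {K : Type*} [Field K] (a : ι → V →ₗ[ℝ] ℝ) (E : Finset ι)
    (W : Submodule ℝ V) (D : (Cov a E W → K) →ₗ[K] (Cov a E W → K)) : Prop where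
  sq : ∀ z, D (D z) = 0
  ne_zero_iff : ∀ G F : Cov a E W, D (Pi.single F 1) G ≠ 0 ↔
    Conf G.1 F.1 ∧ rk a E W F.1 = rk a E W G.1 + 1

theorem linearMap_apply_eq_sum {K α β : Type*} [Field K] [Fintype α] [DecidableEq α]
    (D : (α → K) →ₗ[K] (β → K)) (z : α → K) (G : β) :
    D z G = ∑ F, z F * D (Pi.single F 1) G := by
  conv_lhs => rw [LinearMap.pi_apply_eq_sum_univ D z]
  rw [Finset.sum_apply]
  refine Finset.sum_congr rfl fun F _ => ?_
  have : (fun j => if F = j then (1 : K) else 0) = Pi.single F 1 := by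
    funext j
    simp [Pi.single_apply, eq_comm]
  rw [this, Pi.smul_apply, smul_eq_mul]

/-- The functions supported in a set. -/
def supp (K : Type*) [Field K] {α : Type*} (S : Set α) : Submodule K (α → K) where
  carrier := {z | ∀ x, x ∉ S → z x = 0}
  add_mem' := fun {u v} hu hv x hx => by simp [hu x hx, hv x hx]
  zero_mem' := fun x _ => rfl
  smul_mem' := fun c u hu x hx => by simp [hu x hx]

/-- Exactness of the part of a complex that is supported in a set of cells. -/
def ExactOn {K α : Type*} [Field K] (D : (α → K) →ₗ[K] (α → K)) (S : Set α) : Prop :=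
  ∀ z ∈ supp K S, D z = 0 → ∃ y ∈ supp K S, D y = z

theorem IsCellDiff.map_supp {K : Type*} [Field K] {D : (Cov a E W → K) →ₗ[K] (Cov a E W → K)}
    (hD : IsCellDiff a E W D) {S : Set (Cov a E W)}
    (hS : ∀ G F : Cov a E W, Conf G.1 F.1 → F ∈ S → G ∈ S) {z : Cov a E W → K}
    (hz : z ∈ supp K S) : D z ∈ supp K S := by
  intro G hG
  rw [linearMap_apply_eq_sum]
  refine Finset.sum_eq_zero fun F _ => ?_
  by_cases hF : F ∈ S
  · have : ¬ (D (Pi.single F 1) G ≠ 0) := fun h => hG (hS G F ((hD.ne_zero_iff G F).1 h).1 hF)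
    rw [not_not.1 this, mul_zero]
  · rw [hz F hF, zero_mul]

/-- The cells with signs in prescribed sets. -/
def cellsIn (a : ι → V →ₗ[ℝ] ℝ) (E : Finset ι) (W : Submodule ℝ V) (δ : ι → Set SignType) :
    Set (Cov a E W) := {X | ∀ e, X.1 e ∈ δ e}

theorem cellsIn_lower {δ : ι → Set SignType} (h0 : ∀ e, 0 ∈ δ e) (G F : Cov a E W)
    (h : Conf G.1 F.1) (hF : F ∈ cellsIn a E W δ) : G ∈ cellsIn a E W δ := by
  intro e
  rcases h e with h1 | h1
  · rw [h1]; exact h0 e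
  · rw [h1]; exact hF e

end Arrangement

/-! ### Linear algebra and signs of positive combinations -/

theorem finrank_inf_ker {V : Type*} [AddCommGroup V] [Module ℝ V] [FiniteDimensional ℝ V]
    (F : Submodule ℝ V) (f : V →ₗ[ℝ] ℝ) {v : V} (hv : v ∈ F) (hf : f v ≠ 0) :
    Module.finrank ℝ (F ⊓ LinearMap.ker f : Submodule ℝ V) + 1 = Module.finrank ℝ F := by
  have h1 : f.comp F.subtype ≠ 0 := fun h => hf (LinearMap.congr_fun h ⟨v, hv⟩)
  have h2 := Module.Dual.finrank_ker_add_one_of_ne_zero (f := f.comp F.subtype) h1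
  rw [← h2, LinearMap.ker_comp, ← Submodule.map_comap_subtype, Submodule.finrank_map_subtype_eq]

theorem sign_comb_eq {u v c d : ℝ} (h : SignType.sign u = SignType.sign v) (hc : 0 < c)
    (hd : 0 < d) : SignType.sign (c * u + d * v) = SignType.sign u := by
  rcases lt_trichotomy u 0 with hu | hu | hu
  · rw [sign_neg hu] at h ⊢
    have hv := sign_eq_neg_one_iff.1 h.symm
    exact sign_neg (by nlinarith)
  · rw [hu, sign_zero] at h ⊢
    have hv := sign_eq_zero_iff.1 h.symm
    simp [hv]
  · rw [sign_pos hu] at h ⊢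
    have hv := sign_eq_one_iff.1 h.symm
    exact sign_pos (by positivity)

/-- A nonzero sign of a positive combination already occurs as the sign of one of the two terms.
This is the convexity of regions described by signs. -/
theorem sign_comb_mem {u v c d : ℝ} {S : Set SignType} (h0 : 0 ∈ S)
    (hu : SignType.sign u ∈ S) (hv : SignType.sign v ∈ S) (hc : 0 < c)
    (hd : 0 < d) : SignType.sign (c * u + d * v) ∈ S := by
  rcases lt_trichotomy (c * u + d * v) 0 with h | h | h
  · rw [sign_neg h]
    by_cases h1 : u < 0
    · rwa [sign_neg h1] at hu
    · by_cases h2 : v < 0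
      · rwa [sign_neg h2] at hv
      · push Not at h1 h2
        nlinarith [mul_nonneg hc.le h1, mul_nonneg hd.le h2]
  · rw [h, sign_zero]; exact h0
  · rw [sign_pos h]
    by_cases h1 : 0 < u
    · rwa [sign_pos h1] at hu
    · by_cases h2 : 0 < v
      · rwa [sign_pos h2] at hv
      · push Not at h1 h2
        nlinarith [mul_nonneg hc.le (neg_nonneg.2 h1), mul_nonneg hd.le (neg_nonneg.2 h2)]

theorem SignType.eq_neg_of_notMem {s u : SignType} (hs : s ≠ 0)
    (hu : u ∉ ({0, s} : Set SignType)) : u = -s := by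
  simp only [Set.mem_insert_iff, Set.mem_singleton_iff] at hu
  revert s u
  decide

theorem SignType.eq_zero_of_mem {s u : SignType} (hs : s ≠ 0) (hu : u ∈ ({0, s} : Set SignType))
    (hu' : u ∈ ({0, -s} : Set SignType)) : u = 0 := by
  simp only [Set.mem_insert_iff, Set.mem_singleton_iff] at hu hu'
  revert s u
  decide

/-! ### Deleting a hyperplane: the cells over a given cell -/

section Deletion

variable {V : Type*} [AddCommGroup V] [Module ℝ V] [FiniteDimensional ℝ V]
  {ι : Type*} [DecidableEq ι] [Fintype ι]
  {a : ι → V →ₗ[ℝ] ℝ} {E : Finset ι} {W : Submodule ℝ V} {h : ι}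

theorem signVec_insert (hE : h ∉ E) (y : V) :
    signVec a (insert h E) y = Function.update (signVec a E y) h (SignType.sign (a h y)) := by
  funext e
  by_cases he : e = h
  · subst he; simp [signVec]
  · simp [signVec, he]

theorem signVec_eq_update (hE : h ∉ E) (y : V) :
    signVec a E y = Function.update (signVec a (insert h E) y) h 0 := by
  rw [signVec_insert hE, Function.update_idem, ← signVec_of_notMem (a := a) hE y,
    Function.update_eq_self]

/-- The sign vector of a cell after the deletion of the hyperplane `h`. -/
def del (hE : h ∉ E) (x : Cov a (insert h E) W) : Cov a E W :=
  ⟨Function.update x.1 h 0, by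
    obtain ⟨x, y, hy, rfl⟩ := x
    exact ⟨y, hy, signVec_eq_update hE y⟩⟩

/-- The hyperplane `h` cuts the cell `F`. -/
def IsCut (h : ι) (F : Cov a E W) : Prop :=
  (∃ y ∈ W, signVec a E y = F.1 ∧ 0 < a h y) ∧ ∃ y ∈ W, signVec a E y = F.1 ∧ a h y < 0

theorem exists_lift (hE : h ∉ E) {F : Cov a E W} {y : V} (hy : y ∈ W)
    (hF : signVec a E y = F.1) :
    ∃ x : Cov a (insert h E) W, del hE x = F ∧ x.1 h = SignType.sign (a h y) :=
  ⟨⟨_, y, hy, rfl⟩, Subtype.ext (by rw [← hF, signVec_eq_update hE]; rfl),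
    by simp [signVec]⟩

/-- The lift with sign 0 is represented by the positive combination of points on the two sides at
which `a h` vanishes. -/
theorem IsCut.exists_lift (hE : h ∉ E) {F : Cov a E W} (hF : IsCut h F) (s : SignType) :
    ∃ x : Cov a (insert h E) W, del hE x = F ∧ x.1 h = s := by
  obtain ⟨⟨y, hy, hyF, hpos⟩, z, hz, hzF, hneg⟩ := hF
  rcases s.trichotomy with rfl | rfl | rfl
  · simpa [sign_neg hneg] using PathPowers.exists_lift hE hz hzF
  · have hc : 0 < -a h z := by linarith
    have h1 : signVec a E ((-a h z) • y + (a h y) • z) = F.1 := by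
      funext e
      by_cases he : e ∈ E
      · rw [← hyF, signVec_of_mem he, signVec_of_mem he, map_add, map_smul, map_smul, smul_eq_mul,
          smul_eq_mul]
        refine sign_comb_eq ?_ hc hpos
        rw [← signVec_of_mem he y, ← signVec_of_mem he z, hyF, hzF]
      · rw [← hyF, signVec_of_notMem he, signVec_of_notMem he]
    have h2 := PathPowers.exists_lift hE (W.add_mem (W.smul_mem _ hy) (W.smul_mem _ hz)) h1
    have h3 : a h ((-a h z) • y + (a h y) • z) = 0 := by simp; ring
    rwa [h3, sign_zero] at h2
  · simpa [sign_pos hpos] using PathPowers.exists_lift hE hy hyF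

theorem ext_del (hE : h ∉ E) {x x' : Cov a (insert h E) W} (h1 : del hE x = del hE x')
    (h2 : x.1 h = x'.1 h) : x = x' := by
  refine Subtype.ext ?_
  funext e
  by_cases he : e = h
  · rw [he, h2]
  · have := congrFun (congrArg Subtype.val h1) e
    simpa [del, he] using this

/-- If y lies on h and z off h over the same cell, then y - ε z lies over that cell on the side
opposite to z. Hence the fibres of `del` have one element over uncut cells, and three over cut ones
by `IsCut.exists_lift`. -/
theorem isCut_of_ne (hE : h ∉ E) {x x' : Cov a (insert h E) W} (h1 : del hE x = del hE x')
    (h2 : x.1 h ≠ x'.1 h) : IsCut h (del hE x) := by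
  obtain ⟨_, y, hy, rfl⟩ := x
  obtain ⟨_, z, hz, rfl⟩ := x'
  have hyz : signVec a E y = signVec a E z := by
    rw [signVec_eq_update hE, signVec_eq_update hE z]
    exact congrArg Subtype.val h1
  have hdel : ∀ w ∈ W, signVec a E w = signVec a E y → signVec a E w =
      (del hE (⟨signVec a (insert h E) y, y, hy, rfl⟩ : Cov a (insert h E) W)).1 := by
    intro w _ hw
    rw [hw]; exact signVec_eq_update hE y
  have key : ∀ y ∈ W, ∀ z ∈ W, signVec a E y = signVec a E z → a h y = 0 → a h z ≠ 0 →
      ∃ w ∈ W, signVec a E w = signVec a E y ∧ SignType.sign (a h w) = - SignType.sign (a h z) := by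
    intro y hy z hz hyz hy0 hz0
    obtain ⟨ε, hε, h3⟩ := exists_signVec_add a (insert h E) y (-z)
    refine ⟨y + ε • (-z), W.add_mem hy (W.smul_mem _ (W.neg_mem hz)), ?_, ?_⟩
    · funext e
      by_cases he : e ∈ E
      · rw [signVec_of_mem he, signVec_of_mem he, h3 e (Finset.mem_insert_of_mem he)]
        split_ifs with h4
        · have h5 := congrFun hyz e
          rw [signVec_of_mem he, signVec_of_mem he, h4, sign_zero] at h5
          rw [map_neg, Left.sign_neg, ← h5, h4]; simp
        · rfl
      · rw [signVec_of_notMem he, signVec_of_notMem he]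
    · rw [h3 h (Finset.mem_insert_self _ _), if_pos hy0, map_neg, Left.sign_neg]
  have key2 : ∀ y ∈ W, ∀ z ∈ W, signVec a E y = signVec a E z → a h y = 0 → a h z ≠ 0 →
      (∃ w ∈ W, signVec a E w = signVec a E y ∧ 0 < a h w) ∧
      (∃ w ∈ W, signVec a E w = signVec a E y ∧ a h w < 0) := by
    intro y hy z hz hyz hy0 hz0
    obtain ⟨w, hw, hw1, hw2⟩ := key y hy z hz hyz hy0 hz0
    rcases lt_or_gt_of_ne hz0 with h4 | h4
    · rw [sign_neg h4, neg_neg, sign_eq_one_iff] at hw2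
      exact ⟨⟨w, hw, hw1, hw2⟩, z, hz, hyz.symm, h4⟩
    · rw [sign_pos h4, sign_eq_neg_one_iff] at hw2
      exact ⟨⟨z, hz, hyz.symm, h4⟩, w, hw, hw1, hw2⟩
  have h3 : SignType.sign (a h y) ≠ SignType.sign (a h z) := by
    simpa [signVec] using h2
  suffices hs : (∃ w ∈ W, signVec a E w = signVec a E y ∧ 0 < a h w) ∧
      (∃ w ∈ W, signVec a E w = signVec a E y ∧ a h w < 0) by
    obtain ⟨⟨w, hw, hw1, hw2⟩, w', hw', hw1', hw2'⟩ := hs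
    exact ⟨⟨w, hw, hdel w hw hw1, hw2⟩, w', hw', hdel w' hw' hw1', hw2'⟩
  by_cases hy0 : a h y = 0
  · exact key2 y hy z hz hyz hy0 (fun hz0 => h3 (by rw [hy0, hz0]))
  by_cases hz0 : a h z = 0
  · have := key2 z hz y hy hyz.symm hz0 hy0
    rwa [hyz]
  rcases lt_or_gt_of_ne hy0 with h4 | h4 <;> rcases lt_or_gt_of_ne hz0 with h5 | h5
  · exact absurd (by rw [sign_neg h4, sign_neg h5]) h3
  · exact ⟨⟨z, hz, hyz.symm, h5⟩, y, hy, rfl, h4⟩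
  · exact ⟨⟨y, hy, rfl, h4⟩, z, hz, hyz.symm, h5⟩
  · exact absurd (by rw [sign_pos h4, sign_pos h5]) h3

theorem conf_iff_del (hE : h ∉ E) {x x' : Cov a (insert h E) W} :
    Conf x.1 x'.1 ↔ Conf (del hE x).1 (del hE x').1 ∧ (x.1 h = 0 ∨ x.1 h = x'.1 h) := by
  constructor
  · intro hc
    refine ⟨fun e => ?_, hc h⟩
    by_cases he : e = h
    · simp [del, he]
    · simpa [del, he] using hc e
  · rintro ⟨hc, hh⟩ e
    by_cases he : e = h
    · rw [he]; exact hh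
    · simpa [del, he] using hc e

theorem flat_insert (hE : h ∉ E) (x : Cov a (insert h E) W) (hx : x.1 h = 0) :
    flat a (insert h E) W x.1 = flat a E W (del hE x).1 ⊓ LinearMap.ker (a h) := by
  ext v
  rw [Submodule.mem_inf, mem_flat, mem_flat, LinearMap.mem_ker]
  constructor
  · rintro ⟨h1, h2⟩
    refine ⟨⟨h1, fun e he hx0 => h2 e (Finset.mem_insert_of_mem he) ?_⟩,
      h2 h (Finset.mem_insert_self _ _) hx⟩
    have : e ≠ h := fun h' => hE (h' ▸ he)
    simpa [del, this] using hx0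
  · rintro ⟨⟨h1, h2⟩, h3⟩
    refine ⟨h1, fun e he hx0 => ?_⟩
    rcases Finset.mem_insert.1 he with rfl | he'
    · exact h3
    · have : e ≠ h := fun h' => hE (h' ▸ he')
      exact h2 e he' (by simpa [del, this] using hx0)

theorem rk_del_of_ne (hE : h ∉ E) (x : Cov a (insert h E) W) (hx : x.1 h ≠ 0) :
    rk a (insert h E) W x.1 = rk a E W (del hE x).1 := by
  suffices heq : flat a (insert h E) W x.1 = flat a E W (del hE x).1 by rw [rk, rk, heq]
  ext v
  rw [mem_flat, mem_flat]
  refine and_congr_right fun _ => ⟨fun h2 e he hx0 => ?_, fun h2 e he hx0 => ?_⟩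
  · have : e ≠ h := fun h' => hE (h' ▸ he)
    exact h2 e (Finset.mem_insert_of_mem he) (by simpa [del, this] using hx0)
  · rcases Finset.mem_insert.1 he with rfl | he'
    · exact absurd hx0 hx
    · have : e ≠ h := fun h' => hE (h' ▸ he')
      exact h2 e he' (by simpa [del, this] using hx0)

/-- If x lies on h but `a h` were nonzero at some v in the flat of the deleted cell, a small step
along v would give a second lift with another sign at h, and the cell would be cut. -/
theorem rk_del_of_not_isCut (hE : h ∉ E) (x : Cov a (insert h E) W)
    (hx : ¬ IsCut h (del hE x)) : rk a (insert h E) W x.1 = rk a E W (del hE x).1 := by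
  by_cases hx0 : x.1 h = 0
  · suffices heq : flat a E W (del hE x).1 ⊓ LinearMap.ker (a h) = flat a E W (del hE x).1 by
      rw [rk, rk, flat_insert hE x hx0, heq]
    refine inf_eq_left.2 fun v hv => ?_
    by_contra hv0
    apply hx
    obtain ⟨_, y, hy, rfl⟩ := x
    have hy0 : a h y = 0 := by simpa [signVec] using hx0
    obtain ⟨ε, hε, h3⟩ := exists_signVec_add a (insert h E) y v
    have hvW := (mem_flat.1 hv).1
    have h4 : signVec a E (y + ε • v) = signVec a E y := by
      funext e
      by_cases he : e ∈ E
      · rw [signVec_of_mem he, signVec_of_mem he, h3 e (Finset.mem_insert_of_mem he)]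
        split_ifs with h4
        · have : e ≠ h := fun h' => hE (h' ▸ he)
          have h5 := (mem_flat.1 hv).2 e he (by
            simp [del, this, signVec, h4])
          rw [h5, h4]
        · rfl
      · rw [signVec_of_notMem he, signVec_of_notMem he]
    refine isCut_of_ne hE (x' := ⟨_, y + ε • v, W.add_mem hy (W.smul_mem _ hvW), rfl⟩) ?_ ?_
    · refine Subtype.ext ?_
      show Function.update _ _ _ = Function.update _ _ _
      rw [← signVec_eq_update hE, ← signVec_eq_update hE, h4]
    · show signVec a (insert h E) y h ≠ signVec a (insert h E) (y + ε • v) h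
      rw [signVec_of_mem (Finset.mem_insert_self _ _), signVec_of_mem (Finset.mem_insert_self _ _),
        h3 h (Finset.mem_insert_self _ _), if_pos hy0, hy0, sign_zero]
      exact fun h => hv0 (sign_eq_zero_iff.1 h.symm)
  · exact rk_del_of_ne hE x hx0

theorem rk_del_of_isCut (hE : h ∉ E) (x : Cov a (insert h E) W) (hx0 : x.1 h = 0)
    (hx : IsCut h (del hE x)) : rk a (insert h E) W x.1 + 1 = rk a E W (del hE x).1 := by
  unfold rk
  rw [flat_insert hE x hx0]
  obtain ⟨⟨y, hy, hyF, hpos⟩, -⟩ := hx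
  refine finrank_inf_ker _ _ (v := y) ?_ hpos.ne'
  rw [← hyF]; exact mem_flat_signVec hy

theorem mem_cellsIn_del (hE : h ∉ E) {δ : ι → Set SignType}
    (hu : δ h = Set.univ) (x : Cov a (insert h E) W) :
    del hE x ∈ cellsIn a E W δ ↔ x ∈ cellsIn a (insert h E) W δ := by
  refine forall_congr' fun e => ?_
  by_cases he : e = h
  · simp [he, hu]
  · simp [del, he]

end Deletion

/-! ### Acyclicity under deletion -/

section Acyclic

variable {V : Type*} [AddCommGroup V] [Module ℝ V] [FiniteDimensional ℝ V]
  {ι : Type*} [DecidableEq ι] [Fintype ι]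
  {a : ι → V →ₗ[ℝ] ℝ} {E : Finset ι} {W : Submodule ℝ V} {h : ι} {K : Type*} [Field K]

/-- Over every cut cell F the lifts are F⁺, F⁰, F⁻. Cancelling F⁻ against its facet F⁰ leaves one
cell `lam F` over each F, so the reduced complex lives on the arrangement without h. One reduction
serves all regions that do not constrain the sign at h. -/
theorem exactOn_deletion (hE : h ∉ E)
    {D : (Cov a (insert h E) W → K) →ₗ[K] (Cov a (insert h E) W → K)}
    (hD : IsCellDiff a (insert h E) W D) :
    ∃ D' : (Cov a E W → K) →ₗ[K] (Cov a E W → K), IsCellDiff a E W D' ∧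
      ∀ δ : ι → Set SignType, (∀ e, 0 ∈ δ e) → δ h = Set.univ →
        ExactOn D' (cellsIn a E W δ) → ExactOn D (cellsIn a (insert h E) W δ) := by
  classical
  have hlam : ∀ F : Cov a E W, ∃ x : Cov a (insert h E) W, del hE x = F ∧
      (IsCut h F → x.1 h = 1) := by
    intro F
    by_cases hF : IsCut h F
    · obtain ⟨x, h1, h2⟩ := hF.exists_lift hE 1
      exact ⟨x, h1, fun _ => h2⟩
    · obtain ⟨y, hy, hyF⟩ := F.2
      obtain ⟨x, h1, -⟩ := exists_lift hE hy hyF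
      exact ⟨x, h1, fun hc => absurd hc hF⟩
  choose lam hlam1 hlam2 using hlam
  have hzer : ∀ x : Cov a (insert h E) W, ∃ x' : Cov a (insert h E) W,
      IsCut h (del hE x) → del hE x' = del hE x ∧ x'.1 h = 0 := by
    intro x
    by_cases hF : IsCut h (del hE x)
    · obtain ⟨x', h1, h2⟩ := hF.exists_lift hE 0
      exact ⟨x', fun _ => ⟨h1, h2⟩⟩
    · exact ⟨x, fun hc => absurd hc hF⟩
  choose zer hzer using hzer
  have huniq : ∀ x x' : Cov a (insert h E) W, ¬ IsCut h (del hE x) → del hE x = del hE x' →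
      x = x' := fun x x' hx hxx' =>
    ext_del hE hxx' (by by_contra hne; exact hx (isCut_of_ne hE hxx' hne))
  -- The cells F⁻ to be cancelled; the partner `zer x` of x is F⁰, and the kept lift `lam F` is F⁺
  -- or the only lift.
  let B : Set (Cov a (insert h E) W) := {x | x.1 h = -1 ∧ IsCut h (del hE x)}
  have hlamB : ∀ F, lam F ∉ B := by
    rintro F ⟨h1, h2⟩
    rw [hlam1] at h2
    rw [hlam2 F h2] at h1
    exact absurd h1 (by decide)
  have hzer' : ∀ x ∈ B, del hE (zer x) = del hE x ∧ (zer x).1 h = 0 := fun x hx => hzer x hx.2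
  have hzerB : ∀ x ∈ B, zer x ∉ B := by
    rintro x hx ⟨h1, -⟩
    rw [(hzer' x hx).2] at h1
    exact absurd h1 (by decide)
  have hzlam : ∀ x ∈ B, lam (del hE (zer x)) ≠ zer x := by
    intro x hx he
    have h1 := hlam2 (del hE (zer x)) (by rw [(hzer' x hx).1]; exact hx.2)
    rw [he, (hzer' x hx).2] at h1
    exact absurd h1 (by decide)
  have hrkB : ∀ x ∈ B, rk a (insert h E) W x.1 = rk a E W (del hE x).1 := fun x hx =>
    rk_del_of_ne hE x (by rw [hx.1]; decide)
  have hrkz : ∀ x ∈ B, rk a (insert h E) W (zer x).1 + 1 = rk a E W (del hE x).1 := fun x hx => by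
    rw [rk_del_of_isCut hE (zer x) (hzer' x hx).2 (by rw [(hzer' x hx).1]; exact hx.2),
      (hzer' x hx).1]
  have hrkl : ∀ F, rk a (insert h E) W (lam F).1 = rk a E W F.1 := by
    intro F
    by_cases hF : IsCut h F
    · rw [rk_del_of_ne hE (lam F) (by rw [hlam2 F hF]; decide), hlam1]
    · rw [rk_del_of_not_isCut hE (lam F) (by rwa [hlam1]), hlam1]
  have hne : ∀ x ∈ B, D (Pi.single x 1) (zer x) ≠ 0 := by
    intro x hx
    rw [hD.ne_zero_iff, hrkB x hx, ← hrkz x hx]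
    refine ⟨(conf_iff_del hE).2 ⟨?_, Or.inl (hzer' x hx).2⟩, rfl⟩
    rw [(hzer' x hx).1]; exact Conf.refl _
  -- the only cell of full rank over `F` that has `zer x` as a facet comes from `x`
  have honly : ∀ x ∈ B, ∀ F, rk a (insert h E) W F.1 = rk a E W (del hE F).1 →
      D (Pi.single F 1) (zer x) ≠ 0 → del hE x = del hE F := by
    intro x hx F hF h0
    rw [hD.ne_zero_iff, hF, hrkz x hx] at h0
    have h1 := ((conf_iff_del hE).1 h0.1).1
    rw [(hzer' x hx).1] at h1
    exact h1.eq_of_rk h0.2.le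
  -- The inverse of the incidences x → `zer x`, extended by zero.
  let S : (Cov a (insert h E) W → K) →ₗ[K] (Cov a (insert h E) W → K) :=
    { toFun := fun z x => if x ∈ B then (D (Pi.single x 1) (zer x))⁻¹ * z (zer x) else 0
      map_add' := fun u v => by funext x; by_cases hx : x ∈ B <;> simp [hx, mul_add]
      map_smul' := fun c u => by
        funext x; by_cases hx : x ∈ B <;> simp [hx, mul_left_comm] }
  let I : (Cov a E W → K) →ₗ[K] (Cov a (insert h E) W → K) :=
    { toFun := fun z x => if lam (del hE x) = x then z (del hE x) else 0
      map_add' := fun u v => by funext x; by_cases hx : lam (del hE x) = x <;> simp [hx]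
      map_smul' := fun c u => by funext x; by_cases hx : lam (del hE x) = x <;> simp [hx] }
  let P : (Cov a (insert h E) W → K) →ₗ[K] (Cov a E W → K) := LinearMap.funLeft K K lam
  have hSx : ∀ z, ∀ x ∈ B, S z x = (D (Pi.single x 1) (zer x))⁻¹ * z (zer x) :=
    fun z x hx => if_pos hx
  have hSn : ∀ z, ∀ x, x ∉ B → S z x = 0 := fun z x hx => if_neg hx
  -- By `honly` the matrix of D between B and the cells `zer x` is diagonal, so S D is the identity
  -- on chains supported in B. This yields S D S = S.
  have hsuppB : ∀ v, (∀ x, x ∉ B → v x = 0) → S (D v) = v := by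
    intro v hv
    funext x
    by_cases hx : x ∈ B
    · rw [hSx _ x hx, linearMap_apply_eq_sum D v, Finset.sum_eq_single x]
      · rw [mul_comm (v x), inv_mul_cancel_left₀ (hne x hx)]
      · intro F _ hF
        by_cases hFB : F ∈ B
        · have : ¬ (D (Pi.single F 1) (zer x) ≠ 0) := fun h0 =>
            hF (ext_del hE (honly x hx F (hrkB F hFB) h0) (hx.1.trans hFB.1.symm)).symm
          rw [not_not.1 this, mul_zero]
        · rw [hv F hFB, zero_mul]
      · simp
    · rw [hSn _ x hx, hv x hx]
  obtain ⟨hsq, hex⟩ := exact_of_perturbation D S I P hD.sq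
    (fun z => by
      funext x
      by_cases hx : x ∈ B
      · rw [hSx _ x hx, hSn _ _ (hzerB x hx), mul_zero]; rfl
      · exact hSn _ x hx)
    (fun z => hsuppB _ (hSn z))
    (fun z => by funext F; exact hSn z _ (hlamB F))
    (fun z => by
      funext x
      by_cases hx : x ∈ B
      · rw [hSx _ x hx]
        show _ * (if lam (del hE (zer x)) = zer x then _ else 0) = _
        rw [if_neg (hzlam x hx), mul_zero]; rfl
      · exact hSn _ x hx)
    (fun z => by
      funext F
      show (if lam (del hE (lam F)) = lam F then z (del hE (lam F)) else 0) = _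
      rw [hlam1, if_pos rfl])
    (fun v h1 h2 h3 => by
      have hvB : ∀ x, x ∉ B → v x = 0 := by
        intro x hx
        by_cases hl : lam (del hE x) = x
        · rw [← hl]; exact congrFun h1 (del hE x)
        · have hc : IsCut h (del hE x) := by
            by_contra hc
            exact hl (huniq x _ hc (hlam1 _).symm).symm
          rcases (x.1 h).trichotomy with h4 | h4 | h4
          · exact absurd ⟨h4, hc⟩ hx
          · obtain ⟨b, hb1, hb2⟩ := hc.exists_lift hE (-1)
            have hb : b ∈ B := ⟨hb2, by rwa [hb1]⟩
            have h5 : zer b = x := ext_del hE ((hzer' b hb).1.trans hb1)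
              ((hzer' b hb).2.trans h4.symm)
            have h6 := congrFun h2 b
            rw [hSx _ b hb, h5] at h6
            have h7 := hne b hb
            rw [h5] at h7
            exact (mul_eq_zero.1 h6).resolve_left (inv_ne_zero h7)
          · exact absurd (ext_del hE (hlam1 _) ((hlam2 _ hc).trans h4.symm)) hl
      rw [← hsuppB v hvB, h3])
  -- An entry from F to G is the direct incidence of the kept lifts minus a correction along the
  -- zigzag F⁺ → F⁰ ← F⁻ → `lam G`. When `lam G` is a lift of a facet G of a cut F, exactly one of
  -- the two terms survives, according to the side of h on which it lies.
  let D' : (Cov a E W → K) →ₗ[K] (Cov a E W → K) := P ∘ₗ (D ∘ₗ I - D ∘ₗ S ∘ₗ D ∘ₗ I)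
  have hD'ap : ∀ z, D' z = P (D (I z) - D (S (D (I z)))) := fun z => rfl
  have hIs : ∀ F, I (Pi.single F 1) = Pi.single (lam F) 1 := by
    intro F
    funext x
    show (if lam (del hE x) = x then (Pi.single F 1 : Cov a E W → K) (del hE x) else 0) = _
    by_cases hx : x = lam F
    · subst hx
      rw [hlam1, if_pos rfl, Pi.single_eq_same, Pi.single_eq_same]
    · rw [Pi.single_eq_of_ne hx]
      split_ifs with hl
      · exact Pi.single_eq_of_ne (fun hF => hx (by rw [← hF, hl])) _
      · rfl
  refine ⟨D', ⟨fun z => ?_, fun G F => ?_⟩, fun δ h0 hu hexD' => ?_⟩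
  · rw [hD'ap, hD'ap]
    have := hsq z
    rw [← map_sub] at this
    simpa using hsq z
  · have hent : D' (Pi.single F 1) G = D (Pi.single (lam F) 1) (lam G) -
        ∑ x, S (D (Pi.single (lam F) 1)) x * D (Pi.single x 1) (lam G) := by
      rw [hD'ap, hIs, ← linearMap_apply_eq_sum]; rfl
    have hlamne : D (Pi.single (lam F) 1) (lam G) ≠ 0 ↔
        Conf (lam G).1 (lam F).1 ∧ rk a E W F.1 = rk a E W G.1 + 1 := by
      rw [hD.ne_zero_iff, hrkl, hrkl]
    have hS0 : ∀ x, S (D (Pi.single (lam F) 1)) x ≠ 0 → x ∈ B ∧ del hE x = F := by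
      intro x hx
      by_cases hxB : x ∈ B
      · refine ⟨hxB, ?_⟩
        rw [hSx _ x hxB] at hx
        rw [honly x hxB (lam F) (by rw [hrkl, hlam1]) (right_ne_zero_of_mul hx), hlam1]
      · exact absurd (hSn _ x hxB) hx
    -- lifts of a facet of `F`
    have hadd : Conf G.1 F.1 → (lam G).1 h ≠ 0 →
        ∃ x : Cov a (insert h E) W, del hE x = F ∧ x.1 h = (lam G).1 h := by
      intro hc hG0
      obtain ⟨g, hg, hgx⟩ := (lam G).2
      obtain ⟨f, hf, hfF⟩ := F.2
      obtain ⟨ε, hε, h3⟩ := exists_signVec_add a (insert h E) g f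
      have hhi := Finset.mem_insert_self h E
      have hgG : signVec a E g = G.1 := by
        rw [signVec_eq_update hE, hgx]
        exact congrArg Subtype.val (hlam1 G)
      have h4 : signVec a E (g + ε • f) = F.1 := by
        funext e
        by_cases he : e ∈ E
        · rw [signVec_of_mem he, h3 e (Finset.mem_insert_of_mem he)]
          split_ifs with h4
          · rw [← hfF, signVec_of_mem he]
          · rcases hc e with h5 | h5
            · rw [← hgG, signVec_of_mem he, sign_eq_zero_iff] at h5
              exact absurd h5 h4
            · rw [← h5, ← hgG, signVec_of_mem he]
        · rw [← hfF, signVec_of_notMem he, signVec_of_notMem he]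
      obtain ⟨x, hx1, hx2⟩ := exists_lift hE (W.add_mem hg (W.smul_mem ε hf)) h4
      refine ⟨x, hx1, ?_⟩
      rw [hx2, h3 h hhi, ← hgx, signVec_of_mem hhi, if_neg]
      intro h5
      rw [← hgx, signVec_of_mem hhi, h5, sign_zero] at hG0
      exact hG0 rfl
    have hdown : ∀ x : Cov a (insert h E) W, del hE x = F → Conf (lam G).1 x.1 →
        Conf G.1 F.1 := fun x hx hc => by
      have := ((conf_iff_del hE).1 hc).1
      rwa [hlam1, hx] at this
    have hup : ∀ x : Cov a (insert h E) W, del hE x = F → Conf G.1 F.1 →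
        ((lam G).1 h = 0 ∨ (lam G).1 h = x.1 h) → Conf (lam G).1 x.1 := fun x hx hc hh => by
      refine (conf_iff_del hE).2 ⟨?_, hh⟩
      rwa [hlam1, hx]
    by_cases hF : IsCut h F
    · obtain ⟨b, hb1, hb2⟩ := hF.exists_lift hE (-1)
      have hbB : b ∈ B := ⟨hb2, by rwa [hb1]⟩
      have hbne : D (Pi.single b 1) (lam G) ≠ 0 ↔
          Conf (lam G).1 b.1 ∧ rk a E W F.1 = rk a E W G.1 + 1 := by
        rw [hD.ne_zero_iff, hrkl, hrkB b hbB, hb1]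
      have hSb : S (D (Pi.single (lam F) 1)) b ≠ 0 := by
        rw [hSx _ b hbB]
        refine mul_ne_zero (inv_ne_zero (hne b hbB)) ?_
        rw [hD.ne_zero_iff, hrkl, hrkz b hbB, hb1]
        refine ⟨(conf_iff_del hE).2 ⟨?_, Or.inl (hzer' b hbB).2⟩, rfl⟩
        rw [(hzer' b hbB).1, hb1, hlam1]; exact Conf.refl _
      rw [hent, Finset.sum_eq_single b (fun x _ hx => by
        by_contra hx0
        obtain ⟨h1, h2⟩ := hS0 x (left_ne_zero_of_mul hx0)
        exact hx (ext_del hE (h2.trans hb1.symm) (h1.1.trans hb2.symm))) (by simp)]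
      constructor
      · intro hn
        by_cases h1 : D (Pi.single (lam F) 1) (lam G) = 0
        · have h2 : D (Pi.single b 1) (lam G) ≠ 0 := fun h2 => hn (by rw [h1, h2]; simp)
          exact ⟨hdown b hb1 (hbne.1 h2).1, (hbne.1 h2).2⟩
        · exact ⟨hdown _ (hlam1 F) (hlamne.1 h1).1, (hlamne.1 h1).2⟩
      · rintro ⟨hc, hr⟩
        -- If `lam G` were on h, it would be a face of F⁰ of the same rank, hence equal to it, and G
        -- would be F.
        have hG0 : (lam G).1 h ≠ 0 := by
          intro hG0
          have h1 : Conf (lam G).1 (zer b).1 := by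
            refine (conf_iff_del hE).2 ⟨?_, Or.inl hG0⟩
            rwa [hlam1, (hzer' b hbB).1, hb1]
          have h2 := h1.eq_of_rk (by rw [hrkl]; have := hrkz b hbB; rw [hb1] at this; omega)
          have h3 := congrArg (del hE) h2
          rw [hlam1, (hzer' b hbB).1, hb1] at h3
          rw [h3] at hr; omega
        rcases ((lam G).1 h).trichotomy with h1 | h1 | h1
        · have h2 : D (Pi.single (lam F) 1) (lam G) = 0 := by
            by_contra h2
            have h3 := (hlamne.1 h2).1 h
            rw [hlam2 F hF, h1] at h3
            exact absurd h3 (by decide)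
          rw [h2, zero_sub, neg_ne_zero]
          exact mul_ne_zero hSb (hbne.2 ⟨hup b hb1 hc (Or.inr (h1.trans hb2.symm)), hr⟩)
        · exact absurd h1 hG0
        · have h2 : D (Pi.single b 1) (lam G) = 0 := by
            by_contra h2
            have h3 := (hbne.1 h2).1 h
            rw [hb2, h1] at h3
            exact absurd h3 (by decide)
          rw [h2, mul_zero, sub_zero]
          exact hlamne.2 ⟨hup _ (hlam1 F) hc (Or.inr (h1.trans (hlam2 F hF).symm)), hr⟩
    · rw [hent, Finset.sum_eq_zero (fun x _ => by
        by_contra hx0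
        obtain ⟨h1, h2⟩ := hS0 x (left_ne_zero_of_mul hx0)
        exact hF (h2 ▸ h1.2)), sub_zero, hlamne]
      refine and_congr_left fun _ => ⟨hdown _ (hlam1 F), fun hc => hup _ (hlam1 F) hc ?_⟩
      by_cases hG0 : (lam G).1 h = 0
      · exact Or.inl hG0
      · right
        obtain ⟨x, hx1, hx2⟩ := hadd hc hG0
        rw [← hx2, huniq x (lam F) (by rwa [hx1]) (by rw [hx1, hlam1])]
  · refine hex (supp K (cellsIn a (insert h E) W δ)) (supp K (cellsIn a E W δ))
      (fun x hx => hD.map_supp (cellsIn_lower h0) hx) (fun z hz x hx => ?_)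
      (fun z hz F hF => ?_) (fun z hz x hx => ?_) hexD'
    · by_cases hxB : x ∈ B
      · rw [hSx _ x hxB, hz, mul_zero]
        rwa [← mem_cellsIn_del hE hu, (hzer' x hxB).1, mem_cellsIn_del hE hu]
      · exact hSn _ x hxB
    · refine hz _ ?_
      rwa [← mem_cellsIn_del hE hu, hlam1]
    · show (if lam (del hE x) = x then z (del hE x) else 0) = 0
      rw [hz _ (by rwa [mem_cellsIn_del hE hu]), ite_self]

end Acyclic

/-! ### Contraction, half spaces and the acyclicity of convex regions -/

section Acyclic

variable {V : Type*} [AddCommGroup V] [Module ℝ V] [FiniteDimensional ℝ V]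
  {ι : Type*} [DecidableEq ι] [Fintype ι]
  {a : ι → V →ₗ[ℝ] ℝ} {E : Finset ι} {W : Submodule ℝ V} {h : ι} {K : Type*} [Field K]

/-- The cells with sign 0 at h are the cells of the remaining arrangement inside the hyperplane,
with the same ranks and faces, and they form a subcomplex. -/
theorem exactOn_contraction (hE : h ∉ E)
    {D : (Cov a (insert h E) W → K) →ₗ[K] (Cov a (insert h E) W → K)}
    (hD : IsCellDiff a (insert h E) W D) :
    ∃ D' : (Cov a E (W ⊓ LinearMap.ker (a h)) → K) →ₗ[K] (Cov a E (W ⊓ LinearMap.ker (a h)) → K),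
      IsCellDiff a E (W ⊓ LinearMap.ker (a h)) D' ∧
      ∀ δ : ι → Set SignType, (∀ e, 0 ∈ δ e) → δ h = {0} →
        ExactOn D' (cellsIn a E (W ⊓ LinearMap.ker (a h)) δ) →
        ExactOn D (cellsIn a (insert h E) W δ) := by
  classical
  have hz : ∀ y, a h y = 0 → signVec a (insert h E) y = signVec a E y := by
    intro y hy
    rw [signVec_insert hE, hy, sign_zero, ← signVec_of_notMem (a := a) hE y,
      Function.update_eq_self]
  let inc : Cov a E (W ⊓ LinearMap.ker (a h)) → Cov a (insert h E) W := fun X => ⟨X.1, by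
    obtain ⟨y, hy, hX⟩ := X.2
    exact ⟨y, hy.1, by rw [hz y hy.2, hX]⟩⟩
  have hinc0 : ∀ X, (inc X).1 h = 0 := by
    rintro ⟨_, y, hy, rfl⟩
    exact signVec_of_notMem hE y
  have hback : ∀ x : Cov a (insert h E) W, x.1 h = 0 → ∃ X, inc X = x := by
    rintro ⟨_, y, hy, rfl⟩ hx
    replace hx : signVec a (insert h E) y h = 0 := hx
    rw [signVec_of_mem (Finset.mem_insert_self _ _), sign_eq_zero_iff] at hx
    exact ⟨⟨_, y, ⟨hy, hx⟩, rfl⟩, Subtype.ext (hz y hx).symm⟩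
  have hinj : Function.Injective inc := fun X Y hXY => by
    have := congrArg Subtype.val hXY
    exact Subtype.ext this
  have hrk : ∀ X, rk a (insert h E) W (inc X).1 = rk a E (W ⊓ LinearMap.ker (a h)) X.1 := by
    intro X
    suffices heq : flat a (insert h E) W (inc X).1 = flat a E (W ⊓ LinearMap.ker (a h)) X.1 by
      rw [rk, rk, heq]
    ext v
    rw [mem_flat, mem_flat, Submodule.mem_inf, LinearMap.mem_ker]
    constructor
    · rintro ⟨h1, h2⟩
      exact ⟨⟨h1, h2 h (Finset.mem_insert_self _ _) (hinc0 X)⟩,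
        fun e he hX => h2 e (Finset.mem_insert_of_mem he) hX⟩
    · rintro ⟨⟨h1, h2⟩, h3⟩
      refine ⟨h1, fun e he hX => ?_⟩
      rcases Finset.mem_insert.1 he with rfl | he
      · exact h2
      · exact h3 e he hX
  let I : (Cov a E (W ⊓ LinearMap.ker (a h)) → K) →ₗ[K] (Cov a (insert h E) W → K) :=
    Function.ExtendByZero.linearMap K inc
  have hI1 : ∀ z X, I z (inc X) = z X := fun z X => hinj.extend_apply z 0 X
  have hI0 : ∀ z x, x.1 h ≠ 0 → I z x = 0 := fun z x hx =>
    Function.extend_apply' z (0 : Cov a (insert h E) W → K) x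
      (by rintro ⟨X, rfl⟩; exact hx (hinc0 X))
  let P : (Cov a (insert h E) W → K) →ₗ[K] (Cov a E (W ⊓ LinearMap.ker (a h)) → K) :=
    LinearMap.funLeft K K inc
  have hIP : ∀ z : Cov a (insert h E) W → K, (∀ x, x.1 h ≠ 0 → z x = 0) → I (P z) = z := by
    intro z hzz
    funext x
    by_cases hx : x.1 h = 0
    · obtain ⟨X, rfl⟩ := hback x hx
      rw [hI1]; rfl
    · rw [hI0 _ x hx, hzz x hx]
  have hDI : ∀ z : Cov a (insert h E) W → K, (∀ x, x.1 h ≠ 0 → z x = 0) →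
      ∀ x, x.1 h ≠ 0 → D z x = 0 := by
    intro z hzz
    have := hD.map_supp (S := {x | x.1 h = 0}) (z := z) (fun G F hc hF => by
      rcases hc h with h1 | h1
      · exact h1
      · exact h1.trans hF) hzz
    exact this
  have hIs : ∀ X, I (Pi.single X 1) = Pi.single (inc X) 1 := by
    intro X
    funext x
    by_cases hx : x.1 h = 0
    · obtain ⟨Y, rfl⟩ := hback x hx
      rw [hI1, Pi.single_apply, Pi.single_apply]
      simp [hinj.eq_iff]
    · rw [hI0 _ x hx, Pi.single_eq_of_ne]
      rintro rfl
      exact hx (hinc0 X)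
  refine ⟨P ∘ₗ D ∘ₗ I, ⟨fun z => ?_, fun G F => ?_⟩, fun δ h0 hδ hex z hzS hz0 => ?_⟩
  · show P (D (I (P (D (I z))))) = 0
    rw [hIP _ (hDI _ (hI0 z)), hD.sq, map_zero]
  · show D (I (Pi.single F 1)) (inc G) ≠ 0 ↔ _
    rw [hIs, hD.ne_zero_iff, hrk, hrk]
  · have hz1 : ∀ x, x.1 h ≠ 0 → z x = 0 := fun x hx => hzS x (fun hS => hx (by
      have := hS h
      rwa [hδ] at this))
    have hmem : ∀ X, inc X ∈ cellsIn a (insert h E) W δ ↔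
        X ∈ cellsIn a E (W ⊓ LinearMap.ker (a h)) δ := fun X => Iff.rfl
    obtain ⟨y, hyS, hy⟩ := hex (P z) (fun X hX => hzS _ (by rwa [hmem])) (by
      show P (D (I (P z))) = 0
      rw [hIP z hz1, hz0, map_zero])
    refine ⟨I y, fun x hx => ?_, ?_⟩
    · by_cases hx0 : x.1 h = 0
      · obtain ⟨X, rfl⟩ := hback x hx0
        rw [hI1]
        exact hyS X hx
      · exact hI0 _ x hx0
    · have hy' : P (D (I y)) = P z := hy
      rw [← hIP _ (hDI _ (hI0 y)), hy', hIP z hz1]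

/-- Mayer–Vietoris: the two closed sides cover the region without condition at h and meet in the
wall. A bounding chain in the whole is cut into its parts on the two sides, and the part on the
wrong side is replaced by a chain in the wall with the same boundary. -/
theorem exactOn_halfspace {D : (Cov a E W → K) →ₗ[K] (Cov a E W → K)}
    (hD : IsCellDiff a E W D) {δ : ι → Set SignType} (h0 : ∀ e, 0 ∈ δ e) {s : SignType}
    (hs : s ≠ 0) (hδ : δ h = {0, s})
    (hex : ExactOn D (cellsIn a E W (Function.update δ h Set.univ)))
    (hex0 : ExactOn D (cellsIn a E W (Function.update δ h {0}))) :
    ExactOn D (cellsIn a E W δ) := by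
  classical
  intro z hz hz0
  have hup : ∀ (S : Set SignType) (X : Cov a E W),
      X ∈ cellsIn a E W (Function.update δ h S) ↔ (∀ e, e ≠ h → X.1 e ∈ δ e) ∧ X.1 h ∈ S := by
    intro S X
    constructor
    · intro hX
      refine ⟨fun e he => ?_, ?_⟩
      · have := hX e
        rwa [Function.update_of_ne he] at this
      · have := hX h
        rwa [Function.update_self] at this
    · rintro ⟨h1, h2⟩ e
      by_cases he : e = h
      · subst he; rwa [Function.update_self]
      · rw [Function.update_of_ne he]; exact h1 e he
  have hmem : ∀ X : Cov a E W,
      X ∈ cellsIn a E W δ ↔ (∀ e, e ≠ h → X.1 e ∈ δ e) ∧ X.1 h ∈ ({0, s} : Set SignType) := by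
    intro X
    rw [← hup, ← hδ, Function.update_eq_self]
  obtain ⟨y, hy, hyz⟩ := hex z (fun X hX => hz X (fun hX' => hX (by
    rw [hup]; exact ⟨((hmem X).1 hX').1, trivial⟩))) hz0
  let yp : Cov a E W → K := fun X => if X ∈ cellsIn a E W δ then y X else 0
  have hyp : yp ∈ supp K (cellsIn a E W δ) := fun X hX => if_neg hX
  have hym : y - yp ∈ supp K (cellsIn a E W (Function.update δ h {0, -s})) := by
    intro X hX
    by_cases h1 : X ∈ cellsIn a E W δ
    · simp [yp, h1]
    · simp only [Pi.sub_apply, yp, if_neg h1, sub_zero]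
      refine hy X (fun h2 => ?_)
      rw [hmem] at h1
      rw [hup] at hX h2
      have h3 : X.1 h ∉ ({0, s} : Set SignType) := fun h3 => h1 ⟨h2.1, h3⟩
      exact hX ⟨h2.1, Or.inr (SignType.eq_neg_of_notMem hs h3)⟩
  -- This boundary is supported on the side -s, and, being z minus the boundary of `yp`, also on the
  -- side s; so it is supported on the wall.
  have hw : D (y - yp) ∈ supp K (cellsIn a E W (Function.update δ h {0})) := by
    have h1 := hD.map_supp (cellsIn_lower (δ := Function.update δ h {0, -s}) (fun e => by
      by_cases he : e = h
      · subst he; simp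
      · rw [Function.update_of_ne he]; exact h0 e)) hym
    have h2 : D (y - yp) ∈ supp K (cellsIn a E W δ) := by
      rw [map_sub, hyz]
      exact Submodule.sub_mem _ hz (hD.map_supp (cellsIn_lower h0) hyp)
    intro X hX
    by_cases h3 : X ∈ cellsIn a E W δ
    · refine h1 X (fun h4 => hX ?_)
      rw [hup] at h4 ⊢
      rw [hmem] at h3
      exact ⟨h4.1, SignType.eq_zero_of_mem hs h3.2 h4.2⟩
    · exact h2 X h3
  obtain ⟨x, hx, hxy⟩ := hex0 _ hw (hD.sq _)
  refine ⟨yp + x, Submodule.add_mem _ hyp (fun X hX => hx X (fun h1 => hX ?_)), ?_⟩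
  · rw [hup] at h1
    rw [hmem]
    exact ⟨h1.1, Or.inl h1.2⟩
  · rw [map_add, hxy, ← map_add, add_sub_cancel, hyz]

/-- Only two cells occur, the zero cell and the open half space t > 0, and the incidence between
them is nonzero. -/
theorem exactOn_singleton {t : ι} {D : (Cov a {t} W → K) →ₗ[K] (Cov a {t} W → K)}
    (hD : IsCellDiff a {t} W D) {δ : ι → Set SignType} (hδ : δ t = {0, 1})
    (hne : ∃ X ∈ cellsIn a {t} W δ, X.1 t = 1) : ExactOn D (cellsIn a {t} W δ) := by
  classical
  intro z hz hz0
  obtain ⟨X1, hX1, hX1t⟩ := hne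
  let X0 : Cov a {t} W := ⟨_, 0, W.zero_mem, rfl⟩
  have hext : ∀ X Y : Cov a {t} W, X.1 t = Y.1 t → X = Y := by
    rintro ⟨_, x, hx, rfl⟩ ⟨_, y, hy, rfl⟩ hXY
    refine Subtype.ext (funext fun e => ?_)
    by_cases he : e = t
    · subst he; exact hXY
    · show signVec a {t} x e = signVec a {t} y e
      rw [signVec_of_notMem (by simpa using he), signVec_of_notMem (by simpa using he)]
  have hX0t : X0.1 t = 0 := by simp [X0, signVec]
  have hc01 : Conf X0.1 X1.1 := fun e => Or.inl (by simp [X0, signVec])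
  have h01 : X0 ≠ X1 := by
    intro h
    rw [h, hX1t] at hX0t
    exact absurd hX0t (by decide)
  have hrk : rk a {t} W X1.1 = rk a {t} W X0.1 + 1 := by
    obtain ⟨y, hy, hyX⟩ := X1.2
    rw [← hyX, signVec_of_mem (Finset.mem_singleton_self t), sign_eq_one_iff] at hX1t
    have h1 : flat a {t} W X1.1 = W := by
      ext v
      rw [mem_flat]
      refine ⟨fun h => h.1, fun h => ⟨h, fun e he hX => ?_⟩⟩
      rw [Finset.mem_singleton.1 he, ← hyX, signVec_of_mem (Finset.mem_singleton_self t),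
        sign_eq_zero_iff] at hX
      exact absurd hX hX1t.ne'
    have h2 : flat a {t} W X0.1 = W ⊓ LinearMap.ker (a t) := by
      ext v
      rw [mem_flat, Submodule.mem_inf, LinearMap.mem_ker]
      refine and_congr_right fun _ => ⟨fun h => h t (Finset.mem_singleton_self t) hX0t,
        fun h e he _ => ?_⟩
      rw [Finset.mem_singleton.1 he]; exact h
    rw [rk, rk, h1, h2, finrank_inf_ker W (a t) hy hX1t.ne']
  have hD1 : D (Pi.single X1 1) X0 ≠ 0 := (hD.ne_zero_iff _ _).2 ⟨hc01, hrk⟩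
  have hsupp : ∀ X, X ≠ X0 → X ≠ X1 → z X = 0 := by
    intro X hn0 hn1
    refine hz X (fun hX => ?_)
    have h1 := hX t
    rw [hδ] at h1
    rcases h1 with h1 | h1
    · exact hn0 (hext _ _ (h1.trans hX0t.symm))
    · exact hn1 (hext _ _ (h1.trans hX1t.symm))
  have hz1 : z X1 = 0 := by
    have h1 := congrFun hz0 X0
    rw [linearMap_apply_eq_sum D z, Finset.sum_eq_single X1] at h1
    · exact (mul_eq_zero.1 h1).resolve_right hD1
    · intro X _ hX
      by_cases hX0 : X = X0
      · have : ¬ (D (Pi.single X 1) X0 ≠ 0) := by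
          rw [hD.ne_zero_iff, hX0]; omega
        rw [not_not.1 this, mul_zero]
      · rw [hsupp X hX0 hX, zero_mul]
    · simp
  refine ⟨(z X0 / D (Pi.single X1 1) X0) • Pi.single X1 1, fun X hX => ?_, ?_⟩
  · have : X ≠ X1 := fun h => hX (h ▸ hX1)
    simp [this]
  · funext X
    rw [map_smul, Pi.smul_apply, smul_eq_mul]
    by_cases hX0 : X = X0
    · rw [hX0, div_mul_cancel₀ _ hD1]
    · have h1 : ¬ (D (Pi.single X1 1) X ≠ 0) := by
        rw [hD.ne_zero_iff]
        rintro ⟨h1, h2⟩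
        rcases h1 t with h3 | h3
        · exact hX0 (hext _ _ (h3.trans hX0t.symm))
        · rw [hext X X1 h3] at h2; omega
      rw [not_not.1 h1, mul_zero]
      by_cases hX1 : X = X1
      · rw [hX1, hz1]
      · rw [hsupp X hX0 hX1]

/-- The cells of an arrangement in an intersection of closed half spaces that has points with
`a t > 0`, but none with `a t < 0`, form an acyclic complex. -/
theorem exactOn_cellsIn {t : ι} (ht : t ∈ E) {D : (Cov a E W → K) →ₗ[K] (Cov a E W → K)}
    (hD : IsCellDiff a E W D) {δ : ι → Set SignType} (h0 : ∀ e, 0 ∈ δ e) (hδ : δ t = {0, 1})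
    (hne : ∃ X ∈ cellsIn a E W δ, X.1 t = 1) : ExactOn D (cellsIn a E W δ) := by
  induction hn : E.card using Nat.strong_induction_on generalizing E W δ with
  | _ n IH =>
  by_cases hEt : E = {t}
  · subst hEt
    exact exactOn_singleton hD hδ hne
  obtain ⟨h, hhE, hht⟩ : ∃ h ∈ E, h ≠ t := by
    by_contra hcon
    push Not at hcon
    exact hEt (Finset.eq_singleton_iff_unique_mem.2 ⟨ht, hcon⟩)
  obtain ⟨E0, hE0, rfl⟩ : ∃ E0, h ∉ E0 ∧ insert h E0 = E :=
    ⟨E.erase h, Finset.notMem_erase h E, Finset.insert_erase hhE⟩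
  have ht0 : t ∈ E0 := (Finset.mem_insert.1 ht).resolve_left hht.symm
  have hcard : E0.card < n := by rw [← hn, Finset.card_insert_of_notMem hE0]; omega
  obtain ⟨X, hX, hXt⟩ := hne
  -- the case without condition on the sign at `h`
  have hall : ∀ δ' : ι → Set SignType, (∀ e, 0 ∈ δ' e) → δ' t = {0, 1} → δ' h = Set.univ →
      X ∈ cellsIn a (insert h E0) W δ' → ExactOn D (cellsIn a (insert h E0) W δ') := by
    intro δ' h0' hδ' hu hX'
    obtain ⟨D', hD', hex⟩ := exactOn_deletion hE0 hD
    refine hex δ' h0' hu (IH _ hcard ht0 hD' h0' hδ' ⟨del hE0 X, ?_, ?_⟩ rfl)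
    · rwa [mem_cellsIn_del hE0 hu]
    · simpa [del, hht.symm] using hXt
  have hzero : ∀ δ' : ι → Set SignType, (∀ e, 0 ∈ δ' e) → δ' t = {0, 1} → δ' h = {0} →
      (∃ Y ∈ cellsIn a (insert h E0) W δ', Y.1 t = 1) →
      ExactOn D (cellsIn a (insert h E0) W δ') := by
    rintro δ' h0' hδ' hu ⟨Y, hY, hYt⟩
    obtain ⟨D', hD', hex⟩ := exactOn_contraction hE0 hD
    obtain ⟨y, hy, hyY⟩ := Y.2
    have hYh := hY h
    rw [hu, ← hyY, Set.mem_singleton_iff, signVec_of_mem (Finset.mem_insert_self _ _),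
      sign_eq_zero_iff] at hYh
    have hyE : signVec a E0 y = Y.1 := by
      rw [← hyY, signVec_insert hE0, hYh, sign_zero, ← signVec_of_notMem (a := a) hE0 y,
        Function.update_eq_self]
    exact hex δ' h0' hu (IH _ hcard ht0 hD' h0' hδ'
      ⟨⟨Y.1, y, ⟨hy, hYh⟩, hyE⟩, hY, hYt⟩ rfl)
  have hup0 : ∀ S : Set SignType, 0 ∈ S → ∀ e, 0 ∈ Function.update δ h S e := by
    intro S hS e
    by_cases he : e = h
    · subst he; rwa [Function.update_self]
    · rw [Function.update_of_ne he]; exact h0 e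
  have hupt : ∀ S, Function.update δ h S t = {0, 1} := fun S => by
    rw [Function.update_of_ne hht.symm, hδ]
  have hexall := hall (Function.update δ h Set.univ) (hup0 _ trivial) (hupt _)
    (Function.update_self _ _ _) (fun e => by
      by_cases he : e = h
      · subst he; rw [Function.update_self]; trivial
      · rw [Function.update_of_ne he]; exact hX e)
  have hcases : δ h = Set.univ ∨ δ h = {0} ∨ ∃ s : SignType, s ≠ 0 ∧ δ h = {0, s} := by
    by_cases h1 : (1 : SignType) ∈ δ h <;> by_cases h2 : (-1 : SignType) ∈ δ h
    · left
      refine Set.eq_univ_of_forall fun s => ?_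
      rcases s.trichotomy with rfl | rfl | rfl
      exacts [h2, h0 h, h1]
    · refine Or.inr (Or.inr ⟨1, by decide, Set.ext fun s => ?_⟩)
      rcases s.trichotomy with rfl | rfl | rfl <;> simp [h0 h, h1, h2]
    · refine Or.inr (Or.inr ⟨-1, by decide, Set.ext fun s => ?_⟩)
      rcases s.trichotomy with rfl | rfl | rfl <;> simp [h0 h, h1, h2]
    · refine Or.inr (Or.inl (Set.ext fun s => ?_))
      rcases s.trichotomy with rfl | rfl | rfl <;> simp [h0 h, h1, h2]
  rcases hcases with hu | hu | ⟨s, hs, hu⟩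
  · exact hall δ h0 hδ hu hX
  · exact hzero δ h0 hδ hu ⟨X, hX, hXt⟩
  · by_cases hY : ∃ Y ∈ cellsIn a (insert h E0) W (Function.update δ h {0}), Y.1 t = 1
    · exact exactOn_halfspace hD h0 hs hu hexall
        (hzero _ (hup0 _ rfl) (hupt _) (Function.update_self _ _ _) hY)
    -- If no cell of the wall has t > 0, the half-space condition is vacuous: a cell on the wrong
    -- side and the cell X would have a positive combination on the wall, still with t > 0 since t
    -- is nonnegative on the region.
    · suffices hset : cellsIn a (insert h E0) W (Function.update δ h Set.univ) =
          cellsIn a (insert h E0) W δ by rwa [hset] at hexall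
      have hmono : ∀ Z ∈ cellsIn a (insert h E0) W (Function.update δ h Set.univ),
          ∀ e, e ≠ h → Z.1 e ∈ δ e := by
        intro Z hZ e he
        have := hZ e
        rwa [Function.update_of_ne he] at this
      refine Set.Subset.antisymm (fun Z hZ e => ?_) (fun Z hZ e => ?_)
      · by_cases he : e = h
        swap
        · exact hmono Z hZ e he
        subst he
        by_contra hZe
        apply hY
        obtain ⟨x, hx, hxX⟩ := X.2
        obtain ⟨z, hz, hzZ⟩ := Z.2
        have hee := Finset.mem_insert_self e E0
        have hXe : SignType.sign (a e x) = s := by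
          have h1 := hX e
          rw [hu] at h1
          rcases h1 with h1 | h1
          · exfalso
            refine hY ⟨X, fun e' => ?_, hXt⟩
            by_cases he' : e' = e
            · subst he'; rw [Function.update_self]; exact h1
            · rw [Function.update_of_ne he']; exact hX e'
          · rw [← hxX, signVec_of_mem hee] at h1
            exact h1
        have hZe' : SignType.sign (a e z) = -s := by
          rw [hu, ← hzZ, signVec_of_mem hee] at hZe
          exact SignType.eq_neg_of_notMem hs hZe
        have hxe0 : a e x ≠ 0 := fun h => hs (by rw [← hXe, h, sign_zero])
        have hze0 : a e z ≠ 0 := fun h => hs (by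
          rw [h, sign_zero] at hZe'
          rw [← neg_neg s, ← hZe', neg_zero])
        have hcomb : a e (|a e z| • x + |a e x| • z) = 0 := by
          simp only [map_add, map_smul, smul_eq_mul]
          rcases lt_or_gt_of_ne hxe0 with h1 | h1 <;> rcases lt_or_gt_of_ne hze0 with h2 | h2
          · rw [sign_neg h1] at hXe; rw [sign_neg h2, ← hXe] at hZe'
            exact absurd hZe' (by decide)
          · rw [abs_of_neg h1, abs_of_pos h2]; ring
          · rw [abs_of_pos h1, abs_of_neg h2]; ring
          · rw [sign_pos h1] at hXe; rw [sign_pos h2, ← hXe] at hZe'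
            exact absurd hZe' (by decide)
        refine ⟨⟨_, |a e z| • x + |a e x| • z, W.add_mem (W.smul_mem _ hx) (W.smul_mem _ hz), rfl⟩,
          fun e' => ?_, ?_⟩
        · show signVec a (insert e E0) (|a e z| • x + |a e x| • z) e' ∈ _
          by_cases he' : e' ∈ insert e E0
          · rw [signVec_of_mem he']
            by_cases hee' : e' = e
            · subst hee'
              rw [hcomb, sign_zero, Function.update_self]; rfl
            · rw [Function.update_of_ne hee', map_add, map_smul, map_smul, smul_eq_mul, smul_eq_mul]
              refine sign_comb_mem (h0 e') ?_ ?_ (abs_pos.2 hze0) (abs_pos.2 hxe0)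
              · rw [← signVec_of_mem he', hxX]; exact hX e'
              · rw [← signVec_of_mem he', hzZ]; exact hmono Z hZ e' hee'
          · rw [signVec_of_notMem he']
            exact hup0 {0} rfl e'
        · show signVec a (insert e E0) (|a e z| • x + |a e x| • z) t = 1
          rw [signVec_of_mem ht, map_add, map_smul, map_smul, smul_eq_mul, smul_eq_mul]
          have h1 : 0 < a t x := by
            rw [← hxX, signVec_of_mem ht, sign_eq_one_iff] at hXt; exact hXt
          have h2 : 0 ≤ a t z := by
            have h3 := hmono Z hZ t hht.symm
            rw [hδ, ← hzZ, signVec_of_mem ht] at h3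
            rcases h3 with h3 | h3
            · exact (sign_eq_zero_iff.1 h3).ge
            · exact (sign_eq_one_iff.1 h3).le
          have h3 := abs_pos.2 hze0
          have h4 := abs_pos.2 hxe0
          exact sign_pos (by positivity)
      · by_cases he : e = h
        · subst he; rw [Function.update_self]; trivial
        · rw [Function.update_of_ne he]; exact hZ e

end Acyclic

/-! ### The diamond property of cells of an arrangement -/

section Diamond

variable {V : Type*} [AddCommGroup V] [Module ℝ V] [FiniteDimensional ℝ V]
  {ι : Type*} [DecidableEq ι] [Fintype ι]
  {a : ι → V →ₗ[ℝ] ℝ} {E : Finset ι} {W : Submodule ℝ V}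

/-- Among the functionals vanishing at g that decrease in absolute value along f + s u, take the
first zero. The time -a(f)/a(u) is expanded by a(f), which makes numerator and denominator positive.
-/
theorem exists_first_zero (a : ι → V →ₗ[ℝ] ℝ) (E : Finset ι) (g f u : V)
    (hu : ∃ e ∈ E, a e g = 0 ∧ a e f * a e u < 0) :
    ∃ s : ℝ, 0 < s ∧ (∀ e ∈ E, a e g = 0 → 0 ≤ a e f * a e (f + s • u)) ∧
      ∃ e ∈ E, a e g = 0 ∧ a e f * a e u < 0 ∧ a e (f + s • u) = 0 := by
  classical
  obtain ⟨e', he', hg', hu'⟩ := hu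
  obtain ⟨e0, he0, hmin⟩ := Finset.exists_min_image
    (E.filter fun e => a e g = 0 ∧ a e f * a e u < 0)
    (fun e => (a e f) ^ 2 / (-(a e f * a e u))) ⟨e', by simp [he', hg', hu']⟩
  obtain ⟨h1, h2, h3⟩ : e0 ∈ E ∧ a e0 g = 0 ∧ a e0 f * a e0 u < 0 := by simpa using he0
  have hf0 : a e0 f ≠ 0 := fun h => by simp [h] at h3
  have hu0 : a e0 u ≠ 0 := fun h => by simp [h] at h3
  refine ⟨(a e0 f) ^ 2 / (-(a e0 f * a e0 u)), div_pos (by positivity) (by linarith), ?_,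
    e0, h1, h2, h3, ?_⟩
  · intro e he hg
    have hpos : 0 < (a e0 f) ^ 2 / (-(a e0 f * a e0 u)) := div_pos (by positivity) (by linarith)
    by_cases hn : a e f * a e u < 0
    · have h4 := hmin e (by simp [he, hg, hn])
      rw [le_div_iff₀ (by linarith)] at h4
      simp only [map_add, map_smul, smul_eq_mul]
      nlinarith
    · push Not at hn
      simp only [map_add, map_smul, smul_eq_mul]
      nlinarith [mul_nonneg hpos.le hn, mul_self_nonneg (a e f)]
  · simp only [map_add, map_smul, smul_eq_mul]
    field_simp
    ring

/-- The cell in question is that of g + ε h: the hypotheses say that h belongs to the closed cone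
that F cuts out near G. -/
theorem exists_between {G F : Cov a E W} (hGF : Conf G.1 F.1) {g f h : V} (hg : g ∈ W)
    (hgG : signVec a E g = G.1) (hfF : signVec a E f = F.1) (hh : h ∈ flat a E W F.1)
    (hpos : ∀ e ∈ E, a e g = 0 → 0 ≤ a e f * a e h) :
    ∃ H : Cov a E W, (∀ e ∈ E, H.1 e = if a e g = 0 then SignType.sign (a e h) else
      SignType.sign (a e g)) ∧ Conf G.1 H.1 ∧ Conf H.1 F.1 := by
  obtain ⟨ε, hε, h1⟩ := exists_signVec_add a E g h
  have hH : ∀ e ∈ E, signVec a E (g + ε • h) e = if a e g = 0 then SignType.sign (a e h) else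
      SignType.sign (a e g) := fun e he => by rw [signVec_of_mem he, h1 e he]
  refine ⟨⟨_, g + ε • h, W.add_mem hg (W.smul_mem _ (mem_flat.1 hh).1), rfl⟩, hH, fun e => ?_,
    fun e => ?_⟩
  · by_cases he : e ∈ E
    · show G.1 e = 0 ∨ G.1 e = signVec a E (g + ε • h) e
      rw [hH e he, ← hgG, signVec_of_mem he]
      split_ifs with h2
      · left; rw [h2, sign_zero]
      · exact Or.inr rfl
    · left; rw [← hgG, signVec_of_notMem he]
  · show signVec a E (g + ε • h) e = 0 ∨ signVec a E (g + ε • h) e = F.1 e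
    by_cases he : e ∈ E
    · rw [hH e he]
      split_ifs with h2
      · by_cases h3 : a e h = 0
        · left; rw [h3, sign_zero]
        · right
          rw [← hfF, signVec_of_mem he]
          have h4 : a e f ≠ 0 := fun h4 => h3 ((mem_flat.1 hh).2 e he (by
            rw [← hfF, signVec_of_mem he, h4, sign_zero]))
          have h5 : 0 < a e f * a e h :=
            lt_of_le_of_ne (hpos e he h2) (mul_ne_zero h4 h3).symm
          have h6 := sign_pos h5
          rw [sign_mul] at h6
          revert h6
          generalize SignType.sign (a e f) = x
          generalize SignType.sign (a e h) = y
          revert x y; decide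
      · rcases hGF e with h3 | h3
        · rw [← hgG, signVec_of_mem he, sign_eq_zero_iff] at h3
          exact absurd h3 h2
        · right; rw [← h3, ← hgG, signVec_of_mem he]
    · left; exact signVec_of_notMem he _

/-- A strictly larger cell is nonzero at some functional vanishing on the smaller one. -/
theorem Conf.exists_zero_ne {G F : Cov a E W} (h : Conf G.1 F.1) (hne : G ≠ F) :
    ∃ e ∈ E, G.1 e = 0 ∧ F.1 e ≠ 0 := by
  by_contra hcon
  push Not at hcon
  refine hne (h.eq_of_flat_le fun v hv => ?_)
  rw [mem_flat] at hv ⊢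
  exact ⟨hv.1, fun e he hG => hv.2 e he (hcon e he hG)⟩

/-- Modulo the flat of G, a direction α f + β u on the boundary of the cone of F must be
proportional to the point where the ray f + s u first meets that boundary. Comparing the functional
that vanishes at one with its sign at the other gives both inequalities. -/
theorem eq_of_ray {g f u h : V} {α β s : ℝ} (hβ : 0 < β) (hα : 0 < α)
    (hs : ∀ e ∈ E, a e g = 0 → 0 ≤ a e f * a e (f + s • u))
    (hs0 : ∃ e ∈ E, a e g = 0 ∧ a e f * a e u < 0 ∧ a e (f + s • u) = 0)
    (hh : ∀ e ∈ E, a e g = 0 → a e h = α * a e f + β * a e u)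
    (hpos : ∀ e ∈ E, a e g = 0 → 0 ≤ a e f * a e h)
    (hzero : ∃ e ∈ E, a e g = 0 ∧ a e f ≠ 0 ∧ a e h = 0) :
    β = α * s := by
  obtain ⟨e0, he0, hg0, hu0, hz0⟩ := hs0
  obtain ⟨e1, he1, hg1, hf1, hz1⟩ := hzero
  have h1 := hs e1 he1 hg1
  have h2 := hpos e0 he0 hg0
  rw [hh e0 he0 hg0] at h2
  rw [hh e1 he1 hg1] at hz1
  simp only [map_add, map_smul, smul_eq_mul] at h1 hz0
  have hf1' : 0 < (a e1 f) ^ 2 := by positivity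
  have h3 : α * (a e1 f) ^ 2 + β * (a e1 f * a e1 u) = 0 := by
    linear_combination a e1 f * hz1
  have h4 : a e1 f * a e1 u < 0 := by
    by_contra hc
    push Not at hc
    nlinarith [mul_nonneg hβ.le hc, mul_pos hα hf1']
  have h5 : 0 ≤ (α * s - β) * (a e1 f * a e1 u) := by
    have := mul_nonneg hα.le h1
    linear_combination this + h3
  have h6 : 0 ≤ (β - α * s) * (a e0 f * a e0 u) := by
    linear_combination h2 + α * a e0 f * hz0
  have h7 : α * s - β ≤ 0 := by
    by_contra hc; push Not at hc; nlinarith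
  have h8 : β - α * s ≤ 0 := by
    by_contra hc; push Not at hc; nlinarith
  linarith

/-- Modulo the flat of G, the cell F becomes a pointed cone in a plane, and the cells between are
its two boundary rays. They are found by moving from the interior point f in the directions u and -u
until a functional vanishes. -/
theorem diamond {G F : Cov a E W} (hGF : Conf G.1 F.1)
    (hrk : rk a E W F.1 = rk a E W G.1 + 2) :
    ∃ H₁ H₂ : Cov a E W, H₁ ≠ H₂ ∧ ∀ H : Cov a E W,
      (Conf G.1 H.1 ∧ Conf H.1 F.1 ∧ rk a E W H.1 = rk a E W G.1 + 1) ↔ H = H₁ ∨ H = H₂ := by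
  have hne : G ≠ F := fun h => by rw [h] at hrk; omega
  obtain ⟨g, hg, hgG⟩ := G.2
  obtain ⟨f, hf, hfF⟩ := F.2
  have hG : ∀ e ∈ E, G.1 e = 0 ↔ a e g = 0 := fun e he => by
    rw [← hgG, signVec_of_mem he, sign_eq_zero_iff]
  have hF : ∀ e ∈ E, F.1 e = 0 ↔ a e f = 0 := fun e he => by
    rw [← hfF, signVec_of_mem he, sign_eq_zero_iff]
  have hfflat : f ∈ flat a E W F.1 := hfF ▸ mem_flat_signVec hf
  obtain ⟨e1, he1, hGe1, hFe1⟩ := hGF.exists_zero_ne hne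
  rw [hG e1 he1] at hGe1
  rw [Ne, hF e1 he1] at hFe1
  have hN := finrank_inf_ker (flat a E W F.1) (a e1) hfflat hFe1
  obtain ⟨u0, hu0F, hu01, e2, he2, hGe2, hu02⟩ : ∃ u0 ∈ flat a E W F.1, a e1 u0 = 0 ∧
      ∃ e2 ∈ E, a e2 g = 0 ∧ a e2 f * a e2 u0 < 0 := by
    obtain ⟨u0, hu0, hu0G⟩ : ∃ u0 ∈ flat a E W F.1 ⊓ LinearMap.ker (a e1),
        u0 ∉ flat a E W G.1 := by
      by_contra hcon
      push Not at hcon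
      have h1 := Submodule.finrank_mono (show flat a E W F.1 ⊓ LinearMap.ker (a e1) ≤
        flat a E W G.1 from hcon)
      change _ = rk a E W F.1 at hN
      change _ ≤ rk a E W G.1 at h1
      omega
    have h1 : ∃ e2 ∈ E, a e2 g = 0 ∧ a e2 u0 ≠ 0 := by
      by_contra hcon
      push Not at hcon
      exact hu0G (mem_flat.2 ⟨(mem_flat.1 hu0.1).1, fun e he h2 =>
        hcon e he ((hG e he).1 h2)⟩)
    obtain ⟨e2, he2, hGe2, h2⟩ := h1
    have h3 : a e2 f ≠ 0 := fun h3 => h2 ((mem_flat.1 hu0.1).2 e2 he2 ((hF e2 he2).2 h3))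
    have h4 : a e1 u0 = 0 := hu0.2
    rcases lt_or_gt_of_ne (mul_ne_zero h3 h2) with h5 | h5
    · exact ⟨u0, hu0.1, h4, e2, he2, hGe2, h5⟩
    · exact ⟨-u0, Submodule.neg_mem _ hu0.1, by rw [map_neg, h4, neg_zero], e2, he2, hGe2, by
        rw [map_neg]; linarith⟩
  have hFe2 : a e2 f ≠ 0 := fun h => by simp [h] at hu02
  have hue2 : a e2 u0 ≠ 0 := fun h => by simp [h] at hu02
  -- the quotient of the flats has rank two
  have hGle : flat a E W G.1 ≤ flat a E W F.1 ⊓ LinearMap.ker (a e1) ⊓ LinearMap.ker (a e2) :=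
    fun v hv => ⟨⟨hGF.flat_le hv, (mem_flat.1 hv).2 e1 he1 ((hG e1 he1).2 hGe1)⟩,
      (mem_flat.1 hv).2 e2 he2 ((hG e2 he2).2 hGe2)⟩
  have hN2 := finrank_inf_ker (flat a E W F.1 ⊓ LinearMap.ker (a e1)) (a e2) (v := u0)
    ⟨hu0F, hu01⟩ hue2
  have hGeq := Submodule.eq_of_le_of_finrank_le hGle (by
    change _ = rk a E W F.1 at hN
    change _ ≤ rk a E W G.1
    omega)
  -- A slight tilt of u₀ towards f makes e₁ increase in absolute value along u while e₂ still
  -- decreases. So f + s u meets the boundary because of e₂, and f - s u because of e₁.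
  obtain ⟨δ, hδ, hδ2⟩ : ∃ δ : ℝ, 0 < δ ∧ a e2 f * a e2 u0 + δ * (a e2 f) ^ 2 < 0 := by
    have h1 : 0 < (a e2 f) ^ 2 := by positivity
    refine ⟨-(a e2 f * a e2 u0) / (2 * (a e2 f) ^ 2), div_pos (by linarith) (by positivity), ?_⟩
    have : -(a e2 f * a e2 u0) / (2 * (a e2 f) ^ 2) * (a e2 f) ^ 2 = -(a e2 f * a e2 u0) / 2 := by
      field_simp
    rw [this]; linarith
  set u := u0 + δ • f with hu
  have huF : u ∈ flat a E W F.1 :=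
    Submodule.add_mem _ hu0F (Submodule.smul_mem _ _ hfflat)
  have hue1p : 0 < a e1 f * a e1 u := by
    have : 0 < (a e1 f) ^ 2 := by positivity
    simp only [hu, map_add, map_smul, smul_eq_mul, hu01, zero_add]
    nlinarith [mul_pos hδ this]
  have hue2n : a e2 f * a e2 u < 0 := by
    simp only [hu, map_add, map_smul, smul_eq_mul]
    nlinarith
  -- Since e₁ and e₂ cut the flat of F down to that of G, they determine the coordinates modulo the
  -- latter in the basis f, u.
  have hdec : ∀ h ∈ flat a E W F.1, ∃ α β : ℝ, ∀ e ∈ E, a e g = 0 →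
      a e h = α * a e f + β * a e u := by
    intro h hh
    set α := a e1 h / a e1 f with hα
    set β := (a e2 h - α * a e2 f) / a e2 u0 with hβ
    have h1 : h - α • f - β • u0 ∈ flat a E W G.1 := by
      rw [hGeq]
      refine ⟨⟨Submodule.sub_mem _ (Submodule.sub_mem _ hh (Submodule.smul_mem _ _ hfflat))
        (Submodule.smul_mem _ _ hu0F), ?_⟩, ?_⟩
      · change a e1 _ = 0
        simp only [map_sub, map_smul, smul_eq_mul, hu01, hα]
        field_simp
        ring
      · change a e2 _ = 0
        simp only [map_sub, map_smul, smul_eq_mul, hβ]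
        field_simp
        ring
    refine ⟨α - β * δ, β, fun e he hge => ?_⟩
    have h2 := (mem_flat.1 h1).2 e he ((hG e he).2 hge)
    simp only [map_sub, map_smul, smul_eq_mul] at h2
    simp only [hu, map_add, map_smul, smul_eq_mul]
    linarith
  obtain ⟨s1, hs1, hs1p, hs1z⟩ := exists_first_zero a E g f u ⟨e2, he2, hGe2, hue2n⟩
  obtain ⟨s2, hs2, hs2p, hs2z⟩ := exists_first_zero a E g f (-u)
    ⟨e1, he1, hGe1, by rw [map_neg]; linarith⟩
  obtain ⟨H1, hH1, hGH1, hH1F⟩ := exists_between hGF hg hgG hfF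
    (Submodule.add_mem _ hfflat (Submodule.smul_mem _ s1 huF)) hs1p
  obtain ⟨H2, hH2, hGH2, hH2F⟩ := exists_between hGF hg hgG hfF
    (Submodule.add_mem _ hfflat (Submodule.smul_mem _ s2 (Submodule.neg_mem _ huF))) hs2p
  have hrank : ∀ H : Cov a E W, Conf G.1 H.1 → Conf H.1 F.1 → G ≠ H → H ≠ F →
      rk a E W H.1 = rk a E W G.1 + 1 := by
    intro H h1 h2 h3 h4
    have := h1.rk_lt h3
    have := h2.rk_lt h4
    omega
  have hzero : ∀ e ∈ E, a e g = 0 → ∀ x, a e f * a e x < 0 → ∀ H : Cov a E W,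
      H.1 e = 0 → H ≠ F := by
    rintro e he hge x hx H hH0 rfl
    rw [hF e he] at hH0
    simp [hH0] at hx
  have hr1 : rk a E W H1.1 = rk a E W G.1 + 1 := by
    refine hrank H1 hGH1 hH1F ?_ ?_
    · rintro rfl
      have h1 := hH1 e1 he1
      rw [if_pos hGe1, (hG e1 he1).2 hGe1, eq_comm, sign_eq_zero_iff] at h1
      simp only [map_add, map_smul, smul_eq_mul] at h1
      have h2 : 0 < (a e1 f) ^ 2 := by positivity
      have h3 : a e1 f * (a e1 f + s1 * a e1 u) = 0 := by rw [h1, mul_zero]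
      nlinarith [mul_pos hs1 hue1p]
    · obtain ⟨e, he, hge, hneg, hz⟩ := hs1z
      exact hzero e he hge _ hneg H1 (by rw [hH1 e he, if_pos hge, hz, sign_zero])
  have hr2 : rk a E W H2.1 = rk a E W G.1 + 1 := by
    refine hrank H2 hGH2 hH2F ?_ ?_
    · rintro rfl
      have h1 := hH2 e2 he2
      rw [if_pos hGe2, (hG e2 he2).2 hGe2, eq_comm, sign_eq_zero_iff] at h1
      simp only [map_add, map_smul, smul_eq_mul, map_neg] at h1
      have h2 : 0 < (a e2 f) ^ 2 := by positivity
      have h3 : a e2 f * (a e2 f + s2 * -a e2 u) = 0 := by rw [h1, mul_zero]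
      nlinarith [mul_pos hs2 (neg_pos.2 hue2n)]
    · obtain ⟨e, he, hge, hneg, hz⟩ := hs2z
      exact hzero e he hge _ hneg H2 (by rw [hH2 e he, if_pos hge, hz, sign_zero])
  have h12 : H1 ≠ H2 := by
    rintro rfl
    obtain ⟨e, he, hge, hneg, hz⟩ := hs1z
    have h1 := hH2 e he
    rw [hH1 e he, if_pos hge, if_pos hge, hz, sign_zero, eq_comm, sign_eq_zero_iff] at h1
    simp only [map_add, map_smul, smul_eq_mul, map_neg] at h1
    have h3 : a e f * (a e f + s2 * -a e u) = 0 := by rw [h1, mul_zero]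
    nlinarith [mul_pos hs2 (neg_pos.2 hneg), mul_self_nonneg (a e f)]
  refine ⟨H1, H2, h12, fun H => ⟨?_, ?_⟩⟩
  · rintro ⟨hGH, hHF, hrH⟩
    obtain ⟨h, hh, hhH⟩ := H.2
    have hH : ∀ e ∈ E, H.1 e = SignType.sign (a e h) := fun e he => by
      rw [← hhH, signVec_of_mem he]
    have hHG : G ≠ H := fun h => by rw [h] at hrH; omega
    have hHneF : H ≠ F := fun h => by rw [h] at hrH; omega
    have hhF : h ∈ flat a E W F.1 := hHF.flat_le (hhH ▸ mem_flat_signVec hh)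
    have hcompat : ∀ e ∈ E, a e h ≠ 0 → 0 < a e f * a e h := by
      intro e he h0
      rcases hHF e with h1 | h1
      · rw [hH e he, sign_eq_zero_iff] at h1
        exact absurd h1 h0
      · rw [hH e he, ← hfF, signVec_of_mem he] at h1
        rcases lt_or_gt_of_ne h0 with h2 | h2
        · rw [sign_neg h2, eq_comm, sign_eq_neg_one_iff] at h1
          exact mul_pos_of_neg_of_neg h1 h2
        · rw [sign_pos h2, eq_comm, sign_eq_one_iff] at h1
          exact mul_pos h1 h2
    have hpos : ∀ e ∈ E, a e g = 0 → 0 ≤ a e f * a e h := by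
      intro e he _
      by_cases h0 : a e h = 0
      · rw [h0, mul_zero]
      · exact (hcompat e he h0).le
    have hp : ∃ e ∈ E, a e g = 0 ∧ 0 < a e f * a e h := by
      obtain ⟨e, he, h1, h2⟩ := hGH.exists_zero_ne hHG
      rw [hH e he, Ne, sign_eq_zero_iff] at h2
      exact ⟨e, he, (hG e he).1 h1, hcompat e he h2⟩
    have hz : ∃ e ∈ E, a e g = 0 ∧ a e f ≠ 0 ∧ a e h = 0 := by
      obtain ⟨e, he, h1, h2⟩ := hHF.exists_zero_ne hHneF
      rw [Ne, hF e he] at h2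
      refine ⟨e, he, ?_, h2, ?_⟩
      · rw [← hG e he]
        rcases hGH e with h3 | h3
        · exact h3
        · rw [h3, h1]
      · rwa [hH e he, sign_eq_zero_iff] at h1
    obtain ⟨α, β, hαβ⟩ := hdec h hhF
    have hfin : ∀ (H' : Cov a E W) (h' : V), 0 < α → (∀ e ∈ E, a e g = 0 → a e h = α * a e h') →
        (∀ e ∈ E, H'.1 e = if a e g = 0 then SignType.sign (a e h') else
          SignType.sign (a e g)) → H = H' := by
      intro H' h' hα h1 h2
      refine Subtype.ext (funext fun e => ?_)
      by_cases he : e ∈ E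
      · rw [h2 e he]
        split_ifs with h3
        · rw [hH e he, h1 e he h3, sign_mul, sign_pos hα, one_mul]
        · rcases hGH e with h4 | h4
          · exact absurd ((hG e he).1 h4) h3
          · rw [← h4, ← hgG, signVec_of_mem he]
      · obtain ⟨y, _, hy⟩ := H'.2
        rw [← hhH, ← hy, signVec_of_notMem he, signVec_of_notMem he]
    have hval : ∀ e ∈ E, a e g = 0 → a e f * a e h = α * (a e f) ^ 2 + β * (a e f * a e u) :=
      fun e he hge => by rw [hαβ e he hge]; ring
    -- The sign of β selects the boundary ray. If β = 0, a functional that vanishes at h but not at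
    -- f forces α = 0, and then H would equal G.
    rcases lt_trichotomy β 0 with hβ | hβ | hβ
    · right
      have hα : 0 < α := by
        have h1 := hpos e1 he1 hGe1
        rw [hval e1 he1 hGe1] at h1
        have h2 : 0 < (a e1 f) ^ 2 := by positivity
        by_contra hc
        push Not at hc
        nlinarith [mul_neg_of_neg_of_pos hβ hue1p]
      have h1 := eq_of_ray (β := -β) (by linarith) hα hs2p hs2z (fun e he hge => by
        rw [hαβ e he hge, map_neg]; ring) hpos hz
      refine hfin H2 _ hα (fun e he hge => ?_) hH2
      rw [hαβ e he hge]
      simp only [map_add, map_smul, smul_eq_mul, map_neg]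
      linear_combination -(a e u) * h1
    · exfalso
      obtain ⟨e, he, hge, h1⟩ := hp
      obtain ⟨e', he', hge', h2, h3⟩ := hz
      rw [hval e he hge, hβ] at h1
      have h4 := hval e' he' hge'
      rw [h3, hβ] at h4
      have h5 : α = 0 := by
        have h6 : α * (a e' f) ^ 2 = 0 := by linarith
        exact (mul_eq_zero.1 h6).resolve_right (pow_ne_zero 2 h2)
      rw [h5] at h1
      linarith
    · left
      have hα : 0 < α := by
        have h1 := hpos e2 he2 hGe2
        rw [hval e2 he2 hGe2] at h1
        have h2 : 0 < (a e2 f) ^ 2 := by positivity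
        by_contra hc
        push Not at hc
        nlinarith [mul_neg_of_pos_of_neg hβ hue2n]
      have h1 := eq_of_ray hβ hα hs1p hs1z hαβ hpos hz
      refine hfin H1 _ hα (fun e he hge => ?_) hH1
      rw [hαβ e he hge]
      simp only [map_add, map_smul, smul_eq_mul]
      linear_combination (a e u) * h1
  · rintro (rfl | rfl)
    · exact ⟨hGH1, hH1F, hr1⟩
    · exact ⟨hGH2, hH2F, hr2⟩

end Diamond

/-! ### Determinants and incidence numbers of oriented subspaces -/

section Incidence

variable {V : Type*} [AddCommGroup V] [Module ℝ V]

/-- The determinant of a vector followed by a basis of a subspace. -/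
def consDet {S T : Submodule ℝ V} (h : S ≤ T) {r : ℕ} (b : Module.Basis (Fin r) ℝ S)
    (c : Module.Basis (Fin (r + 1)) ℝ T) (v : T) : ℝ :=
  c.det (Fin.cons v (fun j => Submodule.inclusion h (b j)))

theorem consDet_eq {S T : Submodule ℝ V} (h : S ≤ T) {r : ℕ} (b : Module.Basis (Fin r) ℝ S)
    (c : Module.Basis (Fin (r + 1)) ℝ T) (v : T) :
    consDet h b c v = (c.det.curryLeft v).compLinearMap (Submodule.inclusion h) b := rfl

/-- For fixed v the left side is an alternating form of top degree on S, hence a multiple of the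
determinant of any basis. -/
theorem det_cons_inclusion {S T : Submodule ℝ V} (h : S ≤ T) {r : ℕ}
    (b : Module.Basis (Fin r) ℝ S) (c : Module.Basis (Fin (r + 1)) ℝ T) (v : T) (w : Fin r → S) :
    c.det (Fin.cons v (fun j => Submodule.inclusion h (w j)) : Fin (r + 1) → T) =
      consDet h b c v * b.det w := by
  have h1 := ((c.det.curryLeft v).compLinearMap (Submodule.inclusion h)).eq_smul_basis_det b
  have h2 := congrArg (fun f => f w) h1
  exact h2

theorem consDet_mul {S T U : Submodule ℝ V} (h : S ≤ T) (h' : T ≤ U) {r : ℕ}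
    (b : Module.Basis (Fin r) ℝ S) (c : Module.Basis (Fin (r + 1)) ℝ T)
    (d : Module.Basis (Fin (r + 1 + 1)) ℝ U) (v : T) (w : U) :
    consDet h b c v * consDet h' c d w =
      d.det (Fin.cons w (Fin.cons (Submodule.inclusion h' v)
        (fun j => Submodule.inclusion (h.trans h') (b j)))) := by
  rw [consDet, mul_comm, ← det_cons_inclusion]
  congr 2
  funext j
  refine Fin.cases rfl (fun j => ?_) j
  rfl

theorem det_cons_cons_swap {U : Submodule ℝ V} {r : ℕ}
    (d : Module.Basis (Fin (r + 1 + 1)) ℝ U) (v w : U) (x : Fin r → U) :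
    d.det (Fin.cons w (Fin.cons v x)) = - d.det (Fin.cons v (Fin.cons w x)) := by
  rw [← d.det.map_swap (Fin.cons v (Fin.cons w x)) (i := 0) (j := 1) (by simp)]
  congr 1
  funext j
  refine Fin.cases ?_ (fun j => Fin.cases ?_ (fun j => ?_) j) j
  · simp
  · simp
  · simp only [Function.comp, Fin.cons_succ]
    rw [Equiv.swap_apply_of_ne_of_ne (Fin.succ_ne_zero _)
      (fun h => Fin.succ_ne_zero j (Fin.succ_injective _ h) : j.succ.succ ≠ 1)]
    rfl

/-- A vector of S in the first slot is a combination of the remaining ones and contributes nothing.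
-/
theorem consDet_add_smul {S T : Submodule ℝ V} (h : S ≤ T) {r : ℕ} (b : Module.Basis (Fin r) ℝ S)
    (c : Module.Basis (Fin (r + 1)) ℝ T) (v : T) (t : ℝ) (g : S) :
    consDet h b c (t • v + Submodule.inclusion h g) = t * consDet h b c v := by
  have h0 : ∀ g : S, consDet h b c (Submodule.inclusion h g) = 0 := by
    let φ : S →ₗ[ℝ] ℝ :=
      { toFun := fun g => consDet h b c (Submodule.inclusion h g)
        map_add' := fun x y => by simp [consDet_eq]
        map_smul' := fun t x => by simp [consDet_eq] }
    have : φ = 0 := b.ext fun j => by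
      refine c.det.map_eq_zero_of_eq _ (i := 0) (j := j.succ) ?_ (Fin.succ_ne_zero j).symm
      simp
    exact fun g => LinearMap.congr_fun this g
  have h1 : consDet h b c (t • v + Submodule.inclusion h g) =
      t * consDet h b c v + consDet h b c (Submodule.inclusion h g) := by
    simp [consDet_eq]
  rw [h1, h0, add_zero]

theorem consDet_ne_zero {S T : Submodule ℝ V} (h : S ≤ T) {r : ℕ} (b : Module.Basis (Fin r) ℝ S)
    (c : Module.Basis (Fin (r + 1)) ℝ T) (v : T) (hv : (v : V) ∉ S) : consDet h b c v ≠ 0 := by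
  have h1 : LinearIndependent ℝ
      (Fin.cons v (fun j => Submodule.inclusion h (b j)) : Fin (r + 1) → T) := by
    rw [linearIndependent_finCons]
    refine ⟨b.linearIndependent.map' _ (Submodule.ker_inclusion _ _ h), fun hmem => hv ?_⟩
    have h2 : Submodule.span ℝ (Set.range fun j => Submodule.inclusion h (b j)) ≤
        Submodule.comap T.subtype S := by
      rw [Submodule.span_le]
      rintro _ ⟨j, rfl⟩
      exact (b j).2
    exact h2 hmem
  have h2 : Module.finrank ℝ T = r + 1 := by simpa using Module.finrank_eq_card_basis c
  have : FiniteDimensional ℝ T := c.finiteDimensional_of_finite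
  have h3 := h1.span_eq_top_of_card_eq_finrank' (by simp [h2])
  exact ((Module.Basis.is_basis_iff_det c).1 ⟨h1, h3⟩).ne_zero

/-- A subspace with an ordered basis. -/
abbrev OrientedSubspace (V : Type*) [AddCommGroup V] [Module ℝ V] : Type _ :=
  Σ S : Submodule ℝ V, Module.Basis (Fin (Module.finrank ℝ S)) ℝ S

open Classical in
/-- The orientation of `A` preceded by `v`, compared with that of `B`. -/
def incid (A B : OrientedSubspace V) (v : V) : SignType :=
  if h : A.1 ≤ B.1 ∧ Module.finrank ℝ B.1 = Module.finrank ℝ A.1 + 1 ∧ v ∈ B.1 then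
    SignType.sign (B.2.det fun i => (Fin.cons ⟨v, h.2.2⟩
      (fun j => Submodule.inclusion h.1 (A.2 j)) : Fin (Module.finrank ℝ A.1 + 1) → B.1)
        (Fin.cast h.2.1 i))
  else 0

theorem incid_eq (A B : OrientedSubspace V) {v : V} {r : ℕ} (hA : Module.finrank ℝ A.1 = r)
    (hB : Module.finrank ℝ B.1 = r + 1) (hle : A.1 ≤ B.1) (hv : v ∈ B.1) :
    incid A B v = SignType.sign (consDet hle (A.2.reindex (finCongr hA))
      (B.2.reindex (finCongr hB)) ⟨v, hv⟩) := by
  subst hA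
  rw [incid, dif_pos ⟨hle, hB, hv⟩, consDet, Module.Basis.det_reindex]
  congr 2
  funext i
  simp

theorem incid_ne_zero (A B : OrientedSubspace V) {v : V} (hle : A.1 ≤ B.1)
    (hr : Module.finrank ℝ B.1 = Module.finrank ℝ A.1 + 1) (hv : v ∈ B.1) (hvA : v ∉ A.1) :
    incid A B v ≠ 0 := by
  rw [incid_eq A B rfl hr hle hv, Ne, sign_eq_zero_iff]
  exact consDet_ne_zero _ _ _ _ hvA

/-- Both products are signs of the determinant of v, v' and a basis of A in C, with v and v'
interchanged. This is the sign behind ∂² = 0. -/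
theorem incid_mul_incid_neg (A B B' C : OrientedSubspace V) {v v' : V}
    (hAB : A.1 ≤ B.1) (hAB' : A.1 ≤ B'.1) (hBC : B.1 ≤ C.1) (hBC' : B'.1 ≤ C.1)
    (hrB : Module.finrank ℝ B.1 = Module.finrank ℝ A.1 + 1)
    (hrB' : Module.finrank ℝ B'.1 = Module.finrank ℝ A.1 + 1)
    (hrC : Module.finrank ℝ C.1 = Module.finrank ℝ A.1 + 1 + 1)
    (hv : v ∈ B.1) (hv' : v' ∈ B'.1) :
    incid A B v * incid B C v' = -(incid A B' v' * incid B' C v) := by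
  rw [incid_eq A B rfl hrB hAB hv, incid_eq A B' rfl hrB' hAB' hv',
    incid_eq B C hrB hrC hBC (hBC' hv'), incid_eq B' C hrB' hrC hBC' (hBC hv),
    ← sign_mul, ← sign_mul, consDet_mul, consDet_mul, ← Left.sign_neg, ← det_cons_cons_swap]
  rfl

variable [FiniteDimensional ℝ V]

/-- A is a hyperplane in B cut out by ψ, so two vectors on the same side of it differ by a positive
factor modulo A. The incidence number does not depend on the inward vector. -/
theorem incid_congr (A B : OrientedSubspace V) {v v' : V} (ψ : V →ₗ[ℝ] ℝ)
    (hψ : ∀ x ∈ A.1, ψ x = 0) (hle : A.1 ≤ B.1)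
    (hr : Module.finrank ℝ B.1 = Module.finrank ℝ A.1 + 1) (hv : v ∈ B.1) (hv' : v' ∈ B.1)
    (hpos : 0 < ψ v * ψ v') : incid A B v = incid A B v' := by
  have hv0 : ψ v ≠ 0 := fun h => by simp [h] at hpos
  have hAeq : A.1 = B.1 ⊓ LinearMap.ker ψ := by
    refine Submodule.eq_of_le_of_finrank_le (fun x hx => ⟨hle hx, hψ x hx⟩) ?_
    have := finrank_inf_ker B.1 ψ hv hv0
    omega
  have hg : v' - (ψ v' / ψ v) • v ∈ A.1 := by
    rw [hAeq]
    refine ⟨Submodule.sub_mem _ hv' (Submodule.smul_mem _ _ hv), ?_⟩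
    change ψ _ = 0
    simp only [map_sub, map_smul, smul_eq_mul]
    field_simp
    ring
  have hc : 0 < ψ v' / ψ v := by
    have h1 : ψ v' / ψ v = ψ v * ψ v' / (ψ v) ^ 2 := by field_simp
    rw [h1]; positivity
  rw [incid_eq A B rfl hr hle hv, incid_eq A B rfl hr hle hv']
  have h1 : (⟨v', hv'⟩ : B.1) = (ψ v' / ψ v) • ⟨v, hv⟩ +
      Submodule.inclusion hle ⟨_, hg⟩ := Subtype.ext (by simp)
  rw [h1, consDet_add_smul, sign_mul, sign_pos hc, one_mul]

end Incidence

/-! ### The differential of an oriented arrangement -/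

section CellDiff

variable {V : Type*} [AddCommGroup V] [Module ℝ V] [FiniteDimensional ℝ V]
  {ι : Type*} [DecidableEq ι] [Fintype ι]
  {a : ι → V →ₗ[ℝ] ℝ} {E : Finset ι} {W : Submodule ℝ V}

/-- A point of a cell. -/
def Cov.rep (X : Cov a E W) : V := X.2.choose

theorem Cov.rep_mem (X : Cov a E W) : X.rep ∈ W := X.2.choose_spec.1

theorem Cov.signVec_rep (X : Cov a E W) : signVec a E X.rep = X.1 := X.2.choose_spec.2

theorem Cov.rep_mem_flat (X : Cov a E W) : X.rep ∈ flat a E W X.1 := by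
  have := mem_flat_signVec (a := a) (E := E) X.rep_mem
  rwa [X.signVec_rep] at this

theorem Cov.sign_rep (X : Cov a E W) {e : ι} (he : e ∈ E) :
    SignType.sign (a e X.rep) = X.1 e := by rw [← signVec_of_mem he, X.signVec_rep]

open Classical in
/-- The incidence number of two cells of an arrangement with given orientations. -/
def covSign (O : Cov a E W → OrientedSubspace V) (G F : Cov a E W) : SignType :=
  if Conf G.1 F.1 ∧ rk a E W F.1 = rk a E W G.1 + 1 then incid (O G) (O F) F.rep else 0

theorem covSign_ne_zero_iff {O : Cov a E W → OrientedSubspace V}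
    (hO : ∀ X, (O X).1 = flat a E W X.1) (G F : Cov a E W) :
    covSign O G F ≠ 0 ↔ Conf G.1 F.1 ∧ rk a E W F.1 = rk a E W G.1 + 1 := by
  constructor
  · intro h
    by_contra hc
    exact h (if_neg hc)
  · intro h
    rw [covSign, if_pos h]
    refine incid_ne_zero _ _ ?_ ?_ ?_ ?_
    · rw [hO, hO]; exact h.1.flat_le
    · rw [hO, hO]; exact h.2
    · rw [hO]; exact F.rep_mem_flat
    · rw [hO]
      intro hmem
      have hne : G ≠ F := fun hh => by have := h.2; rw [hh] at this; omega
      obtain ⟨e, he, h1, h2⟩ := h.1.exists_zero_ne hne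
      rw [← F.sign_rep he, Ne, sign_eq_zero_iff] at h2
      exact h2 ((mem_flat.1 hmem).2 e he h1)

/-- Only the two cells H₁, H₂ of a diamond contribute. The inward vector of H₁ in F may be taken in
H₂ and conversely, and then the two paths differ by a swap of two vectors. -/
theorem sum_covSign_mul {K : Type*} [Field K] {O : Cov a E W → OrientedSubspace V}
    (hO : ∀ X, (O X).1 = flat a E W X.1) (G F : Cov a E W) :
    ∑ H, ((covSign O G H : ℤ) : K) * ((covSign O H F : ℤ) : K) = 0 := by
  by_cases hGF : Conf G.1 F.1 ∧ rk a E W F.1 = rk a E W G.1 + 2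
  · obtain ⟨H1, H2, hne, hH⟩ := diamond hGF.1 hGF.2
    have hz : ∀ H, H ≠ H1 ∧ H ≠ H2 →
        ((covSign O G H : ℤ) : K) * ((covSign O H F : ℤ) : K) = 0 := by
      rintro H ⟨h1, h2⟩
      by_contra h0
      have h3 : covSign O G H ≠ 0 := fun h => by simp [h] at h0
      have h4 : covSign O H F ≠ 0 := fun h => by simp [h] at h0
      rw [covSign_ne_zero_iff hO] at h3 h4
      rcases (hH H).1 ⟨h3.1, h4.1, h3.2⟩ with h | h
      exacts [h1 h, h2 h]
    rw [Fintype.sum_eq_add H1 H2 hne hz]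
    obtain ⟨hc1, hc1', hr1⟩ := (hH H1).2 (Or.inl rfl)
    obtain ⟨hc2, hc2', hr2⟩ := (hH H2).2 (Or.inr rfl)
    have hrF := hGF.2
    -- Two distinct cells between G and F of the same rank are separated by a functional that
    -- vanishes on the first and not on the second. On the second it has the sign that it has on F,
    -- so H' and F lie on the same side of H.
    have hne' : ∀ H H' : Cov a E W, H ≠ H' → Conf H.1 F.1 → Conf H'.1 F.1 →
        rk a E W H.1 = rk a E W G.1 + 1 → rk a E W H'.1 = rk a E W G.1 + 1 →
        incid (O H) (O F) F.rep = incid (O H) (O F) H'.rep := by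
      intro H H' hHH' hc hc' hr hr'
      obtain ⟨e, he, h1, h2⟩ : ∃ e ∈ E, H.1 e = 0 ∧ H'.1 e ≠ 0 := by
        by_contra hcon
        push Not at hcon
        have hle : flat a E W H'.1 ≤ flat a E W H.1 := fun v hv =>
          mem_flat.2 ⟨(mem_flat.1 hv).1, fun e he h0 => (mem_flat.1 hv).2 e he (hcon e he h0)⟩
        have heq := Submodule.eq_of_le_of_finrank_le hle (by
          change rk a E W H.1 ≤ rk a E W H'.1; omega)
        refine hHH' (Subtype.ext (funext fun e => ?_))
        by_cases he : e ∈ E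
        · have hiff : H.1 e = 0 ↔ H'.1 e = 0 := by
            refine ⟨hcon e he, fun h0 => ?_⟩
            have := (mem_flat.1 (heq.ge H.rep_mem_flat)).2 e he h0
            rw [← H.sign_rep he, this, sign_zero]
          by_cases h0 : H.1 e = 0
          · rw [h0, hiff.1 h0]
          · rw [(hc e).resolve_left h0, (hc' e).resolve_left (fun h => h0 (hiff.2 h))]
        · rw [← H.signVec_rep, ← H'.signVec_rep, signVec_of_notMem he, signVec_of_notMem he]
      have h3 : F.1 e = H'.1 e := ((hc' e).resolve_left h2).symm
      refine incid_congr _ _ (a e) ?_ ?_ ?_ ?_ ?_ ?_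
      · intro x hx
        rw [hO] at hx
        exact (mem_flat.1 hx).2 e he h1
      · rw [hO, hO]; exact hc.flat_le
      · rw [hO, hO]; change rk a E W F.1 = rk a E W H.1 + 1; omega
      · rw [hO]; exact F.rep_mem_flat
      · rw [hO]; exact hc'.flat_le H'.rep_mem_flat
      · rw [← sign_eq_one_iff, sign_mul, F.sign_rep he, H'.sign_rep he, h3]
        revert h2; generalize H'.1 e = s; revert s; decide
    have h1 : covSign O G H1 = incid (O G) (O H1) H1.rep := if_pos ⟨hc1, hr1⟩
    have h2 : covSign O G H2 = incid (O G) (O H2) H2.rep := if_pos ⟨hc2, hr2⟩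
    have h3 : covSign O H1 F = incid (O H1) (O F) H2.rep := by
      rw [covSign, if_pos ⟨hc1', by omega⟩, hne' H1 H2 hne hc1' hc2' hr1 hr2]
    have h4 : covSign O H2 F = incid (O H2) (O F) H1.rep := by
      rw [covSign, if_pos ⟨hc2', by omega⟩, hne' H2 H1 hne.symm hc2' hc1' hr2 hr1]
    have h5 := incid_mul_incid_neg (O G) (O H1) (O H2) (O F) (v := H1.rep) (v' := H2.rep)
      (by rw [hO, hO]; exact hc1.flat_le) (by rw [hO, hO]; exact hc2.flat_le)
      (by rw [hO, hO]; exact hc1'.flat_le) (by rw [hO, hO]; exact hc2'.flat_le)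
      (by rw [hO, hO]; exact hr1) (by rw [hO, hO]; exact hr2) (by rw [hO, hO]; exact hrF)
      (by rw [hO]; exact H1.rep_mem_flat) (by rw [hO]; exact H2.rep_mem_flat)
    rw [h1, h2, h3, h4]
    have h6 : ∀ x y z w : SignType, x * y = -(z * w) →
        (x : ℤ) * (y : ℤ) + (z : ℤ) * (w : ℤ) = 0 := by decide
    have h7 := h6 _ _ _ _ h5
    exact_mod_cast congrArg (Int.cast : ℤ → K) h7
  · refine Finset.sum_eq_zero fun H _ => ?_
    by_contra h0
    have h3 : covSign O G H ≠ 0 := fun h => by simp [h] at h0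
    have h4 : covSign O H F ≠ 0 := fun h => by simp [h] at h0
    rw [covSign_ne_zero_iff hO] at h3 h4
    exact hGF ⟨h3.1.trans h4.1, by omega⟩

/-- The differential with the incidence numbers of oriented cells. -/
def covDiff (K : Type*) [Field K] (O : Cov a E W → OrientedSubspace V) :
    (Cov a E W → K) →ₗ[K] (Cov a E W → K) :=
  Matrix.mulVecLin (Matrix.of fun G F => ((covSign O G F : ℤ) : K))

theorem covDiff_apply (K : Type*) [Field K] (O : Cov a E W → OrientedSubspace V)
    (z : Cov a E W → K) (G : Cov a E W) :
    covDiff K O z G = ∑ F, ((covSign O G F : ℤ) : K) * z F := rfl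

theorem isCellDiff_covDiff (K : Type*) [Field K] {O : Cov a E W → OrientedSubspace V}
    (hO : ∀ X, (O X).1 = flat a E W X.1) : IsCellDiff a E W (covDiff K O) where
  sq z := by
    funext G
    rw [covDiff_apply]
    simp_rw [covDiff_apply, Finset.mul_sum]
    rw [Finset.sum_comm]
    refine Finset.sum_eq_zero fun F _ => ?_
    simp_rw [← mul_assoc]
    rw [← Finset.sum_mul, sum_covSign_mul hO, zero_mul]
  ne_zero_iff G F := by
    rw [covDiff_apply, Finset.sum_eq_single F]
    · rw [Pi.single_eq_same, mul_one, ← covSign_ne_zero_iff hO G F]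
      rcases (covSign O G F).trichotomy with h | h | h <;> simp [h]
    · intro X _ hX
      rw [Pi.single_eq_of_ne hX, mul_zero]
    · simp

end CellDiff

/-- A presentation of a polytope `P ⊆ ℝⁿ` and of the hyperplanes in `H` that meet it by finitely
many linear functionals on `ℝ × ℝⁿ`. -/
structure Presentation {n : ℕ} (P : Set (Fin n → ℝ)) (H : Set (HyperplaneData n)) where
  ι : Type
  fintype : Fintype ι
  decEq : DecidableEq ι
  a : ι → (ℝ × (Fin n → ℝ)) →ₗ[ℝ] ℝ
  t : ι
  t_apply : ∀ v, a t v = v.1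
  facets : Set ι
  mem_iff : ∀ y, y ∈ P ↔ ∀ e ∈ facets, 0 ≤ a e (1, y)
  pointed : ∀ v, v.1 = 0 → (∀ e ∈ facets, 0 ≤ a e v) → v = 0
  bdd : ∃ N : ℝ, ∀ y ∈ P, ∀ i, 0 ≤ y i ∧ y i ≤ N
  cover : ∀ e, e = t ∨ e ∈ facets ∨ ∃ h ∈ H, ∀ v, a e v = h.1 v.2 - h.2 * v.1
  hyp : ∀ h ∈ H, (∃ e, ∀ v, a e v = h.1 v.2 - h.2 * v.1) ∨ ∀ y ∈ P, h.1 y < h.2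

/-! ### Cells of a presented subdivision and exposed faces -/

namespace Presentation

variable {n : ℕ} {P : Set (Fin n → ℝ)} {H : Set (HyperplaneData n)} (A : Presentation P H)

instance : Fintype A.ι := A.fintype

instance : DecidableEq A.ι := A.decEq

/-- The signs of the functionals at a point. -/
def sg (v : ℝ × (Fin n → ℝ)) : A.ι → SignType := signVec A.a Finset.univ v

theorem sg_apply (v : ℝ × (Fin n → ℝ)) (e : A.ι) : A.sg v e = SignType.sign (A.a e v) :=
  signVec_of_mem (Finset.mem_univ e) v

/-- The closed cell with a given sign vector. -/
def body (X : A.ι → SignType) : Set (Fin n → ℝ) := {y | Conf (A.sg (1, y)) X}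

theorem mem_body_self (y : Fin n → ℝ) : y ∈ A.body (A.sg (1, y)) := Conf.refl _

theorem sg_zero_iff {v : ℝ × (Fin n → ℝ)} {e : A.ι} : A.sg v e = 0 ↔ A.a e v = 0 := by
  rw [sg_apply, sign_eq_zero_iff]

theorem apply_eq_zero_of_mem_body {X : A.ι → SignType} {y : Fin n → ℝ} (hy : y ∈ A.body X)
    {e : A.ι} (he : X e = 0) : A.a e (1, y) = 0 := by
  rw [← sg_zero_iff]
  rcases hy e with h | h
  · exact h
  · rw [h, he]

theorem body_mono {X Y : A.ι → SignType} (h : Conf X Y) : A.body X ⊆ A.body Y :=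
  fun _ hy => Conf.trans hy h

/-- The point y₀ is in the relative interior of its own cell, so a segment that ends at y₀ can be
prolonged inside the open cell. -/
theorem exists_beyond {y₀ y : Fin n → ℝ} (hy : y ∈ A.body (A.sg (1, y₀))) :
    ∃ ε : ℝ, 0 < ε ∧ A.sg (1, y₀ + ε • (y₀ - y)) = A.sg (1, y₀) := by
  obtain ⟨ε, hε, h⟩ := exists_signVec_add A.a Finset.univ ((1 : ℝ), y₀) ((0 : ℝ), y₀ - y)
  refine ⟨ε, hε, funext fun e => ?_⟩
  have h1 : ((1 : ℝ), y₀ + ε • (y₀ - y)) = ((1 : ℝ), y₀) + ε • ((0 : ℝ), y₀ - y) := by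
    ext <;> simp
  rw [sg_apply, sg_apply, h1, h e (Finset.mem_univ e)]
  split_ifs with h0
  · have h2 := A.apply_eq_zero_of_mem_body hy (A.sg_zero_iff.2 h0)
    have h3 : ((0 : ℝ), y₀ - y) = ((1 : ℝ), y₀) - ((1 : ℝ), y) := by ext <;> simp
    rw [h3, map_sub, h2, h0, sub_zero]
  · rfl

/-- Exposed faces, which are defined by maximising functionals, are translated into sign vectors
here. The second hypothesis says that no functional has both strict signs on R, so R is one closed
region rather than a union. -/
theorem isExposed_iff {δ : A.ι → Set SignType} (h0 : ∀ e, 0 ∈ δ e)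
    (hδ : ∀ e, ¬(1 ∈ δ e ∧ -1 ∈ δ e)) {R : Set (Fin n → ℝ)}
    (hR : R = {y | ∀ e, A.sg (1, y) e ∈ δ e}) {G : Set (Fin n → ℝ)} (hG : G.Nonempty) :
    IsExposed ℝ R G ↔ ∃ y ∈ R, G = A.body (A.sg (1, y)) := by
  classical
  have hmem : ∀ y, y ∈ R ↔ ∀ e, A.sg (1, y) e ∈ δ e := fun y => by rw [hR]; rfl
  have hcompat : ∀ e (s s' : SignType), s ∈ δ e → s' ∈ δ e → s' ≠ 0 → s = 0 ∨ s = s' := by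
    intro e s s' hs hs' h
    have := hδ e
    rcases s.trichotomy with rfl | rfl | rfl <;> rcases s'.trichotomy with rfl | rfl | rfl <;>
      simp_all
  have hbody : ∀ y ∈ R, A.body (A.sg (1, y)) ⊆ R := by
    intro y hy x hx
    rw [hmem] at hy ⊢
    intro e
    rcases hx e with h | h
    · rw [h]; exact h0 e
    · rw [h]; exact hy e
  constructor
  · intro hex
    obtain ⟨l, hl⟩ := hex hG
    -- A point of G with the fewest vanishing functionals is generic in G: at the midpoint with any
    -- other point of G no further functional may become nonzero.
    obtain ⟨y₀, hy₀G, hmin⟩ := (InvImage.wf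
      (fun y => (Finset.univ.filter fun e => A.a e (1, y) = 0).card) wellFounded_lt).has_min G hG
    have hGR : ∀ y ∈ G, y ∈ R := fun y hy => by rw [hl] at hy; exact hy.1
    have hGl : ∀ y ∈ G, ∀ x ∈ R, l x ≤ l y := fun y hy => by rw [hl] at hy; exact hy.2
    refine ⟨y₀, hGR y₀ hy₀G, Set.Subset.antisymm (fun y hy => ?_) (fun y hy => ?_)⟩
    · set m := (1 / 2 : ℝ) • y + (1 / 2 : ℝ) • y₀ with hm
      have hm1 : ((1 : ℝ), m) = (1 / 2 : ℝ) • ((1 : ℝ), y) + (1 / 2 : ℝ) • ((1 : ℝ), y₀) := by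
        ext
        · simp; norm_num
        · simp [hm]
      have hmR : m ∈ R := by
        rw [hmem]
        intro e
        rw [sg_apply, hm1, map_add, map_smul, map_smul, smul_eq_mul, smul_eq_mul]
        refine sign_comb_mem (h0 e) ?_ ?_ (by norm_num) (by norm_num)
        · rw [← sg_apply]; exact (hmem y).1 (hGR y hy) e
        · rw [← sg_apply]; exact (hmem y₀).1 (hGR y₀ hy₀G) e
      have hlm : l m = l y₀ := by
        have h1 := hGl y hy y₀ (hGR _ hy₀G)
        have h2 := hGl y₀ hy₀G y (hGR _ hy)
        have h3 : l y = l y₀ := le_antisymm h2 h1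
        rw [hm, map_add, map_smul, map_smul, h3, smul_eq_mul]; ring
      have hmG : m ∈ G := by
        rw [hl]
        exact ⟨hmR, fun x hx => by rw [hlm]; exact hGl y₀ hy₀G x hx⟩
      have hzero : ∀ e, A.a e (1, m) = 0 → A.a e (1, y) = 0 ∧ A.a e (1, y₀) = 0 := by
        intro e he
        rw [hm1, map_add, map_smul, map_smul, smul_eq_mul, smul_eq_mul] at he
        have hs := (hmem y).1 (hGR y hy) e
        have hs' := (hmem y₀).1 (hGR y₀ hy₀G) e
        by_cases h1 : A.a e (1, y₀) = 0
        · refine ⟨?_, h1⟩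
          rw [h1] at he; linarith
        · exfalso
          rcases hcompat e _ _ hs hs' (by rwa [Ne, sg_zero_iff]) with h2 | h2
          · rw [sg_zero_iff] at h2
            rw [h2] at he
            exact h1 (by linarith)
          · rw [sg_apply, sg_apply] at h2
            rcases lt_or_gt_of_ne h1 with h3 | h3
            · rw [sign_neg h3, sign_eq_neg_one_iff] at h2; linarith
            · rw [sign_pos h3, sign_eq_one_iff] at h2; linarith
      intro e
      by_cases h1 : A.a e (1, y₀) = 0
      · left
        rw [sg_zero_iff]
        by_contra h2
        refine hmin m hmG (Finset.card_lt_card ⟨fun e he => ?_, fun hsub => ?_⟩)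
        · simp only [Finset.mem_filter, Finset.mem_univ, true_and] at he ⊢
          exact (hzero e he).2
        · have := hsub (show e ∈ _ by simpa using h1)
          simp only [Finset.mem_filter, Finset.mem_univ, true_and] at this
          exact h2 (hzero e this).1
      · exact hcompat e _ _ ((hmem y).1 (hGR y hy) e) ((hmem y₀).1 (hGR y₀ hy₀G) e)
          (by rwa [Ne, sg_zero_iff])
    -- The segment from y prolonged beyond y₀ stays in R, so l, which is maximal at y₀, cannot be
    -- smaller at y.
    · obtain ⟨ε, hε, hz⟩ := A.exists_beyond hy
      have hyR : y ∈ R := hbody y₀ (hGR _ hy₀G) hy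
      have hzR : y₀ + ε • (y₀ - y) ∈ R := by
        rw [hmem, hz, ← hmem]; exact hGR _ hy₀G
      have h1 := hGl y₀ hy₀G _ hzR
      rw [map_add, map_smul, map_sub, smul_eq_mul] at h1
      have h2 : l y₀ ≤ l y := by
        by_contra hc
        push Not at hc
        nlinarith
      rw [hl]
      exact ⟨hyR, fun x hx => (hGl y₀ hy₀G x hx).trans h2⟩
  · rintro ⟨y₀, hy₀, rfl⟩ _
    -- With these signs every functional is nonnegative on R; if only 0 is allowed either choice
    -- would do. The sum of those that vanish at y₀ is nonnegative on R and vanishes exactly on the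
    -- cell of y₀.
    let σ : A.ι → ℝ := fun e => if (1 : SignType) ∈ δ e then 1 else -1
    have hσ : ∀ y ∈ R, ∀ e, 0 ≤ σ e * A.a e (1, y) := by
      intro y hy e
      have h1 := (hmem y).1 hy e
      rw [sg_apply] at h1
      by_cases h2 : (1 : SignType) ∈ δ e
      · simp only [σ, if_pos h2, one_mul]
        by_contra hc
        rw [sign_neg (not_le.1 hc)] at h1
        exact hδ e ⟨h2, h1⟩
      · simp only [σ, if_neg h2]
        by_contra hc
        rw [sign_pos (by linarith)] at h1
        exact h2 h1
    have hσ0 : ∀ e, σ e ≠ 0 := fun e => by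
      simp only [σ]; split_ifs <;> norm_num
    let Z := Finset.univ.filter fun e => A.sg (1, y₀) e = 0
    let L : (ℝ × (Fin n → ℝ)) →ₗ[ℝ] ℝ := ∑ e ∈ Z, σ e • A.a e
    have hL : ∀ v, L v = ∑ e ∈ Z, σ e * A.a e v := fun v => by simp [L]
    refine ⟨LinearMap.toContinuousLinearMap (-(L ∘ₗ LinearMap.inr ℝ ℝ (Fin n → ℝ))), ?_⟩
    have hl : ∀ x y, (LinearMap.toContinuousLinearMap (-(L ∘ₗ LinearMap.inr ℝ ℝ (Fin n → ℝ)))) y ≤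
        (LinearMap.toContinuousLinearMap (-(L ∘ₗ LinearMap.inr ℝ ℝ (Fin n → ℝ)))) x ↔
        L (1, x) ≤ L (1, y) := by
      intro x y
      have h1 : ∀ w : Fin n → ℝ, L (1, w) = L (1, 0) + L (0, w) := fun w => by
        rw [← map_add]; simp
      rw [h1 x, h1 y]
      simp
    have hLy₀ : ∀ y ∈ A.body (A.sg (1, y₀)), L (1, y) = 0 := by
      intro y hy
      rw [hL]
      refine Finset.sum_eq_zero fun e he => ?_
      rw [A.apply_eq_zero_of_mem_body hy (by simpa [Z] using he), mul_zero]
    ext x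
    constructor
    · intro hx
      refine ⟨hbody y₀ hy₀ hx, fun y hy => ?_⟩
      rw [hl, hLy₀ x hx, hL]
      exact Finset.sum_nonneg fun e _ => hσ y hy e
    · rintro ⟨hxR, hx⟩
      have h1 := (hl x y₀).1 (hx y₀ hy₀)
      rw [hLy₀ y₀ (A.mem_body_self y₀), hL] at h1
      have h2 := (Finset.sum_eq_zero_iff_of_nonneg fun e _ => hσ x hxR e).1
        (le_antisymm h1 (Finset.sum_nonneg fun e _ => hσ x hxR e))
      intro e
      by_cases h3 : A.sg (1, y₀) e = 0
      · left
        have h4 := h2 e (by simpa [Z] using h3)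
        rw [sg_zero_iff]
        exact (mul_eq_zero.1 h4).resolve_left (hσ0 e)
      · exact hcompat e _ _ ((hmem x).1 hxR e) ((hmem y₀).1 hy₀ e) h3

/-- The functionals that are nonnegative on the polytope. -/
theorem sg_nonneg {y : Fin n → ℝ} (hy : y ∈ P) {e : A.ι} (he : e = A.t ∨ e ∈ A.facets) :
    A.sg (1, y) e ∈ ({0, 1} : Set SignType) := by
  have h : 0 ≤ A.a e (1, y) := by
    rcases he with rfl | he
    · rw [A.t_apply]; exact zero_le_one
    · exact (A.mem_iff y).1 hy e he
  rw [sg_apply]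
  rcases h.eq_or_lt with h | h
  · left; rw [← h, sign_zero]
  · right; exact sign_pos h

theorem mem_of_sg {y : Fin n → ℝ} (h : ∀ e ∈ A.facets, A.sg (1, y) e ∈ ({0, 1} : Set SignType)) :
    y ∈ P := by
  rw [A.mem_iff]
  intro e he
  have := h e he
  rw [sg_apply] at this
  rcases this with h | h
  · exact (sign_eq_zero_iff.1 h).ge
  · exact (sign_eq_one_iff.1 h).le

theorem body_subset {y : Fin n → ℝ} (hy : y ∈ P) : A.body (A.sg (1, y)) ⊆ P := by
  intro x hx
  refine A.mem_of_sg fun e he => ?_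
  rcases hx e with h | h
  · left; exact h
  · rw [h]; exact A.sg_nonneg hy (Or.inr he)

/-- Each nonempty region is given by sign conditions, so its faces are closed cells of its points;
conversely a point y lies in the region whose upper sides are the hyperplanes h with h.2 ≤ h.1 y. -/
theorem mem_cells_iff (A : Presentation P H) {C : Set (Fin n → ℝ)} :
    C ∈ subdivisionCells P H ↔ ∃ y ∈ P, C = A.body (A.sg (1, y)) := by
  classical
  -- One functional may be a facet and also a cutting hyperplane; contradictory requirements then
  -- leave only the sign 0. Hyperplanes without a functional miss the polytope and exclude only
  -- empty regions.
  let δ : Set (HyperplaneData n) → A.ι → Set SignType := fun U e =>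
    {s | s = 0 ∨ ((e = A.t ∨ e ∈ A.facets → s = 1) ∧
      ∀ h ∈ H, (∀ v, A.a e v = h.1 v.2 - h.2 * v.1) → (h ∈ U → s = 1) ∧ (h ∉ U → s = -1))}
  have h0 : ∀ U e, 0 ∈ δ U e := fun U e => Or.inl rfl
  have hδ : ∀ U e, ¬(1 ∈ δ U e ∧ -1 ∈ δ U e) := by
    rintro U e ⟨h1, h2⟩
    replace h1 := h1.resolve_left (by decide)
    replace h2 := h2.resolve_left (by decide)
    rcases A.cover e with he | he | ⟨h, hH, he⟩
    · exact absurd (h2.1 (Or.inl he)) (by decide)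
    · exact absurd (h2.1 (Or.inr he)) (by decide)
    · by_cases hU : h ∈ U
      · exact absurd ((h2.2 h hH he).1 hU) (by decide)
      · exact absurd ((h1.2 h hH he).2 hU) (by decide)
  have hreg : ∀ U, (region P H U).Nonempty →
      region P H U = {y | ∀ e, A.sg (1, y) e ∈ δ U e} := by
    rintro U ⟨y₀, hy₀P, hy₀⟩
    ext y
    constructor
    · rintro ⟨hyP, hy⟩ e
      by_cases hs : A.sg (1, y) e = 0
      · exact Or.inl hs
      · refine Or.inr ⟨fun he => ?_, fun h hh he => ⟨fun hU => ?_, fun hU => ?_⟩⟩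
        · exact (A.sg_nonneg hyP he).resolve_left hs
        · have h1 := (hy h hh).1 hU
          rw [sg_apply, sign_eq_one_iff]
          rw [sg_zero_iff] at hs
          refine lt_of_le_of_ne ?_ (Ne.symm hs)
          rw [he]; simpa using h1
        · have h1 := (hy h hh).2 hU
          rw [sg_apply, sign_eq_neg_one_iff]
          rw [sg_zero_iff] at hs
          refine lt_of_le_of_ne ?_ hs
          rw [he]; simpa using h1
    · intro hy
      have hyP : y ∈ P := A.mem_of_sg fun e he => by
        rcases hy e with h | h
        · left; exact h
        · right; exact h.1 (Or.inr he)
      refine ⟨hyP, fun h hh => ⟨fun hU => ?_, fun hU => ?_⟩⟩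
      · rcases A.hyp h hh with ⟨e, he⟩ | hlt
        · have h1 : 0 ≤ A.a e (1, y) := by
            rcases hy e with h1 | h1
            · exact (A.sg_zero_iff.1 h1).ge
            · have := (h1.2 h hh he).1 hU
              rw [sg_apply, sign_eq_one_iff] at this
              exact this.le
          rw [he] at h1
          simpa using h1
        · exact absurd (hlt y₀ hy₀P) (not_lt.2 ((hy₀ h hh).1 hU))
      · rcases A.hyp h hh with ⟨e, he⟩ | hlt
        · have h1 : A.a e (1, y) ≤ 0 := by
            rcases hy e with h1 | h1
            · exact (A.sg_zero_iff.1 h1).le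
            · have := (h1.2 h hh he).2 hU
              rw [sg_apply, sign_eq_neg_one_iff] at this
              exact this.le
          rw [he] at h1
          simpa using h1
        · exact (hlt y hyP).le
  constructor
  · rintro ⟨hC, U, hU⟩
    have hne : (region P H U).Nonempty := hC.mono hU.subset
    obtain ⟨y, hy, hCy⟩ := (A.isExposed_iff (h0 U) (hδ U) (hreg U hne) hC).1 hU
    exact ⟨y, hy.1, hCy⟩
  · rintro ⟨y, hy, rfl⟩
    have hyU : y ∈ region P H {h | h.2 ≤ h.1 y} :=
      ⟨hy, fun h _ => ⟨fun h1 => h1, fun h1 => (not_le.1 h1).le⟩⟩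
    exact ⟨⟨y, A.mem_body_self y⟩, {h | h.2 ≤ h.1 y}, (A.isExposed_iff (h0 _) (hδ _)
      (hreg _ ⟨y, hyU⟩) ⟨y, A.mem_body_self y⟩).2 ⟨y, hyU, rfl⟩⟩

/-- A closed cell is itself a region with signs in {0, s}, so `isExposed_iff` also describes its
faces. This makes the subdivision a polyhedral complex. -/
theorem mem_cells_and_subset_iff (A : Presentation P H) {C G : Set (Fin n → ℝ)} (hC : C ∈ subdivisionCells P H) :
    G ∈ subdivisionCells P H ∧ G ⊆ C ↔ G.Nonempty ∧ IsExposed ℝ C G := by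
  obtain ⟨y, hy, rfl⟩ := A.mem_cells_iff.1 hC
  have key : ∀ {G : Set (Fin n → ℝ)}, G.Nonempty → (IsExposed ℝ (A.body (A.sg (1, y))) G ↔
      ∃ y' ∈ A.body (A.sg (1, y)), G = A.body (A.sg (1, y'))) := fun hG =>
    A.isExposed_iff (δ := fun e => {0, A.sg (1, y) e}) (fun e => Or.inl rfl)
      (fun e => by generalize A.sg (1, y) e = s; revert s; simp) rfl hG
  constructor
  · rintro ⟨hG, hGC⟩
    obtain ⟨y', hy', rfl⟩ := A.mem_cells_iff.1 hG
    exact ⟨⟨y', A.mem_body_self y'⟩, (key ⟨y', A.mem_body_self y'⟩).2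
      ⟨y', hGC (A.mem_body_self y'), rfl⟩⟩
  · rintro ⟨hG, hex⟩
    obtain ⟨y', hy', rfl⟩ := (key hG).1 hex
    exact ⟨A.mem_cells_iff.2 ⟨y', A.body_subset hy hy', rfl⟩, hex.subset⟩

theorem finite_cells (A : Presentation P H) : (subdivisionCells P H).Finite := by
  refine (Set.finite_range A.body).subset fun C hC => ?_
  obtain ⟨y, -, rfl⟩ := A.mem_cells_iff.1 hC
  exact ⟨_, rfl⟩

end Presentation

/-! ### Incidence numbers of exposed faces -/

namespace CellComplex

variable {n : ℕ}

/-- The definition of `sign` uses an arbitrarily chosen point of F off G. A functional supporting F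
along G allows any other inward vector in its place. -/
theorem sign_eq_incid (X : CellComplex n) {G F : Set (Fin n → ℝ)} (hGF : G ⊆ F)
    (hr : rank F = rank G + 1) (ψ : (ℝ × (Fin n → ℝ)) →ₗ[ℝ] ℝ) (hψG : ∀ y ∈ G, ψ (1, y) = 0)
    (hψF : ∀ y ∈ F \ G, 0 < ψ (1, y)) {v : ℝ × (Fin n → ℝ)} (hv : v ∈ coneSpan F) (hv0 : 0 < ψ v)
    (hne : (F \ G).Nonempty) :
    X.sign G F = (incid ⟨coneSpan G, X.orient G⟩ ⟨coneSpan F, X.orient F⟩ v : ℤ) := by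
  have h : G ⊆ F ∧ rank F = rank G + 1 ∧ (F \ G).Nonempty := ⟨hGF, hr, hne⟩
  have h1 : X.sign G F = (incid ⟨coneSpan G, X.orient G⟩ ⟨coneSpan F, X.orient F⟩
      ((1 : ℝ), h.2.2.some) : ℤ) := by
    rw [sign, dif_pos h, incid, dif_pos ⟨coneSpan_mono h.1, h.2.1, mem_coneSpan h.2.2.some_mem.1⟩]
    rfl
  rw [h1]
  refine congrArg (fun s : SignType => (s : ℤ)) (incid_congr ⟨coneSpan G, X.orient G⟩
    ⟨coneSpan F, X.orient F⟩ ψ (fun x hx => ?_) (coneSpan_mono hGF) hr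
    (mem_coneSpan h.2.2.some_mem.1) hv (mul_pos (hψF _ h.2.2.some_mem) hv0))
  have h2 : coneSpan G ≤ LinearMap.ker ψ := by
    rw [coneSpan, Submodule.span_le]
    rintro _ ⟨y, hy, rfl⟩
    exact hψG y hy
  exact h2 hx

theorem sign_ne_zero {X : CellComplex n} {G F : Set (Fin n → ℝ)} (h : X.sign G F ≠ 0) :
    G ⊆ F ∧ rank F = rank G + 1 ∧ (F \ G).Nonempty := by
  by_contra hc
  exact h (dif_neg hc)

/-- The affine functional l(g) - l in homogeneous coordinates; for the empty face the height does
the job. -/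
theorem exists_supporting {G F : Set (Fin n → ℝ)} (h : IsExposed ℝ F G) :
    ∃ ψ : (ℝ × (Fin n → ℝ)) →ₗ[ℝ] ℝ, (∀ y ∈ G, ψ (1, y) = 0) ∧ ∀ y ∈ F \ G, 0 < ψ (1, y) := by
  rcases G.eq_empty_or_nonempty with rfl | hne
  · exact ⟨LinearMap.fst ℝ ℝ _, fun y hy => hy.elim, fun y _ => by simp⟩
  · obtain ⟨l, hl⟩ := h hne
    obtain ⟨g, hg⟩ := hne
    have hmem : ∀ y, y ∈ G ↔ y ∈ F ∧ ∀ x ∈ F, l x ≤ l y := fun y => by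
      conv_lhs => rw [hl]
      rfl
    refine ⟨l g • LinearMap.fst ℝ ℝ _ - l.toLinearMap ∘ₗ LinearMap.snd ℝ ℝ _, fun y hy => ?_,
      fun y hy => ?_⟩
    · have h1 := ((hmem y).1 hy).2 g ((hmem g).1 hg).1
      have h2 := ((hmem g).1 hg).2 y ((hmem y).1 hy).1
      simp; linarith
    · have h1 := ((hmem g).1 hg).2 y hy.1
      have h2 : l y < l g := by
        refine lt_of_le_of_ne h1 fun h3 => hy.2 ((hmem y).2 ⟨hy.1, fun x hx => ?_⟩)
        rw [h3]; exact ((hmem g).1 hg).2 x hx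
      simp; linarith

/-- The faces, including the empty one. -/
def AllFace (X : CellComplex n) : Type := {C : Set (Fin n → ℝ) // C = ∅ ∨ C ∈ X.cells}

/-- The parts of a labelled complex with bounded labels are acyclic. -/
structure IsAcyclic (K : Type*) [Field K] (X : CellComplex n) : Prop where
  finite : X.cells.Finite
  label_mono : ∀ C D : X.AllFace, C.1 ⊆ D.1 → X.label C.1 ≤ X.label D.1
  sq : ∀ G F : X.AllFace, ∑ᶠ H : X.AllFace, ((X.sign G.1 H.1 : ℤ) : K) * (X.sign H.1 F.1 : ℤ) = 0
  exact : ∀ b : Fin n →₀ ℕ, (∃ C ∈ X.cells, X.label C ≤ b) → ∀ z : X.AllFace → K,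
    (∀ C, z C ≠ 0 → X.label C.1 ≤ b) →
    (∀ G : X.AllFace, ∑ᶠ F : X.AllFace, ((X.sign G.1 F.1 : ℤ) : K) * z F = 0) →
    ∃ y : X.AllFace → K, (∀ C, y C ≠ 0 → X.label C.1 ≤ b) ∧
      ∀ G : X.AllFace, ∑ᶠ F : X.AllFace, ((X.sign G.1 F.1 : ℤ) : K) * y F = z G

end CellComplex

/-! ### The cone over the polytope as part of an arrangement -/

namespace Presentation

variable {n : ℕ} {P : Set (Fin n → ℝ)} {H : Set (HyperplaneData n)} (A : Presentation P H)

/-- The cells of the arrangement. -/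
abbrev ACov : Type := Cov A.a Finset.univ ⊤

/-- The cells of the cone over the polytope. -/
def inner : Set A.ACov :=
  {X | ∀ e, e = A.t ∨ e ∈ A.facets → X.1 e ∈ ({0, 1} : Set SignType)}

theorem sg_rep (X : A.ACov) : A.sg X.rep = X.1 := X.signVec_rep

/-- The cell of a point. -/
def cov (v : ℝ × (Fin n → ℝ)) : A.ACov := ⟨A.sg v, v, trivial, rfl⟩

theorem sg_smul {c : ℝ} (hc : 0 < c) (v : ℝ × (Fin n → ℝ)) : A.sg (c • v) = A.sg v := by
  funext e
  rw [sg_apply, sg_apply, map_smul, smul_eq_mul, sign_mul, sign_pos hc, one_mul]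

theorem exists_of_t_eq_one {X : A.ACov} (hX : X.1 A.t = 1) :
    ∃ y, A.sg (1, y) = X.1 ∧ X.rep = X.rep.1 • ((1 : ℝ), y) ∧ 0 < X.rep.1 := by
  have h1 : 0 < X.rep.1 := by
    rw [← A.sg_rep, A.sg_apply, A.t_apply, sign_eq_one_iff] at hX
    exact hX
  have h2 : X.rep = X.rep.1 • ((1 : ℝ), X.rep.1⁻¹ • X.rep.2) := by
    ext
    · simp
    · simp only [Prod.smul_snd, smul_inv_smul₀ h1.ne']
  refine ⟨X.rep.1⁻¹ • X.rep.2, ?_, h2, h1⟩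
  rw [← A.sg_rep, ← A.sg_smul h1, ← h2]

/-- Because the cone over a polytope is pointed, its only cell at height zero is the apex, which
plays the role of the empty face. -/
theorem eq_zero_of_t_eq_zero {X : A.ACov} (hX : X ∈ A.inner) (ht : X.1 A.t = 0) : X = A.cov 0 := by
  have h1 : X.rep = 0 := by
    refine A.pointed _ ?_ fun e he => ?_
    · rwa [← A.sg_rep, A.sg_zero_iff, A.t_apply] at ht
    · have := hX e (Or.inr he)
      rw [← A.sg_rep, A.sg_apply] at this
      rcases this with h | h
      · exact (sign_eq_zero_iff.1 h).ge
      · exact (sign_eq_one_iff.1 h).le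
  refine Subtype.ext ?_
  rw [← A.sg_rep, h1]; rfl

theorem body_cov_zero : A.body (A.cov 0).1 = ∅ := by
  refine Set.eq_empty_of_forall_notMem fun y hy => ?_
  have h1 := A.apply_eq_zero_of_mem_body hy (e := A.t) (by
    change A.sg 0 A.t = 0
    rw [A.sg_zero_iff, map_zero])
  rw [A.t_apply] at h1
  exact one_ne_zero h1

theorem cov_zero_mem_inner : A.cov 0 ∈ A.inner := fun e _ => by
  left
  change A.sg 0 e = 0
  rw [A.sg_zero_iff, map_zero]

theorem conf_cov_zero (X : A.ACov) : Conf (A.cov 0).1 X.1 := fun e => by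
  left
  change A.sg 0 e = 0
  rw [A.sg_zero_iff, map_zero]

theorem inner_cases {X : A.ACov} (hX : X ∈ A.inner) :
    X = A.cov 0 ∨ ∃ y ∈ P, X = A.cov (1, y) := by
  rcases hX A.t (Or.inl rfl) with h | h
  · exact Or.inl (A.eq_zero_of_t_eq_zero hX h)
  · obtain ⟨y, hy, -, -⟩ := A.exists_of_t_eq_one h
    refine Or.inr ⟨y, A.mem_of_sg fun e he => ?_, Subtype.ext hy.symm⟩
    rw [hy]; exact hX e (Or.inr he)

theorem cov_mem_inner {y : Fin n → ℝ} (hy : y ∈ P) : A.cov (1, y) ∈ A.inner :=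
  fun _ he => A.sg_nonneg hy he

theorem conf_iff_body_subset {X Y : A.ACov} (hX : X ∈ A.inner) :
    Conf X.1 Y.1 ↔ A.body X.1 ⊆ A.body Y.1 := by
  refine ⟨A.body_mono, fun h => ?_⟩
  rcases A.inner_cases hX with rfl | ⟨y, -, rfl⟩
  · exact A.conf_cov_zero Y
  · exact h (A.mem_body_self y)

theorem body_injOn : Set.InjOn (fun X : A.ACov => A.body X.1) A.inner := fun _ hX _ hY h =>
  Subtype.ext (((A.conf_iff_body_subset hX).2 h.subset).antisymm
    ((A.conf_iff_body_subset hY).2 h.superset))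

/-- For v in the flat, (1, y) + ε v has the same signs as (1, y); rescaled to height one it is a
point of the cell, so v is a combination of two vectors over the cell. This makes `rank` agree with
`rk`. -/
theorem coneSpan_body {X : A.ACov} (hX : X ∈ A.inner) :
    coneSpan (A.body X.1) = flat A.a Finset.univ ⊤ X.1 := by
  refine le_antisymm ?_ fun v hv => ?_
  · rw [coneSpan, Submodule.span_le]
    rintro _ ⟨y, hy, rfl⟩
    exact mem_flat.2 ⟨trivial, fun e _ he => A.apply_eq_zero_of_mem_body hy he⟩
  · rcases A.inner_cases hX with rfl | ⟨y, -, rfl⟩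
    · have h1 : ∀ e, A.a e v = 0 := fun e => (mem_flat.1 hv).2 e (Finset.mem_univ e) (by
        change A.sg 0 e = 0
        rw [A.sg_zero_iff, map_zero])
      have h2 : v = 0 := A.pointed v (by rw [← A.t_apply]; exact h1 _) fun e _ => (h1 e).ge
      rw [h2]; exact Submodule.zero_mem _
    · obtain ⟨ε, hε, h⟩ := exists_signVec_add A.a Finset.univ ((1 : ℝ), y) v
      have h1 : A.sg (((1 : ℝ), y) + ε • v) = A.sg (1, y) := by
        funext e
        rw [A.sg_apply, A.sg_apply, h e (Finset.mem_univ e)]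
        split_ifs with h0
        · rw [(mem_flat.1 hv).2 e (Finset.mem_univ e) (A.sg_zero_iff.2 h0), h0]
        · rfl
      have h2 : (A.cov (((1 : ℝ), y) + ε • v)) = A.cov (1, y) := Subtype.ext h1
      have hpos : 0 < 1 + ε * v.1 := by
        have h3 := congrFun h1 A.t
        rw [A.sg_apply, A.sg_apply, A.t_apply, A.t_apply] at h3
        simpa [sign_eq_one_iff] using h3
      set c := 1 + ε * v.1 with hc
      have h4 : ((1 : ℝ), y) + ε • v = c • ((1 : ℝ), c⁻¹ • (y + ε • v.2)) := by
        ext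
        · simp [hc]
        · simp [hpos.ne']
      have h5 : c⁻¹ • (y + ε • v.2) ∈ A.body (A.cov (1, y)).1 := by
        have h6 : A.sg (1, c⁻¹ • (y + ε • v.2)) = A.sg (1, y) := by
          rw [← h1, h4, A.sg_smul hpos]
        change Conf _ _
        rw [h6]; exact Conf.refl _
      have h7 : ((1 : ℝ), y) + ε • v ∈ coneSpan (A.body (A.cov (1, y)).1) := by
        rw [h4]; exact Submodule.smul_mem _ _ (mem_coneSpan h5)
      have h8 : ((1 : ℝ), y) ∈ coneSpan (A.body (A.cov (1, y)).1) :=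
        mem_coneSpan (A.mem_body_self y)
      have h9 := Submodule.smul_mem _ ε⁻¹ (Submodule.sub_mem _ h7 h8)
      rwa [add_sub_cancel_left, inv_smul_smul₀ hε.ne'] at h9

theorem rank_body {X : A.ACov} (hX : X ∈ A.inner) :
    rank (A.body X.1) = rk A.a Finset.univ ⊤ X.1 := by
  rw [rank, A.coneSpan_body hX, rk]

open Classical in
/-- The orientations of the cells of the arrangement given by orientations of the cells of the
polytope. -/
def orientation (o : CellOrientation n) (X : A.ACov) : OrientedSubspace (ℝ × (Fin n → ℝ)) :=
  if X ∈ A.inner then ⟨coneSpan (A.body X.1), o (A.body X.1)⟩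
  else ⟨flat A.a Finset.univ ⊤ X.1, Module.finBasis ℝ _⟩

theorem orientation_fst (o : CellOrientation n) (X : A.ACov) :
    (A.orientation o X).1 = flat A.a Finset.univ ⊤ X.1 := by
  rw [orientation]
  split_ifs with h
  · exact A.coneSpan_body h
  · rfl

theorem isExposed_body {X Y : A.ACov} (hX : X ∈ A.inner) (hY : Y ∈ A.inner)
    (h : Conf X.1 Y.1) : IsExposed ℝ (A.body Y.1) (A.body X.1) := by
  rcases A.inner_cases hX with rfl | ⟨x, hx, rfl⟩
  · rw [A.body_cov_zero]
    exact fun hne => absurd hne Set.not_nonempty_empty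
  · rcases A.inner_cases hY with rfl | ⟨y, hy, rfl⟩
    · exfalso
      have := A.body_mono h (A.mem_body_self x)
      rw [A.body_cov_zero] at this
      exact this
    · exact ((A.mem_cells_and_subset_iff (A.mem_cells_iff.2 ⟨y, hy, rfl⟩)).1
        ⟨A.mem_cells_iff.2 ⟨x, hx, rfl⟩, A.body_mono h⟩).2

/-- The two definitions use different inward vectors, but both lie on the positive side of a
functional supporting F along G. -/
theorem covSign_eq (X : CellComplex n) {G F : A.ACov} (hG : G ∈ A.inner) (hF : F ∈ A.inner) :
    (covSign (A.orientation X.orient) G F : ℤ) = X.sign (A.body G.1) (A.body F.1) := by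
  by_cases h : Conf G.1 F.1 ∧ rk A.a Finset.univ ⊤ F.1 = rk A.a Finset.univ ⊤ G.1 + 1
  · rw [covSign, if_pos h]
    have hne : G ≠ F := fun hh => by have := h.2; rw [hh] at this; omega
    obtain ⟨ψ, hψG, hψF⟩ := CellComplex.exists_supporting (A.isExposed_body hG hF h.1)
    have hFt : F.1 A.t = 1 := by
      rcases hF A.t (Or.inl rfl) with h1 | h1
      · exfalso
        have h2 := A.eq_zero_of_t_eq_zero hF h1
        refine hne (Subtype.ext (h.1.antisymm ?_))
        rw [h2]; exact A.conf_cov_zero G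
      · exact h1
    obtain ⟨y, hy, hrep, hpos⟩ := A.exists_of_t_eq_one hFt
    have hyF : y ∈ A.body F.1 \ A.body G.1 := by
      refine ⟨by rw [← hy]; exact A.mem_body_self y, fun hyG => hne (Subtype.ext ?_)⟩
      refine h.1.antisymm ?_
      rw [← hy]; exact hyG
    rw [X.sign_eq_incid (A.body_mono h.1) (by rw [A.rank_body hG, A.rank_body hF, h.2]) ψ hψG hψF
      (v := F.rep) ?_ ?_ ⟨y, hyF⟩, orientation, orientation, if_pos hG, if_pos hF]
    · rw [hrep]; exact Submodule.smul_mem _ _ (mem_coneSpan hyF.1)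
    · rw [hrep, map_smul]; exact mul_pos hpos (hψF y hyF)
  · rw [covSign, if_neg h]
    by_contra hne
    obtain ⟨h1, h2, -⟩ := CellComplex.sign_ne_zero (Ne.symm hne)
    rw [A.rank_body hG, A.rank_body hF] at h2
    exact h ⟨(A.conf_iff_body_subset hG).2 h1, h2⟩

/-! ### Labels -/

theorem isCompact_body {y : Fin n → ℝ} (hy : y ∈ P) : IsCompact (A.body (A.sg (1, y))) := by
  obtain ⟨N, hN⟩ := A.bdd
  have hsub : A.body (A.sg (1, y)) ⊆ Set.univ.pi fun _ : Fin n => Set.Icc 0 N :=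
    fun x hx i _ => hN x (A.body_subset hy hx) i
  refine (isCompact_univ_pi fun _ => isCompact_Icc).of_isClosed_subset ?_ hsub
  have h1 : A.body (A.sg (1, y)) = ⋂ e, {x | A.a e (1, x) = 0 ∨
      (A.sg (1, y) e = 1 ∧ 0 ≤ A.a e (1, x)) ∨ (A.sg (1, y) e = -1 ∧ A.a e (1, x) ≤ 0)} := by
    ext x
    simp only [Set.mem_iInter, Set.mem_ofPred_eq]
    refine forall_congr' fun e => ?_
    rw [A.sg_zero_iff, A.sg_apply (1, x)]
    generalize A.sg (1, y) e = s
    generalize A.a e (1, x) = r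
    rcases lt_trichotomy r 0 with h | h | h
    · rw [sign_neg h]
      simp only [h.ne, h.le, not_le.2 h, and_false, false_or, and_true]
      exact eq_comm
    · simp [h]
    · rw [sign_pos h]
      simp only [h.ne', h.le, not_le.2 h, and_false, false_or, or_false, and_true]
      exact eq_comm
  rw [h1]
  refine isClosed_iInter fun e => ?_
  have hc : Continuous fun x : Fin n → ℝ => A.a e (1, x) :=
    (LinearMap.continuous_of_finiteDimensional _).comp (by fun_prop)
  have hconst : ∀ (p : Prop) (S : Set (Fin n → ℝ)), IsClosed S → IsClosed {x | p ∧ x ∈ S} := by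
    intro p S hS
    by_cases hp : p
    · simpa [hp] using hS
    · simp [hp]
  exact (isClosed_eq hc continuous_const).union
    ((hconst _ _ (isClosed_le continuous_const hc)).union
      (hconst _ _ (isClosed_le hc continuous_const)))

/-- The maximum of the i-th coordinate on a closed cell is attained at an extreme point of the set
of maximisers, and such a point is a vertex of the subdivision. -/
theorem exists_vertex {y : Fin n → ℝ} (hy : y ∈ P) (i : Fin n) :
    ∃ v ∈ A.body (A.sg (1, y)), {v} ∈ subdivisionCells P H ∧ y i ≤ v i := by
  have hK := A.isCompact_body hy
  obtain ⟨x, hx, hmax⟩ := hK.exists_isMaxOn ⟨y, A.mem_body_self y⟩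
    (continuous_apply i).continuousOn
  have hK' : IsCompact (A.body (A.sg (1, y)) ∩ {z | z i = x i}) :=
    hK.inter_right (isClosed_eq (continuous_apply i) continuous_const)
  obtain ⟨v, hv⟩ := hK'.extremePoints_nonempty ⟨x, hx, rfl⟩
  have hvm := hv.1
  refine ⟨v, hvm.1, ?_, ?_⟩
  · refine A.mem_cells_iff.2 ⟨v, A.body_subset hy hvm.1, ?_⟩
    refine (Set.eq_singleton_iff_unique_mem.2 ⟨A.mem_body_self v, fun w hw => ?_⟩).symm
    obtain ⟨ε, hε, hz⟩ := A.exists_beyond hw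
    set z := v + ε • (v - w) with hzd
    have hwy : w ∈ A.body (A.sg (1, y)) := A.body_mono hvm.1 hw
    have hzy : z ∈ A.body (A.sg (1, y)) := by
      change Conf _ _
      rw [hz]; exact hvm.1
    have h1 : w i ≤ x i := hmax hwy
    have h2 : z i ≤ x i := hmax hzy
    have h3 : v i = x i := hvm.2
    have h4 : z i = v i + ε * (v i - w i) := by simp [hzd]
    have hwi : w i = x i := by
      by_contra hne
      have : w i < x i := lt_of_le_of_ne h1 hne
      nlinarith [mul_pos hε (sub_pos.2 this)]
    have hzi : z i = x i := by rw [h4, h3, hwi]; ring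
    -- If v were not alone in its cell, it would be strictly between w and the point z beyond v,
    -- which both maximise the coordinate.
    refine hv.2 ⟨hwy, hwi⟩ ⟨hzy, hzi⟩ ?_
    refine ⟨ε / (1 + ε), 1 / (1 + ε), by positivity, by positivity, by field_simp; ring, ?_⟩
    rw [hzd]
    ext j
    simp
    field_simp
    ring
  · have h3 : v i = x i := hvm.2
    rw [h3]; exact hmax (A.mem_body_self y)

end Presentation

namespace Presentation

variable {n : ℕ} {P : Set (Fin n → ℝ)} {H : Set (HyperplaneData n)} (A : Presentation P H)
  {X : CellComplex n}

/-- Labels are defined by vertices, and coordinates on a cell are maximal at vertices; as b is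
integral, the rounding up is harmless. -/
theorem label_le_iff (A : Presentation P H) (hX : X.cells = subdivisionCells P H)
    {C : Set (Fin n → ℝ)} (hC : C = ∅ ∨ C ∈ X.cells) (b : Fin n →₀ ℕ) :
    X.label C ≤ b ↔ ∀ y ∈ C, ∀ i, y i ≤ b i := by
  rcases hC with rfl | hC
  · refine ⟨fun _ y hy => hy.elim, fun _ i => ?_⟩
    simp [CellComplex.label]
  rw [hX] at hC
  obtain ⟨y₀, hy₀, rfl⟩ := A.mem_cells_iff.1 hC
  obtain ⟨N, hN⟩ := A.bdd
  constructor
  · intro h y hy i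
    obtain ⟨v, hv, hvc, hyv⟩ := A.exists_vertex (A.body_subset hy₀ hy) i
    have h1 : ⌈v i⌉₊ ≤ X.label (A.body (A.sg (1, y₀))) i := by
      refine le_csSup ⟨⌈N⌉₊, ?_⟩ ⟨v, A.body_mono hy hv, by rwa [hX], rfl⟩
      rintro _ ⟨w, hw, -, rfl⟩
      exact Nat.ceil_mono (hN w (A.body_subset hy₀ hw) i).2
    calc y i ≤ v i := hyv
      _ ≤ ⌈v i⌉₊ := Nat.le_ceil _
      _ ≤ b i := by exact_mod_cast h1.trans (h i)
  · intro h i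
    refine csSup_le' ?_
    rintro _ ⟨v, hv, -, rfl⟩
    exact Nat.ceil_le.2 (h v hv i)

theorem label_mono (A : Presentation P H) (hX : X.cells = subdivisionCells P H)
    {C D : Set (Fin n → ℝ)} (hC : C = ∅ ∨ C ∈ X.cells) (hD : D = ∅ ∨ D ∈ X.cells) (h : C ⊆ D) :
    X.label C ≤ X.label D := by
  rw [A.label_le_iff hX hC]
  exact fun y hy => (A.label_le_iff hX hD _).1 le_rfl y (h hy)

theorem face_iff (A : Presentation P H) (hX : X.cells = subdivisionCells P H)
    {C : Set (Fin n → ℝ)} : (C = ∅ ∨ C ∈ X.cells) ↔ ∃ x ∈ A.inner, A.body x.1 = C := by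
  constructor
  · rintro (rfl | hC)
    · exact ⟨A.cov 0, A.cov_zero_mem_inner, A.body_cov_zero⟩
    · rw [hX] at hC
      obtain ⟨y, hy, rfl⟩ := A.mem_cells_iff.1 hC
      exact ⟨A.cov (1, y), A.cov_mem_inner hy, rfl⟩
  · rintro ⟨x, hx, rfl⟩
    rcases A.inner_cases hx with rfl | ⟨y, hy, rfl⟩
    · exact Or.inl A.body_cov_zero
    · right
      rw [hX]
      exact A.mem_cells_iff.2 ⟨y, hy, rfl⟩

theorem inner_lower (G F : A.ACov) (h : Conf G.1 F.1) (hF : F ∈ A.inner) : G ∈ A.inner := by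
  intro e he
  rcases h e with h1 | h1
  · left; exact h1
  · rw [h1]; exact hF e he

/-- By `label_le_iff` the cells with label ≤ b are those in the half spaces y_i ≤ b_i. Their walls
belong to H or miss the polytope, so the region is described by signs and `exactOn_cellsIn` applies.
-/
theorem isAcyclic (K : Type*) [Field K] (A : Presentation P H)
    (hX : X.cells = subdivisionCells P H) (hH : coordHyperplanes n ⊆ H) : X.IsAcyclic K := by
  classical
  have hfin : X.cells.Finite := hX ▸ A.finite_cells
  have : Finite X.AllFace := ((Set.finite_singleton ∅).union hfin).to_subtype
  have : Fintype X.AllFace := Fintype.ofFinite _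
  choose cv hcv hbody using fun C : X.AllFace => (A.face_iff hX).1 C.2
  have hinj : Function.Injective cv := fun C D h => Subtype.ext (by
    rw [← hbody C, ← hbody D, h])
  have hrange : ∀ x, x ∉ Set.range cv → x ∉ A.inner := by
    intro x hx hxi
    let C : X.AllFace := ⟨A.body x.1, (A.face_iff hX).2 ⟨x, hxi, rfl⟩⟩
    exact hx ⟨C, A.body_injOn (hcv C) hxi (hbody C)⟩
  have hsign : ∀ G F : X.AllFace, (covSign (A.orientation X.orient) (cv G) (cv F) : ℤ) =
      X.sign G.1 F.1 := fun G F => by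
    rw [A.covSign_eq X (hcv G) (hcv F), hbody, hbody]
  have hD := isCellDiff_covDiff K (A.orientation_fst X.orient)
  have hlow : ∀ (G F : A.ACov), F ∈ A.inner → G ∉ A.inner →
      covSign (A.orientation X.orient) G F = 0 := by
    intro G F hF hG
    by_contra h
    exact hG (A.inner_lower G F ((covSign_ne_zero_iff (A.orientation_fst X.orient) G F).1 h).1 hF)
  refine ⟨hfin, fun C D h => A.label_mono hX C.2 D.2 h, fun G F => ?_, fun b hb z hz hz0 => ?_⟩
  · rw [finsum_eq_sum_of_fintype, ← sum_covSign_mul (K := K) (A.orientation_fst X.orient) (cv G)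
      (cv F)]
    refine Fintype.sum_of_injective cv hinj _ _ (fun x hx => ?_) (fun C => ?_)
    · rw [hlow x (cv F) (hcv F) (hrange x hx)]; simp
    · rw [hsign, hsign]
  -- Nonnegative on `t` and the facets, nonpositive on the walls y_i = b_i, and 0 where both are
  -- demanded.
  · let δ : A.ι → Set SignType := fun e => {s | s = 0 ∨ ((e = A.t ∨ e ∈ A.facets → s = 1) ∧
      ∀ i, (∀ v, A.a e v = v.2 i - b i * v.1) → s = -1)}
    have hδ0 : ∀ e, 0 ∈ δ e := fun e => Or.inl rfl
    have hδt : δ A.t = {0, 1} := by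
      ext s
      constructor
      · rintro (h | h)
        · exact Or.inl h
        · exact Or.inr (h.1 (Or.inl rfl))
      · rintro (h | h)
        · exact Or.inl h
        · refine Or.inr ⟨fun _ => h, fun i hi => ?_⟩
          -- The height functional is none of the walls: it vanishes at the i-th unit vector at
          -- height zero. So the sign of `t` is not forced to be 0.
          have := hi (0, Pi.single i 1)
          rw [A.t_apply] at this
          simp at this
    have hcells : ∀ x : A.ACov, x ∈ cellsIn A.a Finset.univ ⊤ δ ↔
        x ∈ A.inner ∧ ∀ y ∈ A.body x.1, ∀ i, y i ≤ b i := by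
      intro x
      constructor
      · intro hx
        have hxi : x ∈ A.inner := by
          intro e he
          rcases hx e with h | h
          · exact Or.inl h
          · exact Or.inr (h.1 he)
        refine ⟨hxi, fun y hy i => ?_⟩
        have hyP : y ∈ P := by
          refine A.mem_of_sg fun e he => ?_
          rcases hy e with h | h
          · exact Or.inl h
          · rw [h]; exact hxi e (Or.inr he)
        rcases A.hyp _ (hH ⟨i, b i, rfl⟩) with ⟨e, he⟩ | hlt
        · have h1 : A.a e (1, y) ≤ 0 := by
            rcases hy e with h1 | h1
            · exact (A.sg_zero_iff.1 h1).le
            · rcases hx e with h2 | h2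
              · rw [h2] at h1; exact (A.sg_zero_iff.1 h1).le
              · rw [h2.2 i he, A.sg_apply, sign_eq_neg_one_iff] at h1
                exact h1.le
          rw [he] at h1
          simpa using h1
        · exact (hlt y hyP).le
      · rintro ⟨hxi, hx⟩ e
        by_cases h0 : x.1 e = 0
        · exact Or.inl h0
        · refine Or.inr ⟨fun he => (hxi e he).resolve_left h0, fun i hi => ?_⟩
          rcases A.inner_cases hxi with rfl | ⟨y, hy, rfl⟩
          · exact absurd (A.sg_zero_iff.2 (map_zero _)) h0
          · have h1 := hx y (A.mem_body_self y) i
            change A.sg (1, y) e = -1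
            replace h0 : A.sg (1, y) e ≠ 0 := h0
            rw [Ne, A.sg_zero_iff] at h0
            rw [A.sg_apply, sign_eq_neg_one_iff]
            refine lt_of_le_of_ne ?_ h0
            rw [hi]; simpa using h1
    have hcv_cells : ∀ C : X.AllFace, cv C ∈ cellsIn A.a Finset.univ ⊤ δ ↔ X.label C.1 ≤ b := by
      intro C
      rw [hcells, A.label_le_iff hX C.2, hbody]
      simp [hcv C]
    have hex := exactOn_cellsIn (Finset.mem_univ A.t) hD hδ0 hδt (by
      obtain ⟨C, hC, hCb⟩ := hb
      have hC' := hC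
      rw [hX] at hC'
      obtain ⟨y, hy, rfl⟩ := A.mem_cells_iff.1 hC'
      refine ⟨A.cov (1, y), (hcells _).2 ⟨A.cov_mem_inner hy,
        (A.label_le_iff hX (Or.inr hC) b).1 hCb⟩, ?_⟩
      change A.sg (1, y) A.t = 1
      rw [A.sg_apply, A.t_apply, sign_one])
    let z' : A.ACov → K := Function.extend cv z 0
    have hz'1 : ∀ C, z' (cv C) = z C := fun C => hinj.extend_apply z 0 C
    have hz'0 : ∀ x, x ∉ Set.range cv → z' x = 0 := fun x hx =>
      Function.extend_apply' z (0 : A.ACov → K) x hx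
    have hsum : ∀ (u : A.ACov → K), (∀ x, x ∉ Set.range cv → u x = 0) → ∀ G : X.AllFace,
        covDiff K (A.orientation X.orient) u (cv G) =
          ∑ᶠ F : X.AllFace, ((X.sign G.1 F.1 : ℤ) : K) * u (cv F) := by
      intro u hu G
      rw [covDiff_apply, finsum_eq_sum_of_fintype]
      refine (Fintype.sum_of_injective cv hinj _ _ (fun x hx => ?_) (fun C => ?_)).symm
      · rw [hu x hx, mul_zero]
      · rw [hsign]
    obtain ⟨y, hy, hyz⟩ := hex z' (fun x hx => by
        by_cases hxr : x ∈ Set.range cv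
        · obtain ⟨C, rfl⟩ := hxr
          rw [hz'1]
          by_contra hne
          exact hx ((hcv_cells C).2 (hz C hne))
        · exact hz'0 x hxr) (by
      funext x
      by_cases hxr : x ∈ Set.range cv
      · obtain ⟨C, rfl⟩ := hxr
        rw [hsum z' hz'0]
        simp_rw [hz'1]
        exact hz0 C
      · rw [covDiff_apply]
        refine Finset.sum_eq_zero fun F _ => ?_
        by_cases hF : F ∈ Set.range cv
        · obtain ⟨C, rfl⟩ := hF
          rw [hlow x (cv C) (hcv C) (hrange x hxr)]; simp
        · rw [hz'0 F hF, mul_zero])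
    have hy0 : ∀ x, x ∉ Set.range cv → y x = 0 := fun x hx =>
      hy x fun h => hrange x hx ((hcells x).1 h).1
    refine ⟨fun C => y (cv C), fun C hC => ?_, fun G => ?_⟩
    · by_contra h
      exact hC (hy _ (fun h' => h ((hcv_cells C).1 h')))
    · rw [← hsum y hy0, hyz, hz'1]

end Presentation

/-! ### From vector spaces to modules over the polynomial ring -/

theorem rank_empty {n : ℕ} : rank (∅ : Set (Fin n → ℝ)) = 0 := by
  rw [rank, coneSpan, Set.image_empty, Submodule.span_empty, finrank_bot]

theorem rank_pos {n : ℕ} {C : Set (Fin n → ℝ)} (h : C.Nonempty) : 0 < rank C := by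
  obtain ⟨y, hy⟩ := h
  have h1 : coneSpan C ≠ ⊥ := fun h => by
    have h2 := mem_coneSpan hy
    rw [h, Submodule.mem_bot] at h2
    exact one_ne_zero (congrArg Prod.fst h2)
  have := (Submodule.nontrivial_iff_ne_bot).2 h1
  exact Module.finrank_pos

namespace CellComplex

variable {n : ℕ} {X : CellComplex n} {K : Type*} [Field K]

/-- The face of any rank that underlies a face of rank `p`. -/
def Face.all {p : ℕ} (C : X.Face p) : X.AllFace := ⟨C.1, C.2.1⟩

theorem Face.all_injective (p : ℕ) : Function.Injective (Face.all : X.Face p → X.AllFace) :=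
  fun _ _ h => Subtype.ext (congrArg (fun x : X.AllFace => x.1) h)

instance [Finite X.AllFace] (p : ℕ) : Finite (X.Face p) :=
  Finite.of_injective Face.all (Face.all_injective p)

/-- The empty face. -/
def emptyFace (X : CellComplex n) : X.AllFace := ⟨∅, Or.inl rfl⟩

/-- The empty face, in rank zero. -/
def emptyFace₀ (X : CellComplex n) : X.Face 0 := ⟨∅, Or.inl rfl, rank_empty⟩

theorem label_empty : X.label ∅ = 0 := by
  ext i
  simp [label]

theorem Face.eq_emptyFace₀ (C : X.Face 0) (hne : ∀ C ∈ X.cells, C.Nonempty) :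
    C = X.emptyFace₀ := by
  refine Subtype.ext ?_
  rcases C.2.1 with h | h
  · exact h
  · exact absurd C.2.2 (rank_pos (hne _ h)).ne'

/-- The differential of the reduced chain complex over the field. -/
def kdiff (K : Type*) [Field K] (X : CellComplex n) (y : X.AllFace → K) : X.AllFace → K :=
  fun G => ∑ᶠ F : X.AllFace, ((X.sign G.1 F.1 : ℤ) : K) * y F

theorem bdry_apply [Finite X.AllFace] (p : ℕ) (z : X.Chain K (p + 1)) (G : X.Face p) :
    X.bdry K p z G = ∑ᶠ F : X.Face (p + 1), z F *
      MvPolynomial.monomial (X.label F.1 - X.label G.1) ((X.sign G.1 F.1 : ℤ) : K) := by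
  classical
  have := Fintype.ofFinite (X.Face p)
  have := Fintype.ofFinite (X.Face (p + 1))
  rw [bdry, Finsupp.linearCombination_apply]
  refine (DFunLike.congr_fun (Finsupp.sum_fintype z (fun (F : X.Face (p + 1)) a => a •
    ∑ᶠ G : X.Face p, Finsupp.single G (MvPolynomial.monomial (X.label F.1 - X.label G.1)
      ((X.sign G.1 F.1 : ℤ) : K))) (fun _ => zero_smul _ _)) G).trans ?_
  rw [finsum_eq_sum_of_fintype, Finsupp.finsetSum_apply]
  refine Finset.sum_congr rfl fun F _ => ?_
  rw [Finsupp.smul_apply, smul_eq_mul, finsum_eq_sum_of_fintype, Finsupp.finsetSum_apply,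
    Finset.sum_eq_single G]
  · rw [Finsupp.single_eq_same]
  · intro D _ hD
    exact Finsupp.single_eq_of_ne hD.symm
  · simp

/-- The homogeneous chain of degree `b` with given coefficients. -/
def homog [Finite X.AllFace] (b : Fin n →₀ ℕ) (p : ℕ) (y : X.AllFace → K) : X.Chain K p :=
  Finsupp.equivFunOnFinite.symm fun C => MvPolynomial.monomial (b - X.label C.1) (y C.all)

theorem homog_apply [Finite X.AllFace] (b : Fin n →₀ ℕ) (p : ℕ) (y : X.AllFace → K)
    (C : X.Face p) : homog b p y C = MvPolynomial.monomial (b - X.label C.1) (y C.all) := rfl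

open Classical in
/-- The coefficients of the component of degree `b` of a chain. -/
def component (b : Fin n →₀ ℕ) (p : ℕ) (z : X.Chain K p) : X.AllFace → K := fun C =>
  if h : rank C.1 = p ∧ X.label C.1 ≤ b then
    MvPolynomial.coeff (b - X.label C.1) (z ⟨C.1, C.2, h.1⟩) else 0

theorem component_apply (b : Fin n →₀ ℕ) (p : ℕ) (z : X.Chain K p) (C : X.Face p)
    (h : X.label C.1 ≤ b) :
    component b p z C.all = MvPolynomial.coeff (b - X.label C.1) (z C) :=
  dif_pos (⟨C.2.2, h⟩ : rank C.1 = p ∧ _)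

theorem component_ne_zero {b : Fin n →₀ ℕ} {p : ℕ} {z : X.Chain K p} {C : X.AllFace}
    (h : component b p z C ≠ 0) : rank C.1 = p ∧ X.label C.1 ≤ b := by
  by_contra hc
  exact h (dif_neg hc)

theorem eq_zero_of_component {p : ℕ} {z : X.Chain K p} (h : ∀ b, component b p z = 0) : z = 0 := by
  ext C m
  have h1 := congrFun (h (m + X.label C.1)) C.all
  rw [component_apply _ _ _ _ le_add_self, add_tsub_cancel_right] at h1
  simpa using h1

/-- A sum over all faces that only involves faces of rank `p`. -/
theorem finsum_face [Finite X.AllFace] {M : Type*} [AddCommMonoid M] (p : ℕ) (f : X.AllFace → M)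
    (hf : ∀ C : X.AllFace, rank C.1 ≠ p → f C = 0) :
    ∑ᶠ C : X.Face p, f C.all = ∑ᶠ C : X.AllFace, f C := by
  classical
  have := Fintype.ofFinite (X.Face p)
  have := Fintype.ofFinite X.AllFace
  rw [finsum_eq_sum_of_fintype, finsum_eq_sum_of_fintype]
  refine Fintype.sum_of_injective (fun C : X.Face p => C.all)
    (Face.all_injective p) _ _ (fun C hC => hf C fun hr => hC ?_)
    (fun _ => rfl)
  exact ⟨⟨C.1, C.2, hr⟩, rfl⟩

theorem sign_eq_zero {X : CellComplex n} {G F : Set (Fin n → ℝ)} (h : rank F ≠ rank G + 1) :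
    X.sign G F = 0 := by
  by_contra hc
  exact h (sign_ne_zero hc).2.1

theorem IsAcyclic.finite_allFace (hX : X.IsAcyclic K) : Finite X.AllFace :=
  ((Set.finite_singleton ∅).union hX.finite).to_subtype

theorem IsAcyclic.label_le_of_sign (hX : X.IsAcyclic K) {G F : X.AllFace}
    (h : X.sign G.1 F.1 ≠ 0) : X.label G.1 ≤ X.label F.1 :=
  hX.label_mono G F (sign_ne_zero h).1

theorem IsAcyclic.kdiff_kdiff (hX : X.IsAcyclic K) (y : X.AllFace → K) :
    kdiff K X (kdiff K X y) = 0 := by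
  have := hX.finite_allFace
  have := Fintype.ofFinite X.AllFace
  funext G
  have hsq := fun F => hX.sq G F
  simp only [kdiff, finsum_eq_sum_of_fintype] at hsq ⊢
  simp_rw [Finset.mul_sum]
  rw [Finset.sum_comm]
  refine Finset.sum_eq_zero fun F _ => ?_
  simp_rw [← mul_assoc]
  rw [← Finset.sum_mul, hsq F, zero_mul]

/-- In a fixed multidegree the monomial coefficients are determined by the labels, and the
differential is the one over the field on the cells with label ≤ b. -/
theorem IsAcyclic.bdry_homog [Finite X.AllFace] (hX : X.IsAcyclic K) (b : Fin n →₀ ℕ) (p : ℕ)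
    {y : X.AllFace → K} (hy : ∀ C, y C ≠ 0 → X.label C.1 ≤ b) :
    X.bdry K p (homog b (p + 1) y) = homog b p (kdiff K X y) := by
  classical
  have := Fintype.ofFinite X.AllFace
  ext1 G
  have hG : MvPolynomial.monomial (b - X.label G.1) (kdiff K X y G.all) = ∑ᶠ F : X.AllFace,
      MvPolynomial.monomial (b - X.label G.1) (((X.sign G.1 F.1 : ℤ) : K) * y F) := by
    rw [kdiff, finsum_eq_sum_of_fintype, finsum_eq_sum_of_fintype, map_sum]
    rfl
  rw [bdry_apply, homog_apply, hG]
  have h1 : ∀ F : X.Face (p + 1), homog b (p + 1) y F *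
      MvPolynomial.monomial (X.label F.1 - X.label G.1) ((X.sign G.1 F.1 : ℤ) : K) =
      MvPolynomial.monomial (b - X.label G.1) (((X.sign G.1 F.all.1 : ℤ) : K) * y F.all) := by
    intro F
    rw [homog_apply, MvPolynomial.monomial_mul, mul_comm (y F.all)]
    by_cases hs : X.sign G.1 F.1 = 0
    · change MvPolynomial.monomial _ (((X.sign G.1 F.1 : ℤ) : K) * _) =
        MvPolynomial.monomial _ (((X.sign G.1 F.1 : ℤ) : K) * _)
      simp [hs]
    · by_cases hy0 : y F.all = 0
      · simp [hy0]
      · have h2 : X.label F.1 ≤ b := hy _ hy0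
        have h3 : X.label G.1 ≤ X.label F.1 := hX.label_le_of_sign (G := G.all) (F := F.all) hs
        congr 1
        congr 1
        exact tsub_add_tsub_cancel h2 h3
  simp_rw [h1]
  refine finsum_face (p + 1) (fun F : X.AllFace => MvPolynomial.monomial (b - X.label G.1)
    (((X.sign G.1 F.1 : ℤ) : K) * y F)) fun F hF => ?_
  rw [sign_eq_zero (by rw [G.2.2]; exact hF)]
  simp

/-- The converse direction to `bdry_homog`: taking the component of degree b commutes with the
differentials. So identities and exactness over the polynomial ring can be checked degree by degree.
-/
theorem IsAcyclic.kdiff_component (hX : X.IsAcyclic K) (b : Fin n →₀ ℕ)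
    (p : ℕ) (z : X.Chain K (p + 1)) :
    kdiff K X (component b (p + 1) z) = component b p (X.bdry K p z) := by
  classical
  have := hX.finite_allFace
  have := Fintype.ofFinite (X.Face (p + 1))
  funext G
  by_cases hG : rank G.1 = p ∧ X.label G.1 ≤ b
  · obtain ⟨hr, hl⟩ := hG
    let G' : X.Face p := ⟨G.1, G.2, hr⟩
    have h1 : component b p (X.bdry K p z) G = _ := component_apply b p (X.bdry K p z) G' hl
    rw [h1, bdry_apply, finsum_eq_sum_of_fintype, MvPolynomial.coeff_sum, kdiff,
      ← finsum_face (p + 1) _ (fun F hF => by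
        rw [sign_eq_zero (by rw [hr]; exact hF)]; simp), finsum_eq_sum_of_fintype]
    refine Finset.sum_congr rfl fun F _ => ?_
    by_cases hs : X.sign G.1 F.1 = 0
    · have hs' : X.sign G.1 F.all.1 = 0 := hs
      have hs'' : X.sign G'.1 F.1 = 0 := hs
      rw [hs', hs'']; simp
    · have h3 : X.label G.1 ≤ X.label F.1 := hX.label_le_of_sign (G := G) (F := F.all) hs
      change _ = MvPolynomial.coeff (b - X.label G.1) (z F *
        MvPolynomial.monomial (X.label F.1 - X.label G.1) ((X.sign G.1 F.1 : ℤ) : K))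
      rw [MvPolynomial.coeff_mul_monomial']
      by_cases hF : X.label F.1 ≤ b
      · rw [if_pos (tsub_le_tsub_right hF _), component_apply _ _ _ _ hF, mul_comm]
        congr 2
        exact (tsub_tsub_tsub_cancel_right h3).symm
      · rw [if_neg, show component b (p + 1) z F.all = 0 by
          by_contra hne; exact hF (component_ne_zero hne).2, mul_zero]
        intro hle
        apply hF
        intro i
        have h4 := hle i
        have h5 := h3 i
        have h6 := hl i
        simp only [Finsupp.tsub_apply] at h4
        omega
  · have h1 : component b p (X.bdry K p z) G = 0 := dif_neg hG
    rw [h1]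
    refine finsum_eq_zero_of_forall_eq_zero fun F => ?_
    by_contra hne
    have hs : X.sign G.1 F.1 ≠ 0 := fun h => hne (by simp [h])
    obtain ⟨h2, h3⟩ := component_ne_zero (right_ne_zero_of_mul hne)
    have h4 := (sign_ne_zero hs).2.1
    exact hG ⟨by omega, (hX.label_le_of_sign hs).trans h3⟩

theorem IsAcyclic.bdry_bdry (hX : X.IsAcyclic K) (p : ℕ) (z : X.Chain K (p + 1 + 1)) :
    X.bdry K p (X.bdry K (p + 1) z) = 0 :=
  eq_zero_of_component fun b => by
    rw [← hX.kdiff_component, ← hX.kdiff_component, hX.kdiff_kdiff]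

theorem exists_eq_sum_homog [Finite X.AllFace] (p : ℕ) (z : X.Chain K p) :
    ∃ B : Finset (Fin n →₀ ℕ), z = ∑ b ∈ B, homog b p (component b p z) := by
  classical
  have := Fintype.ofFinite (X.Face p)
  refine ⟨Finset.univ.biUnion fun C : X.Face p => (z C).support.image (· + X.label C.1), ?_⟩
  ext C m
  rw [Finsupp.finsetSum_apply, MvPolynomial.coeff_sum]
  by_cases hm : MvPolynomial.coeff m (z C) = 0
  · rw [hm]
    refine (Finset.sum_eq_zero fun b hb => ?_).symm
    rw [homog_apply, MvPolynomial.coeff_monomial]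
    split_ifs with h
    · by_contra hne
      have h2 := (component_ne_zero hne).2
      change X.label C.1 ≤ b at h2
      rw [component_apply _ _ _ _ h2, h] at hne
      exact hne hm
    · rfl
  · rw [Finset.sum_eq_single (m + X.label C.1)]
    · rw [homog_apply, component_apply _ _ _ _ le_add_self, add_tsub_cancel_right,
        MvPolynomial.coeff_monomial, if_pos rfl]
    · intro b _ hne
      rw [homog_apply, MvPolynomial.coeff_monomial]
      split_ifs with h
      · by_contra hne'
        have h2 := (component_ne_zero hne').2
        change X.label C.1 ≤ b at h2
        exact hne (by rw [← h, tsub_add_cancel_of_le h2])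
      · rfl
    · intro hn
      exfalso
      refine hn (Finset.mem_biUnion.2 ⟨C, Finset.mem_univ _, Finset.mem_image.2 ⟨m, ?_, rfl⟩⟩)
      rwa [MvPolynomial.mem_support_iff]

theorem IsAcyclic.exists_bdry_eq (hX : X.IsAcyclic K) (p : ℕ)
    (z : X.Chain K (p + 1)) (hz : X.bdry K p z = 0) : ∃ w, X.bdry K (p + 1) w = z := by
  classical
  have := hX.finite_allFace
  have h1 : ∀ b, ∃ y : X.AllFace → K, (∀ C, y C ≠ 0 → X.label C.1 ≤ b) ∧
      kdiff K X y = component b (p + 1) z := by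
    intro b
    have hk : kdiff K X (component b (p + 1) z) = 0 := by
      rw [hX.kdiff_component, hz]
      funext C
      simp only [component, Pi.zero_apply]
      split_ifs
      · exact MvPolynomial.coeff_zero _
      · rfl
    by_cases hb : ∃ C ∈ X.cells, X.label C ≤ b
    · obtain ⟨y, hy, hyz⟩ := hX.exact b hb _ (fun C hC => (component_ne_zero hC).2)
        (fun G => congrFun hk G)
      exact ⟨y, hy, funext hyz⟩
    -- If no cell has label ≤ b, only the empty face has; it has rank 0, so the component of the
    -- cycle is zero.
    · refine ⟨0, fun C hC => absurd rfl hC, ?_⟩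
      have h2 : component b (p + 1) z = 0 := by
        funext C
        by_contra hC
        obtain ⟨h3, h4⟩ := component_ne_zero hC
        rcases C.2 with h5 | h5
        · rw [h5, rank_empty] at h3; omega
        · exact hb ⟨C.1, h5, h4⟩
      rw [h2]
      funext G
      simp [kdiff]
  choose y hy hyz using h1
  obtain ⟨B, hB⟩ := exists_eq_sum_homog (p + 1) z
  refine ⟨∑ b ∈ B, homog b (p + 1 + 1) (y b), ?_⟩
  rw [map_sum]
  conv_rhs => rw [hB]
  refine Finset.sum_congr rfl fun b _ => ?_
  rw [hX.bdry_homog b _ (hy b), hyz]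

/-- In degree 0 the image contains x^a for a in S because the empty face is a cycle that bounds
among the cells with label ≤ a; it is contained in the ideal because the labels of the cells are. -/
theorem IsAcyclic.supportsResolution (hX : X.IsAcyclic K) (hne : ∀ C ∈ X.cells, C.Nonempty)
    (S : Set (Fin n →₀ ℕ))
    (hS : ∀ a ∈ S, ∃ C ∈ X.cells, X.label C ≤ a)
    (hJ : ∀ C ∈ X.cells, MvPolynomial.monomial (X.label C) (1 : K) ∈
      Ideal.span ((fun a => MvPolynomial.monomial a (1 : K)) '' S)) :
    X.SupportsResolution K (Ideal.span ((fun a => MvPolynomial.monomial a (1 : K)) '' S)) := by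
  classical
  have := hX.finite_allFace
  have h0 : ∀ C : X.Face 0, C = X.emptyFace₀ := fun C => C.eq_emptyFace₀ hne
  have hsingle : ∀ z : X.Chain K 0, z = Finsupp.single X.emptyFace₀ (z X.emptyFace₀) := by
    intro z
    ext1 C
    rw [h0 C, Finsupp.single_eq_same]
  refine ⟨hX.finite, le_antisymm ?_ ?_, fun p => le_antisymm ?_ ?_⟩
  · rintro _ ⟨z, rfl⟩
    rw [hsingle (X.bdry K 0 z), ← mul_one (X.bdry K 0 z _), ← smul_eq_mul,
      ← Finsupp.smul_single]
    refine Submodule.smul_mem_smul ?_ trivial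
    have := Fintype.ofFinite (X.Face (0 + 1))
    rw [bdry_apply, finsum_eq_sum_of_fintype]
    refine Ideal.sum_mem _ fun F _ => Ideal.mul_mem_left _ _ ?_
    have hF : F.1 ∈ X.cells := F.2.1.resolve_left fun h => by
      have := F.2.2
      rw [h, rank_empty] at this
      omega
    have h1 : X.label X.emptyFace₀.1 = 0 := label_empty
    rw [h1, tsub_zero, ← mul_one ((X.sign X.emptyFace₀.1 F.1 : ℤ) : K),
      ← MvPolynomial.C_mul_monomial]
    exact Ideal.mul_mem_left _ _ (hJ _ hF)
  · rw [Submodule.smul_le]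
    intro r hr z _
    have h1 : Ideal.span ((fun a => MvPolynomial.monomial a (1 : K)) '' S) ≤
        Submodule.comap (Finsupp.lsingle X.emptyFace₀) (LinearMap.range (X.bdry K 0)) := by
      rw [Ideal.span_le]
      rintro _ ⟨a, ha, rfl⟩
      -- The generator of the empty face is a cycle, and by hypothesis some cell has label ≤ a.
      obtain ⟨y, hy, hyz⟩ := hX.exact a (hS a ha) (Pi.single X.emptyFace 1) (fun C hC => by
          have : C = X.emptyFace := by
            by_contra h
            exact hC (Pi.single_eq_of_ne h _)
          rw [this]
          exact (label_empty (X := X)).trans_le (zero_le)) (fun G => by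
        refine finsum_eq_zero_of_forall_eq_zero fun F => ?_
        by_cases hF : F = X.emptyFace
        · have h2 : X.sign G.1 X.emptyFace.1 = 0 :=
            sign_eq_zero (by rw [show X.emptyFace.1 = ∅ from rfl, rank_empty]; omega)
          rw [hF, h2]; simp
        · rw [Pi.single_eq_of_ne hF, mul_zero])
      refine ⟨homog a (0 + 1) y, ?_⟩
      have h3 : kdiff K X y = Pi.single X.emptyFace 1 := funext hyz
      have h4 := hX.bdry_homog a 0 hy
      rw [h3] at h4
      rw [h4, hsingle (homog a 0 _)]
      change Finsupp.single _ _ = Finsupp.single _ _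
      rw [homog_apply]
      have h5 : X.label X.emptyFace₀.1 = 0 := label_empty
      have h6 : X.emptyFace₀.all = X.emptyFace := rfl
      rw [h5, h6, tsub_zero, Pi.single_eq_same]
    have h2 : r • z = z X.emptyFace₀ •
        (Finsupp.lsingle X.emptyFace₀ : _ →ₗ[MvPolynomial (Fin n) K] X.Chain K 0) r := by
      rw [hsingle z]
      simp [mul_comm]
    rw [h2]
    exact Submodule.smul_mem _ _ (h1 hr)
  · rintro _ ⟨w, rfl⟩
    exact hX.bdry_bdry p w
  · intro z hz
    exact hX.exists_bdry_eq p z hz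

end CellComplex

/-! ### Alternating partial sums and the Newton polytopes of the powers -/

section AltSum

variable {n : ℕ}

theorem stepForm_zero (i : Fin n) : stepForm 0 i = LinearMap.proj i := by
  ext y
  simp [stepForm]

theorem stepForm_apply (s : ℕ) (i : Fin n) (y : Fin n → ℝ) :
    stepForm s i y = ∑ t ∈ Finset.range (i.val / s + 1),
      y ⟨i.val - s * t, lt_of_le_of_lt (Nat.sub_le _ _) i.isLt⟩ := by
  simp [stepForm]

theorem stepForm_of_le {s : ℕ} (hs : 0 < s) (i : Fin n) (h : s ≤ i.val) (y : Fin n → ℝ) :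
    stepForm s i y = y i + stepForm s ⟨i.val - s, lt_of_le_of_lt (Nat.sub_le _ _) i.isLt⟩ y := by
  have h1 : i.val / s = (i.val - s) / s + 1 := by
    rw [← Nat.add_div_right _ hs, Nat.sub_add_cancel h]
  rw [stepForm_apply, stepForm_apply, h1, Finset.sum_range_succ', add_comm]
  congr 1
  refine Finset.sum_congr rfl fun t _ => ?_
  congr 2
  rw [Nat.mul_add, Nat.mul_one, Nat.sub_sub, add_comm]

theorem stepForm_of_lt {s : ℕ} (i : Fin n) (h : i.val < s) (y : Fin n → ℝ) :
    stepForm s i y = y i := by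
  rw [stepForm_apply, Nat.div_eq_of_lt h]
  simp

/-- The sum `y_k + y_{k-2} + ⋯`, with coordinates numbered from `1`. -/
def altSum (k : ℕ) : (Fin n → ℝ) →ₗ[ℝ] ℝ :=
  if h : k - 1 < n ∧ 0 < k then stepForm 2 ⟨k - 1, h.1⟩ else 0

@[simp] theorem altSum_zero (y : Fin n → ℝ) : altSum 0 y = 0 := by simp [altSum]

theorem altSum_succ (i : Fin n) : altSum (i.val + 1) = stepForm 2 i :=
  dif_pos ⟨i.isLt, Nat.succ_pos _⟩

/-- Truncated subtraction is right at the start: for the first two coordinates the subtracted term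
is `altSum 0`, which is zero. -/
theorem apply_eq_altSum_sub (y : Fin n → ℝ) (i : Fin n) :
    y i = altSum (i.val + 1) y - altSum (i.val - 1) y := by
  rw [altSum_succ]
  by_cases h : 2 ≤ i.val
  · rw [stepForm_of_le two_pos i h, altSum, dif_pos ⟨by omega, by omega⟩]
    exact (add_sub_cancel_right _ _).symm
  · rw [stepForm_of_lt i (by omega), altSum, dif_neg (by omega)]
    simp

theorem altSum_eq_of {y : Fin n → ℝ} {g : ℕ → ℝ} (h0 : g 0 = 0)
    (h : ∀ i : Fin n, y i = g (i.val + 1) - g (i.val - 1)) {k : ℕ} (hk : k ≤ n) :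
    altSum k y = g k := by
  induction k using Nat.strong_induction_on with
  | _ k ih =>
    rcases k with _ | k
    · simp [h0]
    · have h1 := apply_eq_altSum_sub y ⟨k, hk⟩
      have h2 := h ⟨k, hk⟩
      have h3 := ih (k - 1) (by omega) (by omega)
      simp only at h1 h2
      linarith

theorem exists_altSum_eq {g : ℕ → ℝ} (h0 : g 0 = 0) :
    ∃ y : Fin n → ℝ, ∀ k ≤ n, altSum k y = g k :=
  ⟨fun i => g (i.val + 1) - g (i.val - 1), fun _ hk => altSum_eq_of h0 (fun _ => rfl) hk⟩

theorem eq_of_altSum_eq {y z : Fin n → ℝ} (h : ∀ k ≤ n, altSum k y = altSum k z) : y = z := by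
  funext i
  rw [apply_eq_altSum_sub y i, apply_eq_altSum_sub z i, h _ (by omega), h _ (by omega)]

theorem sum_eq_altSum (y : Fin n → ℝ) : ∑ i, y i = altSum n y + altSum (n - 1) y := by
  have h : ∀ k ≤ n, ∑ i : Fin n with i.val < k, y i = altSum k y + altSum (k - 1) y := by
    intro k hk
    induction k with
    | zero => simp
    | succ k ih =>
      have h1 : (Finset.univ.filter fun i : Fin n => i.val < k + 1) =
          insert (⟨k, hk⟩ : Fin n) (Finset.univ.filter fun i : Fin n => i.val < k) := by
        ext i
        simp [Fin.ext_iff]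
        omega
      rw [h1, Finset.sum_insert (by simp), ih (by omega), apply_eq_altSum_sub y ⟨k, hk⟩]
      simp only [Nat.add_sub_cancel]
      ring
  have := h n le_rfl
  simpa using this

/-- The polytope of the `d`-th power: the alternating sums increase weakly from `0` to `d`, and
the last two agree. -/
def pathPolytope (n d : ℕ) : Set (Fin n → ℝ) :=
  {y | (∀ k < n, altSum k y ≤ altSum (k + 1) y) ∧ altSum n y = d ∧ altSum (n - 1) y = d}

theorem altSum_mono {d : ℕ} {y : Fin n → ℝ} (hy : y ∈ pathPolytope n d) {j k : ℕ} (hjk : j ≤ k)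
    (hk : k ≤ n) : altSum j y ≤ altSum k y := by
  induction k, hjk using Nat.le_induction with
  | base => rfl
  | succ k _ ih => exact (ih (by omega)).trans (hy.1 k (by omega))

theorem altSum_nonneg {d : ℕ} {y : Fin n → ℝ} (hy : y ∈ pathPolytope n d) {k : ℕ} (hk : k ≤ n) :
    0 ≤ altSum k y := by
  simpa using altSum_mono hy (Nat.zero_le k) hk

theorem altSum_le {d : ℕ} {y : Fin n → ℝ} (hy : y ∈ pathPolytope n d) {k : ℕ} (hk : k ≤ n) :
    altSum k y ≤ d := by
  have := altSum_mono hy hk le_rfl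
  rwa [hy.2.1] at this

theorem nonneg_of_mem {d : ℕ} {y : Fin n → ℝ} (hy : y ∈ pathPolytope n d) (i : Fin n) :
    0 ≤ y i := by
  rw [apply_eq_altSum_sub y i]
  exact sub_nonneg.2 (altSum_mono hy (by omega) (by omega))

theorem le_of_mem {d : ℕ} {y : Fin n → ℝ} (hy : y ∈ pathPolytope n d) (i : Fin n) : y i ≤ d := by
  rw [apply_eq_altSum_sub y i]
  have h1 := altSum_nonneg hy (k := i.val - 1) (by omega)
  have h2 := altSum_le hy (k := i.val + 1) (by omega)
  linarith

theorem convex_pathPolytope (n d : ℕ) : Convex ℝ (pathPolytope n d) := by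
  intro x hx y hy a b ha hb hab
  refine ⟨fun k hk => ?_, ?_, ?_⟩
  · have h1 := mul_le_mul_of_nonneg_left (hx.1 k hk) ha
    have h2 := mul_le_mul_of_nonneg_left (hy.1 k hk) hb
    simp only [map_add, map_smul, smul_eq_mul]
    linarith
  · simp only [map_add, map_smul, smul_eq_mul, hx.2.1, hy.2.1, ← add_mul, hab, one_mul]
  · simp only [map_add, map_smul, smul_eq_mul, hx.2.2, hy.2.2, ← add_mul, hab, one_mul]

@[simp] theorem toPoint_add (a b : Fin n →₀ ℕ) : toPoint (a + b) = toPoint a + toPoint b := by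
  ext i
  simp [toPoint]

@[simp] theorem toPoint_smul (d : ℕ) (a : Fin n →₀ ℕ) : toPoint (d • a) = (d : ℝ) • toPoint a := by
  ext i
  simp [toPoint]

theorem toPoint_injective : Function.Injective (toPoint : (Fin n →₀ ℕ) → Fin n → ℝ) := by
  intro a b h
  ext i
  have := congrFun h i
  simpa [toPoint] using this

theorem exists_altSum_toPoint (a : Fin n →₀ ℕ) (k : ℕ) : ∃ z : ℕ, altSum k (toPoint a) = z := by
  by_cases h : k - 1 < n ∧ 0 < k
  · rw [altSum, dif_pos h, stepForm_apply]
    exact ⟨∑ t ∈ Finset.range ((k - 1) / 2 + 1), a ⟨k - 1 - 2 * t, by omega⟩, by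
      simp [toPoint]⟩
  · exact ⟨0, by simp [altSum, dif_neg h]⟩

/-- The exponent vector of an edge of the path. -/
def edgeVec (n k : ℕ) : Fin n →₀ ℕ :=
  Finsupp.equivFunOnFinite.symm fun i => if i.val = k ∨ i.val = k + 1 then 1 else 0

theorem edgeVec_apply (k : ℕ) (i : Fin n) :
    edgeVec n k i = if i.val = k ∨ i.val = k + 1 then 1 else 0 := rfl

/-- In the new coordinates an edge is a jump by one, so the increment from k to k + 1 measures the
weight of the k-th edge. -/
theorem altSum_edgeVec {k : ℕ} {j : ℕ} (hj : j ≤ n) :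
    altSum j (toPoint (edgeVec n k)) = if k < j then 1 else 0 := by
  refine altSum_eq_of (g := fun j => if k < j then (1 : ℝ) else 0) (by simp) (fun i => ?_) hj
  simp only [toPoint, edgeVec_apply]
  split_ifs <;> first | omega | norm_num

theorem add_edgeVec_mem {d k : ℕ} (hk : k + 1 < n) {y : Fin n → ℝ} (hy : y ∈ pathPolytope n d) :
    y + toPoint (edgeVec n k) ∈ pathPolytope n (d + 1) := by
  refine ⟨fun j hj => ?_, ?_, ?_⟩
  · have := hy.1 j hj
    rw [map_add, map_add, altSum_edgeVec (by omega), altSum_edgeVec (by omega)]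
    split_ifs <;> first | omega | linarith
  · rw [map_add, altSum_edgeVec (by omega), hy.2.1, if_pos (by omega)]; simp
  · rw [map_add, altSum_edgeVec (by omega), hy.2.2, if_pos (by omega)]; simp

theorem sub_edgeVec_mem {d k : ℕ} (hk : k + 1 < n) {y : Fin n → ℝ}
    (hy : y ∈ pathPolytope n (d + 1)) (h : altSum k y + 1 ≤ altSum (k + 1) y) :
    y - toPoint (edgeVec n k) ∈ pathPolytope n d := by
  refine ⟨fun j hj => ?_, ?_, ?_⟩
  · have := hy.1 j hj
    rw [map_sub, map_sub, altSum_edgeVec (by omega), altSum_edgeVec (by omega)]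
    by_cases hjk : j = k
    · subst hjk; simp; linarith
    · split_ifs <;> first | omega | linarith
  · rw [map_sub, altSum_edgeVec (by omega), hy.2.1, if_pos (by omega)]; simp
  · rw [map_sub, altSum_edgeVec (by omega), hy.2.2, if_pos (by omega)]; simp

/-- Rounding the alternating sums down. -/
theorem exists_lattice_le {d : ℕ} {y : Fin n → ℝ} (hy : y ∈ pathPolytope n d) {b : Fin n →₀ ℕ}
    (hb : ∀ i, y i ≤ b i) : ∃ a ≤ b, toPoint a ∈ pathPolytope n d := by
  have h1 : ∀ i : Fin n, ⌊altSum (i.val - 1) y⌋ ≤ ⌊altSum (i.val + 1) y⌋ := fun i =>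
    Int.floor_mono (altSum_mono hy (by omega) (by omega))
  let a : Fin n →₀ ℕ := Finsupp.equivFunOnFinite.symm
    fun i => (⌊altSum (i.val + 1) y⌋ - ⌊altSum (i.val - 1) y⌋).toNat
  have ha : ∀ i, ((a i : ℕ) : ℤ) = ⌊altSum (i.val + 1) y⌋ - ⌊altSum (i.val - 1) y⌋ := fun i =>
    Int.toNat_of_nonneg (sub_nonneg.2 (h1 i))
  have hS : ∀ k ≤ n, altSum k (toPoint a) = ⌊altSum k y⌋ := fun k hk =>
    altSum_eq_of (g := fun k => (⌊altSum k y⌋ : ℝ)) (by simp) (fun i => by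
      have := ha i
      simp only [toPoint]
      exact_mod_cast this) hk
  refine ⟨a, fun i => ?_, fun k hk => ?_, ?_, ?_⟩
  · have h2 := ha i
    -- Integrality of b i enters here: the bound on y i reads S_{i+1} ≤ S_{i-1} + b i, and the floor
    -- commutes with adding an integer.
    have h3 : ⌊altSum (i.val + 1) y⌋ ≤ ⌊altSum (i.val - 1) y⌋ + b i := by
      rw [← Int.floor_add_natCast]
      refine Int.floor_mono ?_
      have := hb i
      rw [apply_eq_altSum_sub y i] at this
      linarith
    omega
  · rw [hS k hk.le, hS (k + 1) hk]
    exact_mod_cast Int.floor_mono (hy.1 k hk)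
  · rw [hS n le_rfl, hy.2.1]; simp
  · rw [hS (n - 1) (Nat.sub_le _ _), hy.2.2]; simp

/-- The increments up to n - 1 add up to d, so they cannot all be at most c. -/
theorem exists_increment_pos {d : ℕ} {c : ℝ} (hc : 0 ≤ c) (hd : n * c < d) {y : Fin n → ℝ}
    (hy : y ∈ pathPolytope n d) : ∃ k, k + 1 < n ∧ altSum k y + c < altSum (k + 1) y := by
  by_contra hcon
  push Not at hcon
  have h1 : ∀ k, k ≤ n - 1 → altSum k y ≤ k * c := by
    intro k hk
    induction k with
    | zero => simp
    | succ k ih =>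
      have h2 := ih (by omega)
      have h3 := hcon k (by omega)
      push_cast
      linarith
  have h2 := h1 (n - 1) le_rfl
  rw [hy.2.2] at h2
  have h3 : ((n - 1 : ℕ) : ℝ) * c ≤ n * c :=
    mul_le_mul_of_nonneg_right (by exact_mod_cast Nat.sub_le _ _) hc
  linarith

/-- Some increment of a lattice point is positive, hence at least 1, and the corresponding edge can
be split off. -/
theorem lattice_add_one_iff {d : ℕ} (a : Fin n →₀ ℕ) : toPoint a ∈ pathPolytope n (d + 1) ↔
    ∃ a' k, k + 1 < n ∧ toPoint a' ∈ pathPolytope n d ∧ a = a' + edgeVec n k := by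
  constructor
  · intro ha
    obtain ⟨k, hk, hlt⟩ := exists_increment_pos le_rfl
      (by rw [mul_zero]; exact_mod_cast Nat.succ_pos d) ha
    rw [add_zero] at hlt
    have hle : altSum k (toPoint a) + 1 ≤ altSum (k + 1) (toPoint a) := by
      obtain ⟨z, hz⟩ := exists_altSum_toPoint a k
      obtain ⟨w, hw⟩ := exists_altSum_toPoint a (k + 1)
      rw [hz, hw] at hlt ⊢
      exact_mod_cast Nat.succ_le_of_lt (by exact_mod_cast hlt)
    have hmem := sub_edgeVec_mem hk ha hle
    have hsub : edgeVec n k ≤ a := by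
      intro i
      have h1 := nonneg_of_mem hmem i
      simp only [Pi.sub_apply, toPoint, sub_nonneg] at h1
      exact_mod_cast h1
    refine ⟨a - edgeVec n k, k, hk, ?_, (tsub_add_cancel_of_le hsub).symm⟩
    have h2 : toPoint (a - edgeVec n k) = toPoint a - toPoint (edgeVec n k) := by
      rw [eq_sub_iff_add_eq, ← toPoint_add, tsub_add_cancel_of_le hsub]
    rwa [h2]
  · rintro ⟨a', k, hk, ha', rfl⟩
    rw [toPoint_add]
    exact add_edgeVec_mem hk ha'

theorem lattice_zero_iff (a : Fin n →₀ ℕ) : toPoint a ∈ pathPolytope n 0 ↔ a = 0 := by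
  constructor
  · intro ha
    ext i
    have := le_of_mem ha i
    simp only [toPoint, Nat.cast_zero] at this
    simpa using this
  · rintro rfl
    have h : toPoint (0 : Fin n →₀ ℕ) = 0 := by ext i; simp [toPoint]
    rw [h]
    exact ⟨fun k _ => by simp, by simp, by simp⟩

theorem smul_edgeVec_mem (d : ℕ) {k : ℕ} (hk : k + 1 < n) :
    toPoint (d • edgeVec n k) ∈ pathPolytope n d := by
  induction d with
  | zero => rw [zero_smul, lattice_zero_iff]
  | succ d ih => exact (lattice_add_one_iff _).2 ⟨_, k, hk, ih, succ_nsmul _ _⟩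

/-- The increments are the barycentric coordinates of the dilated simplex spanned by the edges. -/
theorem eq_sum_edgeVec {d : ℕ} {y : Fin n → ℝ} (hy : y ∈ pathPolytope n d) :
    y = ∑ k ∈ Finset.range (n - 1), (altSum (k + 1) y - altSum k y) • toPoint (edgeVec n k) := by
  refine eq_of_altSum_eq fun j hj => ?_
  rw [map_sum]
  have h1 : ∀ k ∈ Finset.range (n - 1), altSum j ((altSum (k + 1) y - altSum k y) •
      toPoint (edgeVec n k)) = if k < j then altSum (k + 1) y - altSum k y else 0 := by
    intro k hk
    rw [Finset.mem_range] at hk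
    rw [map_smul, altSum_edgeVec hj, smul_eq_mul]
    split_ifs <;> simp
  rw [Finset.sum_congr rfl h1, ← Finset.sum_filter]
  by_cases hjn : j ≤ n - 1
  · have h2 : (Finset.range (n - 1)).filter (· < j) = Finset.range j := by
      ext k; simp; omega
    rw [h2, Finset.sum_range_sub (fun k => altSum k y)]
    simp
  · have h2 : (Finset.range (n - 1)).filter (· < j) = Finset.range (n - 1) := by
      ext k; simp; omega
    have h3 : j = n := by omega
    rw [h2, Finset.sum_range_sub (fun k => altSum k y), hy.2.2, h3, hy.2.1]
    simp

theorem convexHull_lattice {d : ℕ} (hd : 0 < d) :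
    convexHull ℝ (toPoint '' {a : Fin n →₀ ℕ | toPoint a ∈ pathPolytope n d}) =
      pathPolytope n d := by
  refine Set.Subset.antisymm (convexHull_min ?_ (convex_pathPolytope n d)) fun y hy => ?_
  · rintro _ ⟨a, ha, rfl⟩
    exact ha
  · have hd' : (d : ℝ) ≠ 0 := by exact_mod_cast hd.ne'
    have h1 : y = ∑ k ∈ Finset.range (n - 1), ((altSum (k + 1) y - altSum k y) / d) •
        toPoint (d • edgeVec n k) := by
      conv_lhs => rw [eq_sum_edgeVec hy]
      refine Finset.sum_congr rfl fun k _ => ?_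
      rw [toPoint_smul, smul_smul, div_mul_cancel₀ _ hd']
    rw [h1]
    refine (convex_convexHull ℝ _).sum_mem (fun k hk => ?_) ?_ fun k hk => ?_
    · rw [Finset.mem_range] at hk
      exact div_nonneg (sub_nonneg.2 (hy.1 k (by omega))) (Nat.cast_nonneg d)
    · rw [← Finset.sum_div, Finset.sum_range_sub (fun k => altSum k y), hy.2.2, altSum_zero,
        sub_zero, div_self hd']
    · rw [Finset.mem_range] at hk
      exact subset_convexHull ℝ _ ⟨_, smul_edgeVec_mem d (by omega), rfl⟩

end AltSum

/-! ### The powers of the edge ideal of a path -/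

section Ideal

variable (K : Type*) [Field K] (n : ℕ)

theorem pathIdeal_eq_span : pathIdeal K n = Ideal.span
    ((fun a => MvPolynomial.monomial a (1 : K)) '' {a | ∃ k, k + 1 < n ∧ a = edgeVec n k}) := by
  have key : ∀ i j : Fin n, i.val + 1 = j.val →
      (MvPolynomial.X i * MvPolynomial.X j : MvPolynomial (Fin n) K) =
        MvPolynomial.monomial (edgeVec n i.val) 1 := by
    intro i j hij
    rw [MvPolynomial.X, MvPolynomial.X, MvPolynomial.monomial_mul, mul_one]
    congr 2
    ext l
    simp only [Finsupp.add_apply, Finsupp.single_apply, edgeVec_apply, Fin.ext_iff]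
    split_ifs <;> omega
  rw [pathIdeal, edgeIdeal]
  congr 1
  ext f
  constructor
  · rintro ⟨i, j, hij, rfl⟩
    rw [SimpleGraph.pathGraph_adj] at hij
    rcases hij with h | h
    · exact ⟨_, ⟨i.val, by omega, rfl⟩, (key i j h).symm⟩
    · exact ⟨_, ⟨j.val, by omega, rfl⟩, by rw [mul_comm]; exact (key j i h).symm⟩
  · rintro ⟨_, ⟨k, hk, rfl⟩, rfl⟩
    exact ⟨⟨k, by omega⟩, ⟨k + 1, hk⟩, by rw [SimpleGraph.pathGraph_adj]; simp,
      (key ⟨k, by omega⟩ ⟨k + 1, hk⟩ rfl).symm⟩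

theorem pathIdeal_pow (d : ℕ) : pathIdeal K n ^ d = Ideal.span
    ((fun a => MvPolynomial.monomial a (1 : K)) '' {a | toPoint a ∈ pathPolytope n d}) := by
  induction d with
  | zero =>
    have h : {a : Fin n →₀ ℕ | toPoint a ∈ pathPolytope n 0} = {0} := by
      ext a; exact lattice_zero_iff a
    rw [h, pow_zero, Set.image_singleton, Ideal.one_eq_top, eq_comm, Ideal.eq_top_iff_one]
    exact Ideal.subset_span rfl
  | succ d ih =>
    rw [pow_succ, ih, pathIdeal_eq_span, Ideal.span_mul_span']
    congr 1
    ext f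
    rw [Set.mem_mul]
    constructor
    · rintro ⟨_, ⟨a, ha, rfl⟩, _, ⟨_, ⟨k, hk, rfl⟩, rfl⟩, rfl⟩
      exact ⟨a + edgeVec n k, (lattice_add_one_iff _).2 ⟨a, k, hk, ha, rfl⟩, by
        simp [MvPolynomial.monomial_mul]⟩
    · rintro ⟨a, ha, rfl⟩
      obtain ⟨a', k, hk, ha', rfl⟩ := (lattice_add_one_iff _).1 ha
      exact ⟨_, ⟨a', ha', rfl⟩, _, ⟨_, ⟨k, hk, rfl⟩, rfl⟩, by simp [MvPolynomial.monomial_mul]⟩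

theorem monomial_mem_pathIdeal_pow (d : ℕ) (b : Fin n →₀ ℕ) :
    MvPolynomial.monomial b (1 : K) ∈ pathIdeal K n ^ d ↔ ∃ a ≤ b, toPoint a ∈ pathPolytope n d := by
  classical
  rw [pathIdeal_pow, MvPolynomial.mem_ideal_span_monomial_image]
  simp only [MvPolynomial.support_monomial, one_ne_zero, if_false, Finset.mem_singleton,
    forall_eq]
  exact ⟨fun ⟨a, ha, hab⟩ => ⟨a, hab, ha⟩, fun ⟨a, hab, ha⟩ => ⟨a, ha, hab⟩⟩

/-- All lattice points of the polytope have coordinate sum 2d, so none divides another. -/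
theorem mem_minGens_iff (d : ℕ) (a : Fin n →₀ ℕ) :
    a ∈ minGens (pathIdeal K n ^ d) ↔ toPoint a ∈ pathPolytope n d := by
  have hanti : ∀ a b : Fin n →₀ ℕ, toPoint a ∈ pathPolytope n d → toPoint b ∈ pathPolytope n d →
      a ≤ b → a = b := by
    intro a b ha hb hab
    have h1 := sum_eq_altSum (toPoint a)
    have h2 := sum_eq_altSum (toPoint b)
    rw [ha.2.1, ha.2.2] at h1
    rw [hb.2.1, hb.2.2, ← h1] at h2
    have h3 : ∀ i ∈ Finset.univ, toPoint a i ≤ toPoint b i := fun i _ => by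
      simp only [toPoint]; exact_mod_cast hab i
    have h4 := (Finset.sum_eq_sum_iff_of_le h3).1 h2.symm
    exact toPoint_injective (funext fun i => h4 i (Finset.mem_univ i))
  constructor
  · intro (ha : Minimal (fun b => MvPolynomial.monomial b (1 : K) ∈ pathIdeal K n ^ d) a)
    obtain ⟨a', ha'a, ha'⟩ := (monomial_mem_pathIdeal_pow K n d a).1 ha.prop
    have h1 := ha.le_of_le ((monomial_mem_pathIdeal_pow K n d a').2 ⟨a', le_rfl, ha'⟩) ha'a
    rwa [le_antisymm h1 ha'a]
  · intro ha
    refine ⟨(monomial_mem_pathIdeal_pow K n d a).2 ⟨a, le_rfl, ha⟩, fun b hb hba => ?_⟩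
    obtain ⟨b', hb'b, hb'⟩ := (monomial_mem_pathIdeal_pow K n d b).1 hb
    rw [← hanti b' a hb' ha (hb'b.trans hba)]
    exact hb'b

theorem newtonPolytope_pathIdeal_pow {d : ℕ} (hd : 0 < d) :
    newtonPolytope (pathIdeal K n ^ d) = pathPolytope n d := by
  rw [newtonPolytope, ← convexHull_lattice hd]
  congr 2
  ext a
  exact mem_minGens_iff K n d a

theorem mem_minGens_pathIdeal_iff (a : Fin n →₀ ℕ) :
    a ∈ minGens (pathIdeal K n) ↔ ∃ k, k + 1 < n ∧ a = edgeVec n k := by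
  have h := mem_minGens_iff K n 1 a
  rw [pow_one] at h
  rw [h, ← zero_add 1, lattice_add_one_iff]
  simp only [lattice_zero_iff]
  exact ⟨fun ⟨a', k, hk, h0, h1⟩ => ⟨k, hk, by rw [h1, h0, zero_add]⟩,
    fun ⟨k, hk, h1⟩ => ⟨0, k, hk, rfl, by rw [h1, zero_add]⟩⟩

end Ideal

/-! ### The subdivisions of the polytopes of the path -/

/-- The hyperplanes of the step forms with step in `Q` (step `0` gives the coordinates). -/
def stepFamily (n : ℕ) (Q : Finset ℕ) : Set (HyperplaneData n) :=
  {h | ∃ s ∈ Q, ∃ (i : Fin n) (j : ℕ), h = (stepForm s i, (j : ℝ))}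

theorem coordHyperplanes_eq (n : ℕ) : coordHyperplanes n = stepHyperplanes n 0 := by
  simp only [coordHyperplanes, stepHyperplanes, stepForm_zero]

theorem stepFamily_singleton (n s : ℕ) : stepFamily n {s} = stepHyperplanes n s := by
  simp [stepFamily, stepHyperplanes]

theorem stepFamily_union (n : ℕ) (Q R : Finset ℕ) :
    stepFamily n (Q ∪ R) = stepFamily n Q ∪ stepFamily n R := by
  ext h
  simp only [stepFamily, Set.mem_union, Set.mem_ofPred_eq, Finset.mem_union, or_and_right,
    exists_or]

theorem hyperplanesY_eq (n : ℕ) : hyperplanesY n = stepFamily n {0} := by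
  rw [stepFamily_singleton, hyperplanesY, coordHyperplanes_eq]

theorem hyperplanesZ_eq (n : ℕ) : hyperplanesZ n = stepFamily n ({0} ∪ {2}) := by
  rw [stepFamily_union, hyperplanesZ, hyperplanesY_eq, stepFamily_singleton n 2]

theorem hyperplanesZbar_eq (n : ℕ) : hyperplanesZbar n = stepFamily n ({0} ∪ {2} ∪ {3}) := by
  rw [stepFamily_union, hyperplanesZbar, hyperplanesZ_eq, stepFamily_singleton n 3]

theorem coordHyperplanes_subset {n : ℕ} {Q : Finset ℕ} (hQ : 0 ∈ Q) :
    coordHyperplanes n ⊆ stepFamily n Q := by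
  rw [coordHyperplanes_eq]
  rintro h ⟨i, j, rfl⟩
  exact ⟨0, hQ, i, j, rfl⟩

variable {n d : ℕ} {Q : Finset ℕ}

theorem stepForm_nonneg {y : Fin n → ℝ} (hy : y ∈ pathPolytope n d) (s : ℕ) (i : Fin n) :
    0 ≤ stepForm s i y := by
  rw [stepForm_apply]
  exact Finset.sum_nonneg fun t _ => nonneg_of_mem hy _

theorem stepForm_le {y : Fin n → ℝ} (hy : y ∈ pathPolytope n d) (s : ℕ) (i : Fin n) :
    stepForm s i y ≤ (n * d : ℕ) := by
  rw [stepForm_apply]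
  refine (Finset.sum_le_card_nsmul _ _ (d : ℝ) fun t _ => le_of_mem hy _).trans ?_
  rw [Finset.card_range, nsmul_eq_mul, Nat.cast_mul]
  refine mul_le_mul_of_nonneg_right ?_ (Nat.cast_nonneg d)
  have := (Nat.div_le_self i.val s).trans_lt i.isLt
  exact_mod_cast this

/-- The functionals that present the subdivision of the polytope of the path. -/
def pathFunctional (n d : ℕ) (Q : Finset ℕ) :
    Option (Fin n ⊕ Fin 3 ⊕ {s // s ∈ Q} × Fin n × Fin (n * d + 1)) →
      (ℝ × (Fin n → ℝ)) →ₗ[ℝ] ℝ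
  | none => LinearMap.fst ℝ ℝ _
  | some (.inl k) => (altSum (k.val + 1) - altSum k.val) ∘ₗ LinearMap.snd ℝ ℝ _
  | some (.inr (.inl 0)) => altSum n ∘ₗ LinearMap.snd ℝ ℝ _ - (d : ℝ) • LinearMap.fst ℝ ℝ _
  | some (.inr (.inl 1)) => (d : ℝ) • LinearMap.fst ℝ ℝ _ - altSum n ∘ₗ LinearMap.snd ℝ ℝ _
  | some (.inr (.inl 2)) => altSum (n - 1) ∘ₗ LinearMap.snd ℝ ℝ _ -
      (d : ℝ) • LinearMap.fst ℝ ℝ _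
  | some (.inr (.inr (s, i, j))) => stepForm s.1 i ∘ₗ LinearMap.snd ℝ ℝ _ -
      ((j.val : ℕ) : ℝ) • LinearMap.fst ℝ ℝ _

/-- The presentation of the subdivision of the polytope of the path. -/
def pathPresentation (n d : ℕ) (Q : Finset ℕ) :
    Presentation (pathPolytope n d) (stepFamily n Q) where
  ι := Option (Fin n ⊕ Fin 3 ⊕ {s // s ∈ Q} × Fin n × Fin (n * d + 1))
  fintype := inferInstance
  decEq := inferInstance
  a := pathFunctional n d Q
  t := none
  t_apply _ := rfl
  facets := {e | (∃ k, e = some (.inl k)) ∨ ∃ j, e = some (.inr (.inl j))}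
  mem_iff y := by
    constructor
    · rintro ⟨h1, h2, h3⟩ e (⟨k, rfl⟩ | ⟨j, rfl⟩)
      · simpa [pathFunctional] using h1 k k.isLt
      · fin_cases j <;> simp [pathFunctional, h2, h3]
    · intro h
      have h0 := h _ (Or.inr ⟨0, rfl⟩)
      have h1 := h _ (Or.inr ⟨1, rfl⟩)
      have h2 := h _ (Or.inr ⟨2, rfl⟩)
      have hm : ∀ k < n, altSum k y ≤ altSum (k + 1) y := fun k hk => by
        simpa [pathFunctional] using h _ (Or.inl ⟨⟨k, hk⟩, rfl⟩)
      simp only [pathFunctional, LinearMap.sub_apply, LinearMap.comp_apply, LinearMap.smul_apply,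
        LinearMap.fst_apply, LinearMap.snd_apply, smul_eq_mul, mul_one, sub_nonneg] at h0 h1 h2
      have h3 : altSum n y = d := le_antisymm h1 h0
      refine ⟨hm, h3, le_antisymm ?_ h2⟩
      rcases Nat.eq_zero_or_pos n with hn | hn
      · subst hn; exact h1
      · have := hm (n - 1) (by omega)
        rw [Nat.sub_add_cancel hn] at this
        exact this.trans h1
  pointed := by
    rintro ⟨r, y⟩ hr h
    replace hr : r = 0 := hr
    subst hr
    have h1 := h _ (Or.inr ⟨1, rfl⟩)
    have hm : ∀ k < n, altSum k y ≤ altSum (k + 1) y := fun k hk => by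
      simpa [pathFunctional] using h _ (Or.inl ⟨⟨k, hk⟩, rfl⟩)
    simp only [pathFunctional, LinearMap.sub_apply, LinearMap.comp_apply, LinearMap.smul_apply,
      LinearMap.fst_apply, LinearMap.snd_apply, smul_eq_mul, mul_zero, sub_nonneg] at h1
    have hmono : ∀ j k, j ≤ k → k ≤ n → altSum j y ≤ altSum k y := by
      intro j k hjk hk
      induction k, hjk using Nat.le_induction with
      | base => rfl
      | succ k _ ih => exact (ih (by omega)).trans (hm k (by omega))
    have hy : y = 0 := eq_of_altSum_eq fun k hk => by
      rw [map_zero]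
      exact le_antisymm ((hmono k n hk le_rfl).trans h1)
        (by simpa using hmono 0 k (Nat.zero_le k) hk)
    rw [hy]
    rfl
  bdd := ⟨d, fun _ hy i => ⟨nonneg_of_mem hy i, le_of_mem hy i⟩⟩
  cover := by
    rintro (_ | k | j | ⟨s, i, j⟩)
    · exact Or.inl rfl
    · exact Or.inr (Or.inl (Or.inl ⟨k, rfl⟩))
    · exact Or.inr (Or.inl (Or.inr ⟨j, rfl⟩))
    · exact Or.inr (Or.inr ⟨_, ⟨s.1, s.2, i, j.val, rfl⟩, fun _ => rfl⟩)
  hyp := by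
    rintro _ ⟨s, hs, i, j, rfl⟩
    by_cases hj : j < n * d + 1
    · exact Or.inl ⟨some (.inr (.inr (⟨s, hs⟩, i, ⟨j, hj⟩))), fun _ => rfl⟩
    · refine Or.inr fun y hy => (stepForm_le hy s i).trans_lt ?_
      have : n * d < j := by omega
      simpa using (by exact_mod_cast this : ((n * d : ℕ) : ℝ) < j)

theorem Presentation.exists_move {P : Set (Fin n → ℝ)} {H : Set (HyperplaneData n)}
    (A : Presentation P H) {y u : Fin n → ℝ} (h : ∀ e, A.a e (1, y) = 0 → A.a e (0, u) = 0) :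
    ∃ ε : ℝ, 0 < ε ∧ A.sg (1, y + ε • u) = A.sg (1, y) := by
  obtain ⟨ε, hε, h1⟩ := exists_signVec_add A.a Finset.univ ((1 : ℝ), y) ((0 : ℝ), u)
  refine ⟨ε, hε, funext fun e => ?_⟩
  have h2 : ((1 : ℝ), y + ε • u) = ((1 : ℝ), y) + ε • ((0 : ℝ), u) := by
    ext <;> simp
  rw [sg_apply, sg_apply, h2, h1 e (Finset.mem_univ e)]
  split_ifs with h0
  · rw [h e h0, h0]
  · rfl

/-- The hyperplanes y_i = a_i through a lattice point isolate it. -/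
theorem lattice_mem_cells (hQ : 0 ∈ Q) {a : Fin n →₀ ℕ} (ha : toPoint a ∈ pathPolytope n d) :
    {toPoint a} ∈ subdivisionCells (pathPolytope n d) (stepFamily n Q) := by
  let A := pathPresentation n d Q
  refine A.mem_cells_iff.2 ⟨_, ha, (Set.eq_singleton_iff_unique_mem.2
    ⟨A.mem_body_self _, fun y hy => funext fun i => ?_⟩).symm⟩
  rcases A.hyp _ (coordHyperplanes_subset hQ ⟨i, a i, rfl⟩) with ⟨e, he⟩ | hlt
  · have h1 := A.apply_eq_zero_of_mem_body hy (e := e) (by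
      rw [A.sg_zero_iff, he]; simp [toPoint])
    rw [he] at h1
    simpa [sub_eq_zero, toPoint] using h1
  · exact absurd (hlt _ ha) (lt_irrefl _)

/-- An active coordinate hyperplane says that two S_k agree modulo 1, and an active alternating one
that some S_k is integral. Shifting a whole nonzero class modulo 1 respects both, so at a vertex
there is no such class. Forms with step 3 are not of either kind. -/
theorem vertex_iff (hQ : 0 ∈ Q) (hQ' : Q ⊆ {0, 2}) (v : Fin n → ℝ) :
    {v} ∈ subdivisionCells (pathPolytope n d) (stepFamily n Q) ↔
      ∃ a : Fin n →₀ ℕ, toPoint a ∈ pathPolytope n d ∧ v = toPoint a := by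
  constructor
  · intro hv
    let A := pathPresentation n d Q
    obtain ⟨y, hy, hvy⟩ := A.mem_cells_iff.1 hv
    have hyv : y = v := by
      have h := A.mem_body_self y
      rwa [← hvy] at h
    subst hyv
    have hint : ∀ k ≤ n, Int.fract (altSum k y) = 0 := by
      intro k hk
      by_contra hθ
      set θ := Int.fract (altSum k y) with hθd
      -- The direction that raises exactly the S_k with fractional part θ.
      obtain ⟨u, hu⟩ := exists_altSum_eq (n := n)
        (g := fun k => if Int.fract (altSum k y) = θ then (1 : ℝ) else 0)
        (by simp [Ne.symm hθ])
      have hz : ∀ e, A.a e (1, y) = 0 → A.a e (0, u) = 0 := by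
        rintro (_ | k' | j | ⟨s, i, j⟩) h
        · exact absurd h one_ne_zero
        · change altSum (k'.val + 1) y - altSum k'.val y = 0 at h
          change altSum (k'.val + 1) u - altSum k'.val u = 0
          rw [hu _ (by omega), hu _ (by omega), sub_eq_zero.1 h, sub_self]
        · have h1 : altSum n u = 0 := by
            rw [hu n le_rfl, hy.2.1, Int.fract_natCast, if_neg (Ne.symm hθ)]
          have h2 : altSum (n - 1) u = 0 := by
            rw [hu (n - 1) (Nat.sub_le _ _), hy.2.2, Int.fract_natCast, if_neg (Ne.symm hθ)]
          change pathFunctional n d Q _ _ = 0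
          fin_cases j <;> simp [pathFunctional, h1, h2]
        · change stepForm s.1 i y - (j.val : ℝ) * 1 = 0 at h
          change stepForm s.1 i u - (j.val : ℝ) * 0 = 0
          have hs := hQ' s.2
          simp only [Finset.mem_insert, Finset.mem_singleton] at hs
          rcases hs with hs | hs
          · rw [hs, stepForm_zero, LinearMap.proj_apply, apply_eq_altSum_sub y i] at h
            rw [hs, stepForm_zero, LinearMap.proj_apply, apply_eq_altSum_sub u i,
              hu _ (by omega), hu _ (by omega)]
            have h1 : altSum (i.val + 1) y = altSum (i.val - 1) y + (j.val : ℕ) := by linarith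
            rw [h1, Int.fract_add_natCast]
            ring
          · rw [hs, ← altSum_succ] at h ⊢
            have h1 : altSum (i.val + 1) y = (j.val : ℕ) := by linarith
            rw [hu _ (by omega), h1, Int.fract_natCast, if_neg (Ne.symm hθ)]
            ring
      obtain ⟨ε, hε, hsg⟩ := A.exists_move hz
      have h1 : y + ε • u ∈ ({y} : Set (Fin n → ℝ)) := by
        rw [hvy, ← hsg]; exact A.mem_body_self _
      have h2 : u = 0 := by
        simpa [hε.ne'] using h1
      have h3 := hu k hk
      rw [h2, map_zero] at h3
      simp at h3
      exact h3 rfl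
    have hint' : ∀ k ≤ n, altSum k y = ⌊altSum k y⌋ := fun k hk => by
      have := Int.floor_add_fract (altSum k y)
      rw [hint k hk, add_zero] at this
      exact this.symm
    have hnat : ∀ i, ∃ m : ℕ, y i = m := by
      intro i
      have h1 := nonneg_of_mem hy i
      rw [apply_eq_altSum_sub y i, hint' _ (by omega : i.val + 1 ≤ n),
        hint' _ (by omega : i.val - 1 ≤ n)] at h1 ⊢
      norm_cast at h1
      obtain ⟨m, hm⟩ := Int.eq_ofNat_of_zero_le h1
      exact ⟨m, by exact_mod_cast hm⟩
    choose m hm using hnat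
    have hya : y = toPoint (Finsupp.equivFunOnFinite.symm m) := funext hm
    exact ⟨_, hya ▸ hy, hya⟩
  · rintro ⟨a, ha, rfl⟩
    exact lattice_mem_cells hQ ha

theorem cells_newtonComplex (K : Type*) [Field K] (hd : 0 < d) (o : CellOrientation n) :
    (newtonComplex (pathIdeal K n ^ d) (stepFamily n Q) o).cells =
      subdivisionCells (pathPolytope n d) (stepFamily n Q) := by
  rw [newtonComplex, newtonPolytope_pathIdeal_pow K n hd]

variable {X : CellComplex n}

theorem exists_cell_label_le (hQ : 0 ∈ Q)
    (hX : X.cells = subdivisionCells (pathPolytope n d) (stepFamily n Q))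
    {y : Fin n → ℝ} (hy : y ∈ pathPolytope n d) {b : Fin n →₀ ℕ} (hb : ∀ i, y i ≤ b i) :
    ∃ a ≤ b, toPoint a ∈ pathPolytope n d ∧ {toPoint a} ∈ X.cells ∧ X.label {toPoint a} ≤ a := by
  obtain ⟨a, hab, ha⟩ := exists_lattice_le hy hb
  have hcell : {toPoint a} ∈ X.cells := hX ▸ lattice_mem_cells hQ ha
  refine ⟨a, hab, ha, hcell, ?_⟩
  rw [(pathPresentation n d Q).label_le_iff hX (Or.inr hcell)]
  rintro _ rfl i
  exact le_rfl

theorem nonempty_of_mem_cells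
    (hX : X.cells = subdivisionCells (pathPolytope n d) (stepFamily n Q))
    {C : Set (Fin n → ℝ)} (hC : C ∈ X.cells) : C.Nonempty := by
  rw [hX] at hC
  exact hC.1

theorem subset_of_mem_cells
    (hX : X.cells = subdivisionCells (pathPolytope n d) (stepFamily n Q))
    {C : Set (Fin n → ℝ)} (hC : C ∈ X.cells) : C ⊆ pathPolytope n d := by
  rw [hX] at hC
  obtain ⟨y, hy, rfl⟩ := (pathPresentation n d Q).mem_cells_iff.1 hC
  exact (pathPresentation n d Q).body_subset hy

/-- Rounding down supplies both inputs besides acyclicity: a generator below the label of any cell,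
and a vertex cell with label ≤ a for each generator a. -/
theorem supportsResolution_path (K : Type*) [Field K] (hQ : 0 ∈ Q)
    (hX : X.cells = subdivisionCells (pathPolytope n d) (stepFamily n Q)) :
    X.SupportsResolution K (pathIdeal K n ^ d) := by
  have hac := (pathPresentation n d Q).isAcyclic K hX (coordHyperplanes_subset hQ)
  rw [pathIdeal_pow]
  refine hac.supportsResolution (fun C hC => nonempty_of_mem_cells hX hC) _ (fun a ha => ?_)
    (fun C hC => ?_)
  · obtain ⟨a', ha', -, hcell, hl⟩ := exists_cell_label_le hQ hX ha (b := a) (fun i => le_rfl)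
    exact ⟨_, hcell, hl.trans ha'⟩
  · obtain ⟨y, hy⟩ := nonempty_of_mem_cells hX hC
    rw [← pathIdeal_pow, monomial_mem_pathIdeal_pow]
    exact exists_lattice_le (subset_of_mem_cells hX hC hy)
      (((pathPresentation n d Q).label_le_iff hX (Or.inr hC) _).1 le_rfl y hy)

/-! ### Translations of cells and their orientations -/

section OrientSign

variable {V : Type*} [AddCommGroup V] [Module ℝ V]

/-- Whether an injective linear map is compatible with the orientations given by two bases. -/
def orientSign (τ : V →ₗ[ℝ] V) {S T : Submodule ℝ V} (h : ∀ x ∈ S, τ x ∈ T) {r : ℕ}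
    (b : Module.Basis (Fin r) ℝ S) (c : Module.Basis (Fin r) ℝ T) : SignType :=
  SignType.sign (c.det fun j => τ.restrict h (b j))

theorem orientSign_ne_zero {τ : V →ₗ[ℝ] V} (hτ : Function.Injective τ) {S T : Submodule ℝ V}
    (h : ∀ x ∈ S, τ x ∈ T) {r : ℕ} (b : Module.Basis (Fin r) ℝ S)
    (c : Module.Basis (Fin r) ℝ T) : orientSign τ h b c ≠ 0 := by
  rw [orientSign, Ne, sign_eq_zero_iff]
  have hli : LinearIndependent ℝ fun j => τ.restrict h (b j) := by
    refine b.linearIndependent.map' (τ.restrict h) (LinearMap.ker_eq_bot.2 fun x y hxy => ?_)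
    exact Subtype.ext (hτ (congrArg Subtype.val hxy))
  have hsp : ⊤ ≤ Submodule.span ℝ (Set.range fun j => τ.restrict h (b j)) := by
    have : FiniteDimensional ℝ T := c.finiteDimensional_of_finite
    exact (hli.span_eq_top_of_card_eq_finrank' (by rw [Module.finrank_eq_card_basis c])).ge
  exact (c.isUnit_det (Module.Basis.mk hli hsp)).ne_zero ∘ fun h0 => by
    rw [Module.Basis.coe_mk]; exact h0

/-- The pullback of the determinant of T' along τ is a multiple of that of T; evaluated at v
followed by a basis of S it splits in two ways. -/
theorem sign_consDet_mul_orientSign {τ : V →ₗ[ℝ] V} {S T S' T' : Submodule ℝ V} (hST : S ≤ T)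
    (hST' : S' ≤ T') (hS : ∀ x ∈ S, τ x ∈ S') (hT : ∀ x ∈ T, τ x ∈ T') {r : ℕ}
    (b : Module.Basis (Fin r) ℝ S) (c : Module.Basis (Fin (r + 1)) ℝ T)
    (b' : Module.Basis (Fin r) ℝ S') (c' : Module.Basis (Fin (r + 1)) ℝ T') (v : T) :
    orientSign τ hT c c' * SignType.sign (consDet hST b c v) =
      SignType.sign (consDet hST' b' c' (τ.restrict hT v)) * orientSign τ hS b b' := by
  rw [orientSign, orientSign, ← sign_mul, ← sign_mul, ← det_cons_inclusion]
  congr 1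
  have h1 := congrArg (fun f => f (Fin.cons v fun j => Submodule.inclusion hST (b j)))
    ((c'.det.compLinearMap (τ.restrict hT)).eq_smul_basis_det c)
  refine Eq.trans h1.symm ?_
  change c'.det _ = _
  congr 1
  funext j
  refine Fin.cases rfl (fun j => rfl) j

end OrientSign

variable {n : ℕ}

/-- The translate of a set. -/
def translate (w : Fin n → ℝ) (C : Set (Fin n → ℝ)) : Set (Fin n → ℝ) := (fun y => y + w) '' C

/-- The translation by `w` in homogeneous coordinates. -/
def shear (w : Fin n → ℝ) : (ℝ × (Fin n → ℝ)) →ₗ[ℝ] ℝ × (Fin n → ℝ) where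
  toFun v := (v.1, v.2 + v.1 • w)
  map_add' u v := by ext <;> simp [add_mul]; ring
  map_smul' r v := by ext <;> simp [mul_assoc]

theorem shear_neg_shear (w : Fin n → ℝ) (v : ℝ × (Fin n → ℝ)) : shear (-w) (shear w v) = v := by
  ext <;> simp [shear]

theorem shear_injective (w : Fin n → ℝ) : Function.Injective (shear w) :=
  Function.LeftInverse.injective (shear_neg_shear w)

theorem translate_empty (w : Fin n → ℝ) : translate w ∅ = ∅ := Set.image_empty _

theorem translate_neg_translate (w : Fin n → ℝ) (C : Set (Fin n → ℝ)) :
    translate (-w) (translate w C) = C := by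
  rw [translate, translate, Set.image_image]
  simp only [add_neg_cancel_right, Set.image_id']

theorem translate_translate_neg (w : Fin n → ℝ) (C : Set (Fin n → ℝ)) :
    translate w (translate (-w) C) = C := by
  rw [translate, translate, Set.image_image]
  simp only [neg_add_cancel_right, Set.image_id']

theorem translate_injective (w : Fin n → ℝ) : Function.Injective (translate w) :=
  Function.LeftInverse.injective (translate_neg_translate w)

theorem translate_subset {w : Fin n → ℝ} {C D : Set (Fin n → ℝ)} :
    translate w C ⊆ translate w D ↔ C ⊆ D :=
  Set.image_subset_image_iff (add_left_injective w)

theorem coneSpan_translate (w : Fin n → ℝ) (C : Set (Fin n → ℝ)) :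
    coneSpan (translate w C) = (coneSpan C).map (shear w) := by
  rw [coneSpan, coneSpan, Submodule.map_span, translate, Set.image_image, Set.image_image]
  congr 2
  funext y
  simp [shear]

theorem shear_mem_coneSpan (w : Fin n → ℝ) (C : Set (Fin n → ℝ)) (v : ℝ × (Fin n → ℝ))
    (hv : v ∈ coneSpan C) : shear w v ∈ coneSpan (translate w C) := by
  rw [coneSpan_translate]
  exact Submodule.mem_map_of_mem hv

theorem rank_translate (w : Fin n → ℝ) (C : Set (Fin n → ℝ)) : rank (translate w C) = rank C := by
  rw [rank, rank, coneSpan_translate]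
  exact (Submodule.equivMapOfInjective (shear w) (shear_injective w) _).finrank_eq.symm

theorem isExposed_translate (w : Fin n → ℝ) {C G : Set (Fin n → ℝ)} (h : IsExposed ℝ C G) :
    IsExposed ℝ (translate w C) (translate w G) := by
  intro hG
  obtain ⟨l, hl⟩ := h (Set.image_nonempty.1 hG)
  refine ⟨l, ?_⟩
  ext y
  constructor
  · rintro ⟨x, hx, rfl⟩
    rw [hl] at hx
    refine ⟨⟨x, hx.1, rfl⟩, ?_⟩
    rintro _ ⟨z, hz, rfl⟩
    simpa using hx.2 z hz
  · rintro ⟨⟨x, hx, rfl⟩, hy⟩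
    refine ⟨x, ?_, rfl⟩
    rw [hl]
    exact ⟨hx, fun z hz => by simpa using hy _ ⟨z, hz, rfl⟩⟩

namespace CellComplex

variable {X Y : CellComplex n}

/-- The comparison of the orientation of a cell with that of its translate. -/
def translateSign (X Y : CellComplex n) (w : Fin n → ℝ) (C : Set (Fin n → ℝ)) : SignType :=
  orientSign (shear w) (shear_mem_coneSpan w C) (X.orient C)
    ((Y.orient (translate w C)).reindex (finCongr (rank_translate w C)))

theorem translateSign_ne_zero (w : Fin n → ℝ) (C : Set (Fin n → ℝ)) :
    translateSign X Y w C ≠ 0 :=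
  orientSign_ne_zero (shear_injective w) _ _ _

theorem translateSign_eq (w : Fin n → ℝ) (C : Set (Fin n → ℝ)) {r : ℕ}
    (h : rank C = r) (h' : rank (translate w C) = r) :
    translateSign X Y w C = orientSign (shear w) (shear_mem_coneSpan w C)
      ((X.orient C).reindex (finCongr h)) ((Y.orient (translate w C)).reindex (finCongr h')) := by
  subst h
  rw [finCongr_refl, Module.Basis.reindex_refl]
  rfl

/-- Translation is linear in homogeneous coordinates and carries inward vectors to inward vectors.
So the map sending cells to their translates, with these signs, commutes with the differentials. -/
theorem translateSign_mul_sign (w : Fin n → ℝ) {G F : Set (Fin n → ℝ)}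
    (h : G ⊆ F → IsExposed ℝ F G) :
    (translateSign X Y w F : ℤ) * X.sign G F =
      Y.sign (translate w G) (translate w F) * (translateSign X Y w G : ℤ) := by
  by_cases hr : rank F = rank G + 1
  swap
  · rw [sign_eq_zero hr, sign_eq_zero (by rwa [rank_translate, rank_translate]), mul_zero, zero_mul]
  by_cases hGF : G ⊆ F
  swap
  · have h1 : X.sign G F = 0 := by
      by_contra hne; exact hGF (sign_ne_zero hne).1
    have h2 : Y.sign (translate w G) (translate w F) = 0 := by
      by_contra hne; exact hGF (translate_subset.1 (sign_ne_zero hne).1)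
    rw [h1, h2, mul_zero, zero_mul]
  have hne : (F \ G).Nonempty := by
    by_contra hcon
    rw [Set.not_nonempty_iff_eq_empty, Set.sdiff_eq_empty] at hcon
    rw [hcon.antisymm hGF] at hr
    omega
  obtain ⟨ψ, hψG, hψF⟩ := exists_supporting (h hGF)
  obtain ⟨y, hy⟩ := hne
  have hvF := mem_coneSpan hy.1
  rw [X.sign_eq_incid hGF hr ψ hψG hψF hvF (hψF y hy) ⟨y, hy⟩]
  have hψ : ∀ v, (ψ ∘ₗ shear (-w)) (shear w v) = ψ v := fun v => by
    rw [LinearMap.comp_apply, shear_neg_shear]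
  have hsh : ∀ x : Fin n → ℝ, ((1 : ℝ), x + w) = shear w (1, x) := fun x => by simp [shear]
  rw [Y.sign_eq_incid (translate_subset.2 hGF) (by rwa [rank_translate, rank_translate])
    (ψ ∘ₗ shear (-w)) (v := shear w (1, y)) ?_ ?_ (shear_mem_coneSpan w F _ hvF) ?_ ?_]
  · have hrF : Module.finrank ℝ (coneSpan (translate w F)) = rank G + 1 := by
      rw [← hr]; exact rank_translate w F
    have hrG : Module.finrank ℝ (coneSpan (translate w G)) = rank G := rank_translate w G
    rw [incid_eq ⟨coneSpan G, X.orient G⟩ ⟨coneSpan F, X.orient F⟩ rfl hr (coneSpan_mono hGF) hvF,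
      incid_eq ⟨_, Y.orient (translate w G)⟩ ⟨_, Y.orient (translate w F)⟩ hrG hrF (coneSpan_mono (translate_subset.2 hGF))
        (shear_mem_coneSpan w F _ hvF), translateSign_eq w F hr hrF,
      translateSign_eq w G rfl hrG]
    have := sign_consDet_mul_orientSign (coneSpan_mono hGF)
      (coneSpan_mono (translate_subset.2 hGF)) (shear_mem_coneSpan w G) (shear_mem_coneSpan w F)
      ((X.orient G).reindex (finCongr rfl)) ((X.orient F).reindex (finCongr hr))
      ((Y.orient (translate w G)).reindex (finCongr hrG))
      ((Y.orient (translate w F)).reindex (finCongr hrF)) ⟨_, hvF⟩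
    have h2 := congrArg (fun s : SignType => (s : ℤ)) this
    simp only [SignType.coe_mul] at h2
    exact h2
  · rintro _ ⟨x, hx, rfl⟩
    rw [hsh, hψ]; exact hψG x hx
  · rintro _ ⟨⟨x, hx, rfl⟩, hx'⟩
    rw [hsh, hψ]
    exact hψF x ⟨hx, fun hG => hx' ⟨x, hG, rfl⟩⟩
  · rw [hψ]; exact hψF y hy
  · exact ⟨y + w, ⟨y, hy.1, rfl⟩, fun ⟨x, hx, hxy⟩ => hy.2 (by
      rwa [← add_right_cancel hxy])⟩

end CellComplex

/-! ### Existence of multiplications -/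

namespace CellComplex

variable {n : ℕ} {X Y : CellComplex n} {K : Type*} [Field K]

/-- The compatibility of two complexes with the translation by `m` that is needed to construct a
multiplication by `x ^ m`. -/
structure Translates (X Y : CellComplex n) (m : Fin n →₀ ℕ) : Prop where
  nonempty_left : ∀ C ∈ X.cells, C.Nonempty
  nonempty_right : ∀ C ∈ Y.cells, C.Nonempty
  exists_le : ∀ C ∈ X.cells, ∃ D ∈ Y.cells, Y.label D ≤ m + X.label C
  lower : ∀ (F : X.AllFace) (D : Y.AllFace), D.1 = translate (toPoint m) F.1 →
    ∀ G : X.AllFace, G.1 ⊆ F.1 → ∃ E : Y.AllFace, E.1 = translate (toPoint m) G.1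
  exposed : ∀ F G : X.AllFace, G.1 ⊆ F.1 → IsExposed ℝ F.1 G.1
  lift : ∀ (F : X.AllFace) (D : Y.AllFace), D.1 = translate (toPoint m) F.1 →
    ∀ E : Y.AllFace, E.1 ⊆ D.1 → ∃ G : X.AllFace, E.1 = translate (toPoint m) G.1
  label_le : ∀ (F : X.AllFace) (D : Y.AllFace), D.1 = translate (toPoint m) F.1 →
    Y.label D.1 ≤ m + X.label F.1
  label_eq : ∀ F ∈ X.cells, ∀ D ∈ Y.cells, D = translate (toPoint m) F →
    Y.label D = m + X.label F

theorem kdiff_single [Finite X.AllFace] [DecidableEq X.AllFace] (D E : X.AllFace) (c : K) :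
    kdiff K X (Pi.single D c) E = ((X.sign E.1 D.1 : ℤ) : K) * c := by
  rw [kdiff, finsum_eq_single _ D fun F hF => by rw [Pi.single_eq_of_ne hF, mul_zero],
    Pi.single_eq_same]

theorem signType_mul_self {s : SignType} (hs : s ≠ 0) : (s : ℤ) * s = 1 := by
  revert hs; revert s; decide

open Classical in
/-- The conditions on the matrix of a multiplication at a given face. -/
structure IsMatrixAt (m : Fin n →₀ ℕ) (φ : X.AllFace → Y.AllFace → K) (C : X.AllFace) : Prop where
  label_le : ∀ D, φ C D ≠ 0 → Y.label D.1 ≤ m + X.label C.1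
  comm : kdiff K Y (φ C) = fun D => ∑ᶠ G : X.AllFace, ((X.sign G.1 C.1 : ℤ) : K) * φ G D
  translate : ∀ D : Y.AllFace, D.1 = translate (toPoint m) C.1 →
    φ C = Pi.single D ((translateSign X Y (toPoint m) C.1 : ℤ) : K)

/-- The comparison theorem by induction on the rank, performed over the field with labels bounded by
m plus the label of the source cell. -/
theorem exists_matrix (hX : X.IsAcyclic K) (hY : Y.IsAcyclic K) {m : Fin n →₀ ℕ}
    (h : Translates X Y m) (p : ℕ) :
    ∃ φ : X.AllFace → Y.AllFace → K, ∀ C : X.AllFace, rank C.1 < p → IsMatrixAt m φ C := by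
  classical
  have := hX.finite_allFace
  have := hY.finite_allFace
  have := Fintype.ofFinite X.AllFace
  have := Fintype.ofFinite Y.AllFace
  induction p with
  | zero => exact ⟨0, fun C hC => absurd hC (Nat.not_lt_zero _)⟩
  | succ p ih =>
    obtain ⟨φ, hφ⟩ := ih
    have hlow : ∀ {G C : X.AllFace}, rank C.1 ≤ p → X.sign G.1 C.1 ≠ 0 → IsMatrixAt m φ G := by
      intro G C hC hs
      exact hφ G (by have := (sign_ne_zero hs).2.1; omega)
    have key : ∀ C : X.AllFace, rank C.1 = p → ∃ z : Y.AllFace → K,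
        (∀ D, z D ≠ 0 → Y.label D.1 ≤ m + X.label C.1) ∧
        (kdiff K Y z = fun D => ∑ᶠ G : X.AllFace, ((X.sign G.1 C.1 : ℤ) : K) * φ G D) ∧
        ∀ D : Y.AllFace, D.1 = PathPowers.translate (toPoint m) C.1 →
          z = Pi.single D ((translateSign X Y (toPoint m) C.1 : ℤ) : K) := by
      intro C hC
      -- On a cell whose translate is a cell the value is forced, and the chain map condition must
      -- be checked: by `lower` and `lift` the faces of the two cells correspond.
      by_cases hD : ∃ D : Y.AllFace, D.1 = PathPowers.translate (toPoint m) C.1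
      · obtain ⟨D, hD⟩ := hD
        refine ⟨Pi.single D ((translateSign X Y (toPoint m) C.1 : ℤ) : K), fun E hE => ?_, ?_,
          fun E hE => ?_⟩
        · have : E = D := by
            by_contra hne; exact hE (Pi.single_eq_of_ne hne _)
          rw [this]
          exact h.label_le C D hD
        · funext E
          rw [kdiff_single]
          by_cases hE : ∃ G : X.AllFace, E.1 = PathPowers.translate (toPoint m) G.1
          · obtain ⟨G, hG⟩ := hE
            rw [finsum_eq_single _ G fun G' hG' => ?_]
            · by_cases hs : X.sign G.1 C.1 = 0
              · have h1 := translateSign_mul_sign (X := X) (Y := Y) (toPoint m) (h.exposed C G)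
                rw [hs, mul_zero, eq_comm, mul_eq_zero, ← hD, ← hG] at h1
                have h2 : Y.sign E.1 D.1 = 0 := h1.resolve_right fun h3 =>
                  by
                    have := signType_mul_self
                      (translateSign_ne_zero (X := X) (Y := Y) (toPoint m) G.1)
                    rw [h3] at this
                    simp at this
                rw [hs, h2]; simp
              · rw [(hlow hC.le hs).translate E hG, Pi.single_eq_same]
                have h1 := translateSign_mul_sign (X := X) (Y := Y) (toPoint m) (h.exposed C G)
                rw [← hD, ← hG] at h1
                have hη := signType_mul_self
                  (translateSign_ne_zero (X := X) (Y := Y) (toPoint m) G.1)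
                have hη' := signType_mul_self
                  (translateSign_ne_zero (X := X) (Y := Y) (toPoint m) C.1)
                -- The identity of `translateSign_mul_sign`, solved for the other side by using that
                -- the translation signs square to 1.
                have h2 : Y.sign E.1 D.1 * (translateSign X Y (toPoint m) C.1 : ℤ) =
                    X.sign G.1 C.1 * (translateSign X Y (toPoint m) G.1 : ℤ) := by
                  linear_combination (-(Y.sign E.1 D.1 * (translateSign X Y (toPoint m) C.1 : ℤ))) *
                    hη + (X.sign G.1 C.1 * (translateSign X Y (toPoint m) G.1 : ℤ)) * hη' -
                    ((translateSign X Y (toPoint m) G.1 : ℤ) *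
                      (translateSign X Y (toPoint m) C.1 : ℤ)) * h1
                exact_mod_cast congrArg (fun z : ℤ => (z : K)) h2
            · by_cases hs : X.sign G'.1 C.1 = 0
              · rw [hs]; simp
              · obtain ⟨E', hE'⟩ := h.lower C D hD G' (sign_ne_zero hs).1
                rw [(hlow hC.le hs).translate E' hE', Pi.single_eq_of_ne, mul_zero]
                rintro rfl
                exact hG' (Subtype.ext (translate_injective _ (hE'.symm.trans hG)))
          · have h1 : Y.sign E.1 D.1 = 0 := by
              by_contra hne
              exact hE (h.lift C D hD E (sign_ne_zero hne).1)
            rw [h1, Int.cast_zero, zero_mul]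
            refine (finsum_eq_zero_of_forall_eq_zero fun G => ?_).symm
            by_cases hs : X.sign G.1 C.1 = 0
            · rw [hs]; simp
            · obtain ⟨E', hE'⟩ := h.lower C D hD G (sign_ne_zero hs).1
              rw [(hlow hC.le hs).translate E' hE', Pi.single_eq_of_ne, mul_zero]
              rintro rfl
              exact hE ⟨G, hE'⟩
        · rw [show E = D from Subtype.ext (hE.trans hD.symm)]
      · have hCc : C.1 ∈ X.cells := C.2.resolve_left fun h0 =>
          hD ⟨⟨∅, Or.inl rfl⟩, by rw [h0, translate_empty]⟩
        -- Elsewhere the image of the boundary is a cycle with labels ≤ m + a_C, and it bounds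
        -- because Y is acyclic in that degree.
        suffices hcyc : _ ∧ _ from
          let ⟨z, hz, hzw⟩ := hY.exact (m + X.label C.1) (h.exists_le C.1 hCc)
            (fun D => ∑ᶠ G : X.AllFace, ((X.sign G.1 C.1 : ℤ) : K) * φ G D) hcyc.1 hcyc.2
          ⟨z, hz, funext hzw, fun D hD' => absurd ⟨D, hD'⟩ hD⟩
        refine ⟨fun D hDne => ?_, fun E => ?_⟩
        · rw [finsum_eq_sum_of_fintype] at hDne
          obtain ⟨G, -, hG⟩ := Finset.exists_ne_zero_of_sum_ne_zero hDne
          have hs : X.sign G.1 C.1 ≠ 0 := fun h0 => hG (by rw [h0]; simp)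
          exact ((hlow hC.le hs).label_le D (right_ne_zero_of_mul hG)).trans
            (add_le_add_right (hX.label_le_of_sign hs) m)
        · have hsq := fun G => hX.sq G C
          simp only [finsum_eq_sum_of_fintype] at hsq ⊢
          simp_rw [Finset.mul_sum]
          rw [Finset.sum_comm]
          calc ∑ G : X.AllFace, ∑ D : Y.AllFace, ((Y.sign E.1 D.1 : ℤ) : K) *
                (((X.sign G.1 C.1 : ℤ) : K) * φ G D)
              = ∑ G : X.AllFace, ((X.sign G.1 C.1 : ℤ) : K) *
                  ∑ G' : X.AllFace, ((X.sign G'.1 G.1 : ℤ) : K) * φ G' E := by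
                refine Finset.sum_congr rfl fun G _ => ?_
                by_cases hs : X.sign G.1 C.1 = 0
                · simp [hs]
                · have h1 := congrFun (hlow hC.le hs).comm E
                  rw [kdiff, finsum_eq_sum_of_fintype, finsum_eq_sum_of_fintype] at h1
                  rw [← h1, Finset.mul_sum]
                  exact Finset.sum_congr rfl fun D _ => by ring
            _ = ∑ G' : X.AllFace, (∑ G : X.AllFace, ((X.sign G'.1 G.1 : ℤ) : K) *
                  ((X.sign G.1 C.1 : ℤ) : K)) * φ G' E := by
                simp_rw [Finset.mul_sum, Finset.sum_mul]
                rw [Finset.sum_comm]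
                exact Finset.sum_congr rfl fun _ _ => Finset.sum_congr rfl fun _ _ => by ring
            _ = 0 := Finset.sum_eq_zero fun G' _ => by rw [hsq G', zero_mul]
    choose! z hz using key
    refine ⟨fun C => if rank C.1 = p then z C else φ C, fun C hC => ?_⟩
    have hsum : ∀ D, ∑ᶠ G : X.AllFace, ((X.sign G.1 C.1 : ℤ) : K) *
        (if rank G.1 = p then z G else φ G) D =
        ∑ᶠ G : X.AllFace, ((X.sign G.1 C.1 : ℤ) : K) * φ G D := by
      intro D
      refine finsum_congr fun G => ?_
      by_cases hs : X.sign G.1 C.1 = 0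
      · simp [hs]
      · rw [if_neg (by have := (sign_ne_zero hs).2.1; omega)]
    by_cases hCp : rank C.1 = p
    · obtain ⟨h1, h2, h3⟩ := hz C hCp
      refine ⟨?_, ?_, ?_⟩ <;> simp only [if_pos hCp]
      · exact h1
      · rw [h2]
        exact funext fun D => (hsum D).symm
      · exact h3
    · have h0 := hφ C (by omega)
      refine ⟨?_, ?_, ?_⟩ <;> simp only [if_neg hCp]
      · exact h0.label_le
      · rw [h0.comm]
        exact funext fun D => (hsum D).symm
      · exact h0.translate

theorem homog_single [Finite X.AllFace] [DecidableEq X.AllFace] (b : Fin n →₀ ℕ) (p : ℕ)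
    (D : X.Face p) (c : K) : homog b p (Pi.single D.all c) =
      Finsupp.single D (MvPolynomial.monomial (b - X.label D.1) c) := by
  ext1 E
  rw [homog_apply]
  by_cases h : E = D
  · rw [h, Finsupp.single_eq_same, Pi.single_eq_same]
  · rw [Finsupp.single_eq_of_ne h, Pi.single_eq_of_ne fun h' => h (Face.all_injective p h'),
      map_zero]

theorem rank_le (C : Set (Fin n → ℝ)) : rank C ≤ n + 1 := by
  refine (Submodule.finrank_le _).trans ?_
  simp [add_comm]

theorem exists_isMultiplication (hX : X.IsAcyclic K) (hY : Y.IsAcyclic K) {m : Fin n →₀ ℕ}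
    (h : Translates X Y m) : ∃ f : ChainMap K X Y, f.IsMultiplication m := by
  classical
  have := hX.finite_allFace
  have := hY.finite_allFace
  -- Ranks are at most n + 1, the dimension of the homogeneous space, so n + 2 stages of the
  -- induction treat all faces.
  obtain ⟨φ, hφ'⟩ := exists_matrix hX hY h (n + 2)
  have hφ : ∀ C, IsMatrixAt m φ C := fun C => hφ' C (Nat.lt_succ_of_le (rank_le _))
  let app : ∀ p, X.Chain K p →ₗ[MvPolynomial (Fin n) K] Y.Chain K p := fun p =>
    Finsupp.linearCombination (MvPolynomial (Fin n) K)
      fun C : X.Face p => homog (m + X.label C.1) p (φ C.all)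
  have happ : ∀ p (C : X.Face p), app p (Finsupp.single C 1) =
      homog (m + X.label C.1) p (φ C.all) := fun p C => by
    simp only [app]
    rw [Finsupp.linearCombination_single, one_smul]
  have happ' : ∀ p (z : X.Chain K p) (D : Y.Face p), app p z D = ∑ᶠ C : X.Face p,
      z C * MvPolynomial.monomial (m + X.label C.1 - Y.label D.1) (φ C.all D.all) := by
    intro p z D
    have := Fintype.ofFinite (X.Face p)
    simp only [app]
    rw [Finsupp.linearCombination_apply]
    refine (DFunLike.congr_fun (Finsupp.sum_fintype z (fun (C : X.Face p) a => a •
      homog (m + X.label C.1) p (φ C.all)) (fun _ => zero_smul _ _)) D).trans ?_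
    rw [finsum_eq_sum_of_fintype, Finsupp.finsetSum_apply]
    rfl
  have hcomm : ∀ p, (app p).comp (X.bdry K p) = (Y.bdry K p).comp (app (p + 1)) := by
    intro p
    refine Finsupp.lhom_ext' fun C => LinearMap.ext_ring ?_
    change app p (X.bdry K p (Finsupp.single C 1)) = Y.bdry K p (app (p + 1) (Finsupp.single C 1))
    rw [happ, hY.bdry_homog (m + X.label C.1) p (y := φ C.all) (hφ C.all).label_le,
      (hφ C.all).comm]
    ext1 D
    have := Fintype.ofFinite X.AllFace
    have hR : homog (m + X.label C.1) p
        (fun D => ∑ᶠ G : X.AllFace, ((X.sign G.1 C.all.1 : ℤ) : K) * φ G D) D =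
        ∑ᶠ G : X.AllFace, MvPolynomial.monomial (m + X.label C.1 - Y.label D.1)
          (((X.sign G.1 C.1 : ℤ) : K) * φ G D.all) := by
      rw [homog_apply, finsum_eq_sum_of_fintype, finsum_eq_sum_of_fintype, map_sum]
      rfl
    rw [happ', hR, ← finsum_face p _ fun G hG => by
      rw [sign_eq_zero (by rw [C.2.2]; omega)]; simp]
    refine finsum_congr fun G => ?_
    have hb : X.bdry K p (Finsupp.single C 1) G =
        MvPolynomial.monomial (X.label C.1 - X.label G.1) ((X.sign G.1 C.1 : ℤ) : K) := by
      rw [bdry_apply, finsum_eq_single _ C fun F hF => by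
        rw [Finsupp.single_eq_of_ne hF, zero_mul], Finsupp.single_eq_same, one_mul]
    rw [hb, MvPolynomial.monomial_mul]
    by_cases hs : X.sign G.1 C.1 = 0
    · have hs' : X.sign G.all.1 C.1 = 0 := hs
      rw [hs, hs']; simp
    by_cases h0 : φ G.all D.all = 0
    · rw [h0]; simp
    have h1 : Y.label D.1 ≤ m + X.label G.1 := (hφ G.all).label_le D.all h0
    have h2 : X.label G.1 ≤ X.label C.1 := hX.label_le_of_sign (G := G.all) (F := C.all) hs
    congr 1
    congr 1
    ext i
    have h3 := h1 i
    have h4 := h2 i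
    simp only [Finsupp.add_apply, Finsupp.tsub_apply] at h3 ⊢
    omega
  refine ⟨⟨app, hcomm⟩, fun C D => ?_, fun p C D => ?_, fun p C D hD => ?_⟩
  · have hC : C = X.emptyFace₀ := C.eq_emptyFace₀ h.nonempty_left
    have hD : D = Y.emptyFace₀ := D.eq_emptyFace₀ h.nonempty_right
    have hDC : D.all.1 = translate (toPoint m) C.all.1 := by
      rw [hC, hD]; exact (translate_empty _).symm
    -- The empty face has the empty basis, whose determinant is 1; this gives multiplication by x ^
    -- m in degree 0 without a sign.
    have hη : translateSign X Y (toPoint m) C.all.1 = 1 := by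
      have : IsEmpty (Fin (rank C.all.1)) := by
        rw [show rank C.all.1 = 0 from C.2.2]; infer_instance
      rw [translateSign, orientSign, Module.Basis.det_isEmpty]
      simp
    change app 0 _ = _
    rw [happ, (hφ C.all).translate D.all hDC, homog_single, hη]
    have hl : X.label C.1 = 0 := by rw [hC]; exact label_empty
    have hl' : Y.label D.1 = 0 := by rw [hD]; exact label_empty
    rw [hl, hl', add_zero, tsub_zero]
    simp
  · change app p _ _ = 0 ∨ _ ∧ ∃ c, app p _ _ = _
    rw [happ, homog_apply]
    by_cases h0 : φ C.all D.all = 0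
    · left; rw [h0, map_zero]
    · right
      exact ⟨(hφ C.all).label_le D.all h0, _, rfl⟩
  · change app (p + 1) _ = _ ∨ app (p + 1) _ = _
    have hC : C.1 ∈ X.cells := C.2.1.resolve_left fun h0 => by
      have := C.2.2; rw [h0, rank_empty] at this; omega
    have hDc : D.1 ∈ Y.cells := D.2.1.resolve_left fun h0 => by
      have := D.2.2; rw [h0, rank_empty] at this; omega
    rw [happ, (hφ C.all).translate D.all hD, homog_single, h.label_eq _ hC _ hDc hD, tsub_self]
    have hη := translateSign_ne_zero (X := X) (Y := Y) (toPoint m) C.all.1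
    generalize translateSign X Y (toPoint m) C.all.1 = s at hη
    rcases s.trichotomy with rfl | rfl | rfl
    · right
      rw [← Finsupp.single_neg]
      simp [MvPolynomial.monomial_zero']
    · exact absurd rfl hη
    · left
      simp [MvPolynomial.monomial_zero']

end CellComplex

/-- Being a face is intrinsic to the larger cell, by `mem_cells_and_subset_iff`, and is preserved by
translation in both directions. Only the existence of small labels in Y remains as a hypothesis. -/
theorem Presentation.translates {n : ℕ} {P P' : Set (Fin n → ℝ)} {H H' : Set (HyperplaneData n)}
    (A : Presentation P H) (B : Presentation P' H') {X Y : CellComplex n}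
    (hX : X.cells = subdivisionCells P H) (hY : Y.cells = subdivisionCells P' H') {m : Fin n →₀ ℕ}
    (hle : ∀ C ∈ X.cells, ∃ D ∈ Y.cells, Y.label D ≤ m + X.label C) :
    CellComplex.Translates X Y m := by
  have hneX : ∀ C ∈ X.cells, C.Nonempty := fun C hC => by rw [hX] at hC; exact hC.1
  have hneY : ∀ C ∈ Y.cells, C.Nonempty := fun C hC => by rw [hY] at hC; exact hC.1
  have hexA : ∀ F G : X.AllFace, G.1 ⊆ F.1 → IsExposed ℝ F.1 G.1 := by
    rintro ⟨F, hF⟩ ⟨G, hG⟩ hGF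
    rcases hG with rfl | hG
    · exact fun h => absurd h Set.not_nonempty_empty
    rcases hF with rfl | hF
    · exact absurd ((hneX _ hG).mono hGF) Set.not_nonempty_empty
    rw [hX] at hF hG
    exact ((A.mem_cells_and_subset_iff hF).1 ⟨hG, hGF⟩).2
  have hexB : ∀ F G : Y.AllFace, G.1 ⊆ F.1 → IsExposed ℝ F.1 G.1 := by
    rintro ⟨F, hF⟩ ⟨G, hG⟩ hGF
    rcases hG with rfl | hG
    · exact fun h => absurd h Set.not_nonempty_empty
    rcases hF with rfl | hF
    · exact absurd ((hneY _ hG).mono hGF) Set.not_nonempty_empty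
    rw [hY] at hF hG
    exact ((B.mem_cells_and_subset_iff hF).1 ⟨hG, hGF⟩).2
  have hle' : ∀ (F : X.AllFace) (D : Y.AllFace), D.1 = translate (toPoint m) F.1 →
      Y.label D.1 ≤ m + X.label F.1 := by
    intro F D hD
    rw [B.label_le_iff hY D.2, hD]
    rintro _ ⟨y, hy, rfl⟩ i
    have := (A.label_le_iff hX F.2 _).1 le_rfl y hy i
    simp only [Pi.add_apply, Finsupp.add_apply, Nat.cast_add, toPoint]
    linarith
  refine ⟨hneX, hneY, hle, ?_, hexA, ?_, hle', ?_⟩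
  · intro F D hD G hGF
    rcases G.2 with h0 | hG
    · exact ⟨⟨∅, Or.inl rfl⟩, by rw [h0, translate_empty]⟩
    · have hex := isExposed_translate (toPoint m) (hexA F G hGF)
      have hne : (translate (toPoint m) G.1).Nonempty := (hneX _ hG).image _
      rw [← hD] at hex
      have hDc : D.1 ∈ subdivisionCells P' H' := hY ▸ D.2.resolve_left fun h0 =>
        (hne.mono hex.subset).ne_empty h0
      exact ⟨⟨_, Or.inr (hY ▸ ((B.mem_cells_and_subset_iff hDc).2 ⟨hne, hex⟩).1)⟩, rfl⟩
  · intro F D hD E hED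
    rcases E.2 with h0 | hE
    · exact ⟨⟨∅, Or.inl rfl⟩, by rw [h0, translate_empty]⟩
    · have hex := isExposed_translate (-toPoint m) (hexB D E hED)
      rw [hD, translate_neg_translate] at hex
      have hne : (translate (-toPoint m) E.1).Nonempty := (hneY _ hE).image _
      have hFc : F.1 ∈ subdivisionCells P H := hX ▸ F.2.resolve_left fun h0 =>
        (hne.mono hex.subset).ne_empty h0
      exact ⟨⟨_, Or.inr (hX ▸ ((A.mem_cells_and_subset_iff hFc).2 ⟨hne, hex⟩).1)⟩,
        (translate_translate_neg _ _).symm⟩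
  · intro F hF D hD hDF
    refine le_antisymm (hle' ⟨F, Or.inr hF⟩ ⟨D, Or.inr hD⟩ hDF) ?_
    have h1 := (B.label_le_iff hY (Or.inr hD) _).1 le_rfl
    have h2 : ∀ y ∈ F, ∀ i, y i + m i ≤ (Y.label D i : ℝ) := fun y hy i => by
      have := h1 (y + toPoint m) (by rw [hDF]; exact ⟨y, hy, rfl⟩) i
      simpa [toPoint] using this
    obtain ⟨N, hN⟩ := A.bdd
    -- Points of P have nonnegative coordinates, so those of the translate are at least m; this
    -- makes the truncated difference of labels genuine.
    have hm : m ≤ Y.label D := by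
      intro i
      obtain ⟨y, hy⟩ := hneX F hF
      have hyP : y ∈ P := by
        rw [hX] at hF
        obtain ⟨x, hx, rfl⟩ := A.mem_cells_iff.1 hF
        exact A.body_subset hx hy
      have h3 := h2 y hy i
      have h4 := (hN y hyP i).1
      exact_mod_cast (by linarith : (m i : ℝ) ≤ (Y.label D i : ℝ))
    have h5 : X.label F ≤ Y.label D - m := by
      rw [A.label_le_iff hX (Or.inr hF)]
      intro y hy i
      have h3 := h2 y hy i
      have h6 := hm i
      rw [Finsupp.tsub_apply, Nat.cast_sub h6]
      linarith
    calc m + X.label F ≤ m + (Y.label D - m) := add_le_add_right h5 m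
      _ = Y.label D := add_tsub_cancel_of_le hm

/-! ### Multiplication families -/

section Family

variable {K : Type*} [Field K] {n : ℕ} {X : ℕ → CellComplex n}

theorem ChainMap.IsMultiplication.exponent_unique {X Y : CellComplex n} {f : ChainMap K X Y}
    {m m' : Fin n →₀ ℕ} (h : f.IsMultiplication m) (h' : f.IsMultiplication m') : m = m' := by
  have h1 := (h.zero X.emptyFace₀ Y.emptyFace₀).symm.trans (h'.zero X.emptyFace₀ Y.emptyFace₀)
  exact MvPolynomial.monomial_left_injective one_ne_zero (Finsupp.single_injective _ h1)

/-- The compositions of given chain maps between consecutive complexes. -/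
inductive Generated (G : ∀ a, Set (ChainMap K (X a) (X (a + 1)))) :
    ∀ {a b : ℕ}, ChainMap K (X a) (X b) → Prop
  | id (a : ℕ) : Generated G (ChainMap.id K (X a))
  | step {a b : ℕ} (f : ChainMap K (X a) (X b)) (g : ChainMap K (X b) (X (b + 1))) :
      Generated G f → g ∈ G b → Generated G (g.comp f)

theorem Generated.comp {G : ∀ a, Set (ChainMap K (X a) (X (a + 1)))} {a b c : ℕ}
    {g : ChainMap K (X b) (X c)} {f : ChainMap K (X a) (X b)} (hg : Generated G g)
    (hf : Generated G f) : Generated G (g.comp f) := by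
  induction hg with
  | id => exact hf
  | step g' h _ hh ih => exact Generated.step (g'.comp f) h ih hh

theorem Generated.of_mem {G : ∀ a, Set (ChainMap K (X a) (X (a + 1)))} {a : ℕ}
    {g : ChainMap K (X a) (X (a + 1))} (hg : g ∈ G a) : Generated G g :=
  Generated.step _ g (Generated.id a) hg

/-- The number of factors is the difference of the indices. So the generated category has no new
morphisms between consecutive objects and no self-maps besides identities. -/
theorem Generated.cases_index {G : ∀ a, Set (ChainMap K (X a) (X (a + 1)))} {a b : ℕ}
    {f : ChainMap K (X a) (X b)} (hf : Generated G f) :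
    a ≤ b ∧ (b = a → HEq f (ChainMap.id K (X a))) ∧ (b = a + 1 → ∃ g ∈ G a, HEq f g) := by
  induction hf with
  | id => exact ⟨le_rfl, fun _ => HEq.rfl, fun h => by omega⟩
  | @step b f g _ hg ih =>
    obtain ⟨h1, h2, -⟩ := ih
    refine ⟨by omega, fun h => by omega, fun h => ?_⟩
    obtain rfl : b = a := by omega
    obtain rfl := eq_of_heq (h2 rfl)
    exact ⟨g, hg, HEq.rfl⟩

theorem Generated.mem {G : ∀ a, Set (ChainMap K (X a) (X (a + 1)))} {a : ℕ}
    {f : ChainMap K (X a) (X (a + 1))} (hf : Generated G f) : f ∈ G a := by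
  obtain ⟨g, hg, h⟩ := hf.cases_index.2.2 rfl
  rwa [eq_of_heq h]

/-- One multiplication is chosen for each generator and each index. Uniqueness holds because the
degree 0 part of a chain map determines the exponent. -/
theorem exists_multiplicationFamily (I : Ideal (MvPolynomial (Fin n) K))
    (h : ∀ a, ∀ m ∈ minGens I, ∃ f : ChainMap K (X a) (X (a + 1)), f.IsMultiplication m) :
    ∃ F : Family K X, F.IsMultiplicationFamily I := by
  choose μ hμ using h
  let G : ∀ a, Set (ChainMap K (X a) (X (a + 1))) := fun a => {f | ∃ m hm, f = μ a m hm}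
  let F : Family K X :=
    { homs := fun a b => {f | Generated G f}
      id_mem := fun a => Generated.id a
      comp_mem := fun hg hf => Generated.comp hg hf }
  refine ⟨F, fun a b f hf => ?_, fun a m hm => ⟨μ a m hm, ⟨Generated.of_mem ⟨m, hm, rfl⟩, hμ a m hm⟩,
    ?_⟩, fun a f hf => ?_⟩
  · have hf' : Generated G f := hf
    clear hf
    induction hf' with
    | id => exact Family.Composite.id a
    | step f g _ hg ih => exact Family.Composite.step f g ih (Generated.of_mem hg)
  · rintro f ⟨hf, hfm⟩
    obtain ⟨m', hm', rfl⟩ := Generated.mem hf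
    obtain rfl := hfm.exponent_unique (hμ a m' hm')
    rfl
  · obtain ⟨m, hm, rfl⟩ := Generated.mem hf
    exact ⟨m, hm, hμ a m hm⟩

/-- The boundaries of the cells generate the syzygy modules. Those in the finitely many complexes up
to index D suffice: later cells are translates, and a multiplication carries the boundary of a cell
to ± that of its translate. -/
theorem finitelyGeneratedRep_syzygyFunctor {I : Ideal (MvPolynomial (Fin n) K)} {F : Family K X}
    (hF : F.IsMultiplicationFamily I) (hfin : ∀ a, Finite (X a).AllFace) (D : ℕ)
    (hstep : ∀ a, D ≤ a → ∀ C ∈ (X (a + 1)).cells, ∃ m ∈ minGens I, ∃ C' ∈ (X a).cells,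
      C = translate (toPoint m) C') (p : ℕ) : FinitelyGeneratedRep (F.syzygyFunctor p) := by
  let gen : ∀ a, (X a).Face (p + 1) → (X a).syz K p := fun a C =>
    ⟨(X a).bdry K p (Finsupp.single C 1), ⟨_, rfl⟩⟩
  refine ⟨⋃ a ∈ Set.Iic D, Set.range fun C : (X a).Face (p + 1) =>
    (⟨⟨a⟩, gen a C⟩ : Σ c : F.Obj, (F.syzygyFunctor p).obj c),
    (Set.finite_Iic D).biUnion fun a _ => Set.finite_range _, fun N hN hT => ?_⟩
  have hgen : ∀ a (C : (X a).Face (p + 1)), gen a C ∈ N ⟨a⟩ := by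
    intro a
    induction a with
    | zero =>
      intro C
      exact hT ⟨⟨0⟩, gen 0 C⟩ (Set.mem_biUnion (Set.mem_Iic.2 (Nat.zero_le D)) ⟨C, rfl⟩)
    | succ a ih =>
      intro C
      by_cases ha : a + 1 ≤ D
      · exact hT ⟨⟨a + 1⟩, gen (a + 1) C⟩ (Set.mem_biUnion (Set.mem_Iic.2 ha) ⟨C, rfl⟩)
      · have hC : C.1 ∈ (X (a + 1)).cells := C.2.1.resolve_left fun h0 => by
          have := C.2.2; rw [h0, rank_empty] at this; omega
        obtain ⟨m, hm, C', hC', hCC'⟩ := hstep a (by omega) C.1 hC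
        let E : (X a).Face (p + 1) := ⟨C', Or.inr hC', by
          rw [← rank_translate (toPoint m), ← hCC']; exact C.2.2⟩
        obtain ⟨f, ⟨hf, hfm⟩, -⟩ := hF.exists_unique a m hm
        have h1 := hN ⟨a⟩ ⟨a + 1⟩ ⟨f, hf⟩ (gen a E) (ih E)
        have h2 : f.app p ((X a).bdry K p (Finsupp.single E 1)) =
            (X (a + 1)).bdry K p (f.app (p + 1) (Finsupp.single E 1)) :=
          LinearMap.congr_fun (f.comm p) _
        rcases hfm.translate p E C hCC' with h3 | h3
        · have h4 : ((F.syzygyFunctor p).map (X := ⟨a⟩) (Y := ⟨a + 1⟩) ⟨f, hf⟩).hom (gen a E) =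
              gen (a + 1) C := Subtype.ext (h2.trans (by rw [h3]))
          rwa [h4] at h1
        · have h4 : (-1 : MvPolynomial (Fin n) K) •
              ((F.syzygyFunctor p).map (X := ⟨a⟩) (Y := ⟨a + 1⟩) ⟨f, hf⟩).hom (gen a E) =
              gen (a + 1) C := Subtype.ext (by
            change (-1 : MvPolynomial (Fin n) K) • f.app p ((X a).bdry K p (Finsupp.single E 1)) =
              (X (a + 1)).bdry K p (Finsupp.single C 1)
            rw [h2, h3, map_neg, neg_one_smul, neg_neg])
          rw [← h4]
          exact (N ⟨a + 1⟩).smul_mem (-1) h1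
  rintro ⟨a⟩
  rw [Submodule.eq_top_iff']
  rintro ⟨_, w, rfl⟩
  have hw : ∀ w, ((X a).bdry K p).rangeRestrict w ∈ N ⟨a⟩ := by
    intro w
    induction w using Finsupp.induction_linear with
    | zero => rw [map_zero]; exact (N ⟨a⟩).zero_mem
    | add u v hu hv => rw [map_add]; exact (N ⟨a⟩).add_mem hu hv
    | single C r =>
      have h1 : Finsupp.single C r = r • Finsupp.single C (1 : MvPolynomial (Fin n) K) := by
        rw [Finsupp.smul_single, smul_eq_mul, mul_one]
      rw [h1, map_smul]
      exact (N ⟨a⟩).smul_mem r (hgen a C)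
  exact hw w

end Family

/-! ### Translation of the cells for the path -/

/-- A description of closed cells by facets and hyperplanes alone, which allows cells for different
powers, with different sets of functionals, to be compared. -/
theorem Presentation.mem_body_iff {n : ℕ} {P : Set (Fin n → ℝ)} {H : Set (HyperplaneData n)}
    (A : Presentation P H) {y z : Fin n → ℝ} (hy : y ∈ P) : z ∈ A.body (A.sg (1, y)) ↔
      z ∈ P ∧ (∀ e ∈ A.facets, A.a e (1, y) = 0 → A.a e (1, z) = 0) ∧
        ∀ h ∈ H, (h.2 ≤ h.1 y → h.2 ≤ h.1 z) ∧ (h.1 y ≤ h.2 → h.1 z ≤ h.2) := by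
  constructor
  · intro hz
    have hzP := A.body_subset hy hz
    refine ⟨hzP, fun e _ he => A.apply_eq_zero_of_mem_body hz (A.sg_zero_iff.2 he), fun h hh => ?_⟩
    rcases A.hyp h hh with ⟨e, he⟩ | hlt
    · have h1 := hz e
      rw [A.sg_apply, A.sg_apply, he, he] at h1
      simp only [mul_one] at h1
      rcases h1 with h1 | h1
      · have h2 : h.1 z = h.2 := sub_eq_zero.1 (sign_eq_zero_iff.1 h1)
        exact ⟨fun _ => h2.ge, fun _ => h2.le⟩
      · rcases lt_trichotomy (h.1 y - h.2) 0 with h3 | h3 | h3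
        · rw [sign_neg h3, sign_eq_neg_one_iff] at h1
          exact ⟨fun h4 => by linarith, fun _ => by linarith⟩
        · rw [h3, sign_zero, sign_eq_zero_iff] at h1
          exact ⟨fun _ => by linarith, fun _ => by linarith⟩
        · rw [sign_pos h3, sign_eq_one_iff] at h1
          exact ⟨fun _ => by linarith, fun h4 => by linarith⟩
    · exact ⟨fun h1 => absurd (hlt y hy) (not_lt.2 h1), fun _ => (hlt z hzP).le⟩
  · rintro ⟨hzP, hf, hH⟩ e
    rw [A.sg_apply, A.sg_apply]
    rcases A.cover e with rfl | he | ⟨h, hh, he⟩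
    · right; rw [A.t_apply, A.t_apply]
    · have h1 := (A.mem_iff z).1 hzP e he
      have h2 := (A.mem_iff y).1 hy e he
      rcases h1.eq_or_lt with h3 | h3
      · left; rw [← h3, sign_zero]
      · rcases h2.eq_or_lt with h4 | h4
        · exact absurd (hf e he h4.symm) h3.ne'
        · right; rw [sign_pos h3, sign_pos h4]
    · have h1 := hH h hh
      rw [he, he]
      simp only [mul_one]
      rcases lt_trichotomy (h.1 z - h.2) 0 with h3 | h3 | h3
      · right
        rw [sign_neg h3, eq_comm, sign_eq_neg_one_iff]
        by_contra hc
        have := h1.1 (by linarith)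
        linarith
      · left; rw [h3, sign_zero]
      · right
        rw [sign_pos h3, eq_comm, sign_eq_one_iff]
        by_contra hc
        have := h1.2 (by linarith)
        linarith

variable {n d : ℕ} {Q : Finset ℕ}

theorem mem_path_body_iff {y z : Fin n → ℝ} (hy : y ∈ pathPolytope n d) :
    z ∈ (pathPresentation n d Q).body ((pathPresentation n d Q).sg (1, y)) ↔
      z ∈ pathPolytope n d ∧
      (∀ k < n, altSum k y = altSum (k + 1) y → altSum k z = altSum (k + 1) z) ∧
      ∀ s ∈ Q, ∀ (i : Fin n) (j : ℕ), ((j : ℝ) ≤ stepForm s i y → (j : ℝ) ≤ stepForm s i z) ∧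
        (stepForm s i y ≤ j → stepForm s i z ≤ j) := by
  rw [(pathPresentation n d Q).mem_body_iff hy]
  refine and_congr_right fun hz => and_congr ⟨fun h k hk h1 => ?_, fun h e he h1 => ?_⟩
    ⟨fun h s hs i j => h _ ⟨s, hs, i, j, rfl⟩, ?_⟩
  · have h2 := h (some (.inl ⟨k, hk⟩)) (Or.inl ⟨_, rfl⟩) (by
      change altSum (k + 1) y - altSum k y = 0
      rw [h1, sub_self])
    change altSum (k + 1) z - altSum k z = 0 at h2
    linarith
  · rcases he with ⟨k, rfl⟩ | ⟨j, rfl⟩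
    · change altSum (k.val + 1) y - altSum k.val y = 0 at h1
      change altSum (k.val + 1) z - altSum k.val z = 0
      rw [h k k.isLt (by linarith), sub_self]
    · change pathFunctional n d Q _ _ = 0
      fin_cases j <;> simp [pathFunctional, hz.2.1, hz.2.2]
  · rintro h _ ⟨s, hs, i, j, rfl⟩
    exact h s hs i j

theorem altSum_le_add {y z : Fin n → ℝ} (h : ∀ i, y i ≤ z i + 1) {k : ℕ} :
    altSum k y ≤ altSum k z + n := by
  by_cases hk : k - 1 < n ∧ 0 < k
  · rw [altSum, dif_pos hk, stepForm_apply, stepForm_apply]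
    refine (Finset.sum_le_sum fun t _ => h _).trans ?_
    rw [Finset.sum_add_distrib]
    refine add_le_add_right ?_ _
    simp only [Finset.sum_const, Finset.card_range, nsmul_eq_mul, mul_one]
    have := Nat.div_le_self (k - 1) 2
    exact_mod_cast (by omega : (k - 1) / 2 + 1 ≤ n)
  · simp [altSum, dif_neg hk]

/-- The coordinate hyperplanes confine a cell to a unit interval in each coordinate, here from ⌊y i⌋
to ⌊y i⌋ + 1. -/
theorem le_add_one_of_mem_body (hQ : 0 ∈ Q) {y z : Fin n → ℝ} (hy : y ∈ pathPolytope n d)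
    (hz : z ∈ (pathPresentation n d Q).body ((pathPresentation n d Q).sg (1, y))) (i : Fin n) :
    y i ≤ z i + 1 ∧ z i ≤ y i + 1 := by
  have h := ((mem_path_body_iff hy).1 hz).2.2 0 hQ i
  simp only [stepForm_zero, LinearMap.proj_apply] at h
  have h1 := (h ⌊y i⌋₊).1 (Nat.floor_le (nonneg_of_mem hy i))
  have h2 := (h (⌊y i⌋₊ + 1)).2 (by push_cast; exact (Nat.lt_floor_add_one _).le)
  have h3 := Nat.lt_floor_add_one (y i)
  have h4 := Nat.floor_le (nonneg_of_mem hy i)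
  push_cast at h2
  exact ⟨by linarith, by linarith⟩

theorem exists_stepForm_toPoint (s : ℕ) (i : Fin n) (a : Fin n →₀ ℕ) :
    ∃ q : ℕ, stepForm s i (toPoint a) = q := by
  rw [stepForm_apply]
  exact ⟨∑ t ∈ Finset.range (i.val / s + 1), a ⟨i.val - s * t, by omega⟩, by simp [toPoint]⟩

/-- Subtracting an edge shifts every step form by an integer, so it respects the hyperplanes; only
the facet inequality of that edge could fail, and it is far from active on the whole cell. -/
theorem exists_translate_eq (hQ : 0 ∈ Q) (hd : n * (2 * n + 1) ≤ d) {C : Set (Fin n → ℝ)}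
    (hC : C ∈ subdivisionCells (pathPolytope n (d + 1)) (stepFamily n Q)) :
    ∃ k, k + 1 < n ∧ ∃ C' ∈ subdivisionCells (pathPolytope n d) (stepFamily n Q),
      C = translate (toPoint (edgeVec n k)) C' := by
  let A := pathPresentation n d Q
  obtain ⟨y, hy, rfl⟩ := (pathPresentation n (d + 1) Q).mem_cells_iff.1 hC
  -- The constant is 2n + 1 because each of the two alternating sums varies by at most n within a
  -- cell, and an increment of at least 1 must remain.
  obtain ⟨k, hk, hyk⟩ := exists_increment_pos (c := 2 * n + 1) (by positivity)
    (by exact_mod_cast Nat.lt_succ_of_le hd) hy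
  have hinc : ∀ z ∈ (pathPresentation n (d + 1) Q).body ((pathPresentation n (d + 1) Q).sg (1, y)),
      altSum k z + 1 ≤ altSum (k + 1) z := by
    intro z hz
    have h1 := altSum_le_add (k := k + 1) fun i => (le_add_one_of_mem_body hQ hy hz i).1
    have h2 := altSum_le_add (k := k) fun i => (le_add_one_of_mem_body hQ hy hz i).2
    linarith
  set m := toPoint (edgeVec n k) with hm
  have hy1 : altSum k y + 1 ≤ altSum (k + 1) y := by
    have : (0 : ℝ) ≤ n := Nat.cast_nonneg n
    linarith
  have hy' : y - m ∈ pathPolytope n d := sub_edgeVec_mem hk hy hy1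
  have hstep : ∀ (x : Fin n → ℝ) (j : ℕ), j < n → j ≠ k →
      altSum (j + 1) (x - m) - altSum j (x - m) = altSum (j + 1) x - altSum j x := by
    intro x j hj hjk
    rw [map_sub, map_sub, altSum_edgeVec (by omega), altSum_edgeVec (by omega)]
    split_ifs <;> first | omega | ring
  have hstepk : ∀ x : Fin n → ℝ,
      altSum (k + 1) (x - m) - altSum k (x - m) = altSum (k + 1) x - altSum k x - 1 := by
    intro x
    rw [map_sub, map_sub, altSum_edgeVec (by omega), altSum_edgeVec (by omega)]
    simp
    ring
  refine ⟨k, hk, A.body (A.sg (1, y - m)), A.mem_cells_iff.2 ⟨_, hy', rfl⟩, ?_⟩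
  have key : ∀ z, z ∈ (pathPresentation n (d + 1) Q).body
      ((pathPresentation n (d + 1) Q).sg (1, y)) ↔ z - m ∈ A.body (A.sg (1, y - m)) := by
    intro z
    constructor
    · intro hz
      have hz' := (mem_path_body_iff hy).1 hz
      refine (mem_path_body_iff hy').2 ⟨sub_edgeVec_mem hk hz'.1 (hinc z hz), fun j hj hjy => ?_,
        fun s hs i j => ?_⟩
      · by_cases hjk : j = k
        · subst hjk
          have := hstepk y
          have : (0 : ℝ) ≤ n := Nat.cast_nonneg n
          linarith
        · have h1 := hstep y j hj hjk
          have h2 := hstep z j hj hjk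
          have h3 := hz'.2.1 j hj (by linarith)
          linarith
      · obtain ⟨q, hq⟩ := exists_stepForm_toPoint s i (edgeVec n k)
        have h1 := hz'.2.2 s hs i (j + q)
        rw [map_sub, map_sub, hq]
        push_cast at h1
        exact ⟨fun h => by have := h1.1 (by linarith); linarith,
          fun h => by have := h1.2 (by linarith); linarith⟩
    · intro hz
      have hz' := (mem_path_body_iff hy').1 hz
      have hzP : z ∈ pathPolytope n (d + 1) := by
        have := add_edgeVec_mem hk hz'.1
        rwa [← hm, sub_add_cancel] at this
      refine (mem_path_body_iff hy).2 ⟨hzP, fun j hj hjy => ?_, fun s hs i j => ?_⟩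
      · by_cases hjk : j = k
        · subst hjk
          linarith
        · have h1 := hstep y j hj hjk
          have h2 := hstep z j hj hjk
          have h3 := hz'.2.1 j hj (by linarith)
          linarith
      · obtain ⟨q, hq⟩ := exists_stepForm_toPoint s i (edgeVec n k)
        have hzq : stepForm s i (z - m) = stepForm s i z - q := by rw [map_sub, hq]
        have hyq : stepForm s i (y - m) = stepForm s i y - q := by rw [map_sub, hq]
        by_cases hjq : q ≤ j
        · have h1 := hz'.2.2 s hs i (j - q)
          rw [hzq, hyq, Nat.cast_sub hjq] at h1
          exact ⟨fun h => by have := h1.1 (by linarith); linarith,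
            fun h => by have := h1.2 (by linarith); linarith⟩
        -- A level j < q would be shifted to a negative one, for which there is no hyperplane; but
        -- the step forms are nonnegative after the shift, so both points are strictly above it.
        · have h1 := stepForm_nonneg hz'.1 s i
          have h2 := stepForm_nonneg hy' s i
          have h3 : (j : ℝ) < q := by exact_mod_cast not_le.1 hjq
          exact ⟨fun _ => by linarith, fun h => by linarith⟩
  ext z
  rw [key]
  exact ⟨fun h => ⟨z - m, h, sub_add_cancel z m⟩, by
    rintro ⟨x, hx, rfl⟩
    rwa [add_sub_cancel_right]⟩

end PathPowers

end

/-! ### The theorem for the three sequences of subdivisions -/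

theorem mainTheorem9 (K : Type*) [Field K] (n : ℕ)
    (H : Set (PathPowers.HyperplaneData n))
    (hH : H = PathPowers.hyperplanesY n ∨ H = PathPowers.hyperplanesZ n ∨
      H = PathPowers.hyperplanesZbar n)
    (o : ℕ → PathPowers.CellOrientation n)
    (X : ℕ → PathPowers.CellComplex n)
    (hX : ∀ d, X d = PathPowers.newtonComplex (PathPowers.pathIdeal K n ^ (d + 1)) H (o d)) :
    -- the vertices of the first two complexes are the exponent vectors of the generators
    ((H = PathPowers.hyperplanesY n ∨ H = PathPowers.hyperplanesZ n) → ∀ d (v : Fin n → ℝ), {v} ∈ (X d).cells ↔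
      ∃ a ∈ PathPowers.minGens (PathPowers.pathIdeal K n ^ (d + 1)), v = PathPowers.toPoint a) ∧
    -- the complexes support cellular resolutions of the powers
    (∀ d, (X d).SupportsResolution K (PathPowers.pathIdeal K n ^ (d + 1))) ∧
    -- the multiplications by the generators make them into a family
    (∃ F : PathPowers.Family K X, F.IsMultiplicationFamily (PathPowers.pathIdeal K n)) ∧
    -- the family has finitely generated syzygies
    (∀ F : PathPowers.Family K X, F.IsMultiplicationFamily (PathPowers.pathIdeal K n) →
      ∀ p, PathPowers.FinitelyGeneratedRep (F.syzygyFunctor p)) := by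
  -- From here on the three cases differ only in the set Q of steps, of which 0 ∈ Q is all that is
  -- needed outside the statement on vertices.
  obtain ⟨Q, hQ, rfl⟩ : ∃ Q : Finset ℕ, 0 ∈ Q ∧ H = PathPowers.stepFamily n Q := by
    rcases hH with rfl | rfl | rfl
    · exact ⟨_, by simp, PathPowers.hyperplanesY_eq n⟩
    · exact ⟨_, by simp, PathPowers.hyperplanesZ_eq n⟩
    · exact ⟨_, by simp, PathPowers.hyperplanesZbar_eq n⟩
  have hcells : ∀ d, (X d).cells = PathPowers.subdivisionCells
      (PathPowers.pathPolytope n (d + 1)) (PathPowers.stepFamily n Q) := fun d => by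
    rw [hX d, PathPowers.cells_newtonComplex K d.succ_pos]
  have hac : ∀ d, (X d).IsAcyclic K := fun d =>
    (PathPowers.pathPresentation n (d + 1) Q).isAcyclic K (hcells d)
      (PathPowers.coordHyperplanes_subset hQ)
  refine ⟨fun hYZ d v => ?_, fun d => PathPowers.supportsResolution_path K hQ (hcells d),
    PathPowers.exists_multiplicationFamily _ fun d m hm => ?_, fun F hF p =>
      PathPowers.finitelyGeneratedRep_syzygyFunctor hF (fun d => (hac d).finite_allFace)
        (n * (2 * n + 1)) (fun d hd C hC => ?_) p⟩
  -- The set Q is no longer known explicitly, so the hyperplanes are rewritten with an explicit set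
  -- of steps contained in {0, 2}.
  · have hvert : ∀ R : Finset ℕ, 0 ∈ R → R ⊆ {0, 2} →
        PathPowers.stepFamily n Q = PathPowers.stepFamily n R →
        ({v} ∈ (X d).cells ↔ ∃ a ∈ PathPowers.minGens (PathPowers.pathIdeal K n ^ (d + 1)),
          v = PathPowers.toPoint a) := by
      intro R hR hR' hQR
      rw [hcells, hQR, PathPowers.vertex_iff hR hR']
      simp only [PathPowers.mem_minGens_iff]
    rcases hYZ with h | h
    · exact hvert {0} (by simp) (by simp) (h.trans (PathPowers.hyperplanesY_eq n))
    · exact hvert ({0} ∪ {2}) (by simp) subset_rfl (h.trans (PathPowers.hyperplanesZ_eq n))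
  · obtain ⟨k, hk, rfl⟩ := (PathPowers.mem_minGens_pathIdeal_iff K n m).1 hm
    refine PathPowers.CellComplex.exists_isMultiplication (hac d) (hac (d + 1))
      ((PathPowers.pathPresentation n (d + 1) Q).translates
        (PathPowers.pathPresentation n (d + 1 + 1) Q) (hcells d) (hcells (d + 1)) fun C hC => ?_)
    obtain ⟨y, hy⟩ := PathPowers.nonempty_of_mem_cells (hcells d) hC
    obtain ⟨a, ha, -, hcell, hl⟩ := PathPowers.exists_cell_label_le hQ (hcells (d + 1))
      (PathPowers.add_edgeVec_mem hk (PathPowers.subset_of_mem_cells (hcells d) hC hy))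
      (b := PathPowers.edgeVec n k + (X d).label C) (fun i => by
        have := ((PathPowers.pathPresentation n (d + 1) Q).label_le_iff (hcells d) (Or.inr hC)
          _).1 le_rfl y hy i
        simp only [Pi.add_apply, Finsupp.add_apply, Nat.cast_add, PathPowers.toPoint]
        linarith)
    exact ⟨_, hcell, hl.trans ha⟩
  · rw [hcells] at hC
    obtain ⟨k, hk, C', hC', h⟩ := PathPowers.exists_translate_eq hQ (hd.trans d.le_succ) hC
    exact ⟨_, (PathPowers.mem_minGens_pathIdeal_iff K n _).2 ⟨k, hk, rfl⟩, C',
      by rw [hcells]; exact hC', h⟩
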